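/- For each integer $n\ge 1$ consider an $M/M/n$-JSQ system: there are $n$ servers, each with its own queue served first-in-first-out, at time $0$ server $v$ has a random number of customers (including the one in service), all service times (for customers present at time $0$: the remaining service times) are exponential of rate $1$, customers arrive in a Poisson process of rate $\lambda_n n$, and each arriving customer joins a server with the smallest number of customers, ties being broken uniformly at random; initial queue lengths, interarrival times, service times and tie-breaks are independent. Let $0<\lambda_n<1$ and $\lim_{n\to\infty}\sqrt n\,(1-\lambda_n)=\beta$ for a fixed $\beta>0$. Let $Q_i^n(s)$ be the number of queues with at least $i$ customers (including the one in service) at time $s$, and put $X_1^n=(Q_1^n-n)/\sqrt n$ and $X_i^n=Q_i^n/\sqrt n$ for $i\ge 2$. Suppose that there are $k$ and a random vector $(X_1(0),\dots,X_k(0))$ such that $X_i^n(0)$ converges in distribution to $X_i(0)$ for $1\le i\le k$, and $X_i^n(0)=0$ almost surely for all $i>k$ and all $n$. Fix $t\ge 0$ and let $Z_t^n$ be the aggregate waiting time (from arrival to the beginning of service) of the customers who arrive in $[0,t]$. Then $$\lim_{C\to\infty}\limsup_{n\to\infty}\mathbb P\left(Z_t^n\ge C\sqrt n\right)=0.$$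 If $t>0$, then the number $A_t^n$ of arrivals in $[0,t]$ is $\Theta(n)$ with high probability, that is, there are constants $0<c_1\le c_2$ with $\mathbb P(c_1 n\le A_t^n\le c_2 n)\to 1$, and the waiting time per arrival is $O(1/\sqrt n)$ with high probability: $$\lim_{C\to\infty}\limsup_{n\to\infty}\mathbb P\left(\frac{Z_t^n}{A_t^n}\ge \frac{C}{\sqrt n}\right)=0.$$ The two displayed statements also hold if $Z_t^n$ is replaced by the total waiting time $\int_0^t\sum_{i\ge 2}Q_i^n(s)\,ds$ that all customers accumulate during $[0,t]$. -/

import Mathlib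

open MeasureTheory ProbabilityTheory Filter Topology
open scoped ENNReal

noncomputable section

namespace JSQ

/-- The names of the random numbers that drive a system with `n` servers. Customers that arrive
after time `0` are numbered `j = 0, 1, 2, …` in the order of their arrival; the customers present
at time `0` at server `v` are numbered `i = 0, 1, 2, …` in the order in which they are served. -/
inductive Clock (n : ℕ) : Type
  /-- the (remaining) service time of the `i`-th customer present at server `v` at time `0` -/
  | initialService (v : Fin n) (i : ℕ)
  /-- the time between the arrivals of the customers `j - 1` and `j` (time `0` and customer `0`,
  if `j = 0`) -/
  | interarrival (j : ℕ)
  /-- the service time of customer `j` -/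
  | service (j : ℕ)
  /-- the number that breaks the tie, if any, between the servers that customer `j` may join -/
  | tieBreak (j : ℕ)

/-- Services are exponential of rate `1`, arrivals form a Poisson process of rate `lam * n`,
and ties are broken by uniform numbers. -/
def Clock.law (n : ℕ) (lam : ℝ) : Clock n → Measure ℝ
  | .initialService _ _ => expMeasure 1
  | .interarrival _ => expMeasure (lam * n)
  | .service _ => expMeasure 1
  | .tieBreak _ => volume.restrict (Set.Icc 0 1)

/-- The random input of an `M/M/n`-JSQ system with total arrival rate `lam * n`: the queue lengths
`init v` at time `0` (with the customer in service) are arbitrary random variables, the clocks are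
mutually independent, independent of `init`, and have the laws above. -/
structure IsInput {Ω : Type*} [MeasurableSpace Ω] (P : Measure Ω) (n : ℕ) (lam : ℝ)
    (init : Ω → Fin n → ℕ) (clock : Clock n → Ω → ℝ) : Prop where
  measurable_init : Measurable init
  measurable_clock : ∀ c, Measurable (clock c)
  hasLaw_clock : ∀ c, HasLaw (clock c) (Clock.law n lam c) P
  iIndepFun_clock : iIndepFun clock P
  indepFun_init_clock : IndepFun init (fun ω c => clock c ω) P

/-! ### The dynamics

Below, `q₀` is a vector of initial queue lengths and `x` a realization of the clocks. -/

section Dynamics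

variable {n : ℕ}

/-- The arrival time of customer `j`. -/
def arrivalTime (x : Clock n → ℝ) (j : ℕ) : ℝ :=
  ∑ i ∈ Finset.range (j + 1), x (.interarrival i)

/-- The number of customers who are at a server at time `s`, if `d` lists the departure times of
all customers who have joined it until then. -/
def remaining (d : List ℝ) (s : ℝ) : ℕ := (d.filter (fun y => s < y)).length

/-- The set of servers with a shortest queue. -/
def shortest (q : Fin n → ℕ) : Finset (Fin n) :=
  Finset.univ.filter (fun v => ∀ w, q v ≤ q w)

theorem shortest_card_pos [NeZero n] (q : Fin n → ℕ) : 0 < (shortest q).card := by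
  obtain ⟨v, hv⟩ := Finite.exists_min q
  exact Finset.card_pos.mpr ⟨v, by simpa [shortest] using hv⟩

/-- The server with a shortest queue that is joined when the tie-breaking number is `u`: if there
are `m` candidates, then `[0, 1]` is cut into `m` intervals of the same length, one for each. -/
def joined [NeZero n] (q : Fin n → ℕ) (u : ℝ) : Fin n :=
  (shortest q).orderEmbOfFin rfl
    ⟨min ⌊u * (shortest q).card⌋₊ ((shortest q).card - 1),
      (min_le_right _ _).trans_lt (Nat.sub_lt (shortest_card_pos q) one_pos)⟩

/-- First-in-first-out service: a customer who arrives at time `s` at a server with departure times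
`d` of the earlier customers enters service as soon as all of those have left, and at time `s` if
they have left before. -/
def serviceStart (d : List ℝ) (s : ℝ) : ℝ := d.foldr max s

/-- The departure times of the customers present at server `v` at time `0`. -/
def initialDepartures (q₀ : Fin n → ℕ) (x : Clock n → ℝ) (v : Fin n) : List ℝ :=
  (List.range (q₀ v)).map (fun i => ∑ l ∈ Finset.range (i + 1), x (.initialService v l))

/-- The server joined by customer `j`, if `d v` lists the departure times of all earlier customers
of server `v`. -/
def serverOf [NeZero n] (x : Clock n → ℝ) (j : ℕ) (d : Fin n → List ℝ) : Fin n :=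
  joined (fun v => remaining (d v) (arrivalTime x j)) (x (.tieBreak j))

/-- `departures q₀ x j v` lists, in the order of their arrival, the departure times of those
customers of server `v` who were present at time `0` or are numbered `0, …, j - 1`. -/
def departures [NeZero n] (q₀ : Fin n → ℕ) (x : Clock n → ℝ) : ℕ → Fin n → List ℝ
  | 0 => initialDepartures q₀ x
  | j + 1 =>
    let d := departures q₀ x j
    let v := serverOf x j d
    Function.update d v
      (d v ++ [serviceStart (d v) (arrivalTime x j) + x (.service j)])

/-- The waiting time of customer `j`, from the arrival to the beginning of the service. -/
def waitingTime [NeZero n] (q₀ : Fin n → ℕ) (x : Clock n → ℝ) (j : ℕ) : ℝ :=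
  serviceStart (departures q₀ x j (serverOf x j (departures q₀ x j))) (arrivalTime x j)
    - arrivalTime x j

/-- The number of customers who arrive in `[0, t]`. -/
def arrivals (x : Clock n → ℝ) (t : ℝ) : ℕ∞ := {j | arrivalTime x j ≤ t}.encard

/-- The aggregate waiting time of the customers who arrive in `[0, t]`. -/
def aggregateWait [NeZero n] (q₀ : Fin n → ℕ) (x : Clock n → ℝ) (t : ℝ) : ℝ≥0∞ :=
  ∑' j : {j | arrivalTime x j ≤ t}, ENNReal.ofReal (waitingTime q₀ x j)

/-- The number of customers at server `v` at time `t`, with the one in service. (Almost surely,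
only finitely many customers arrive in `[0, t]`.) -/
def queueLength [NeZero n] (q₀ : Fin n → ℕ) (x : Clock n → ℝ) (t : ℝ) (v : Fin n) : ℕ :=
  remaining (departures q₀ x (arrivals x t).toNat v) t

/-- The number of queues with at least `i` customers, for queue lengths `q`. -/
def atLeast (q : Fin n → ℕ) (i : ℕ) : ℕ := (Finset.univ.filter (fun v => i ≤ q v)).card

/-- The scaled number `(Q₁ - n) / √n`, or `Qᵢ / √n` for `i ≥ 2`, where `Qᵢ` is the number of queues
with at least `i` customers. -/
def scaled (q : Fin n → ℕ) (i : ℕ) : ℝ :=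
  if i = 1 then ((atLeast q 1 : ℝ) - n) / √n else (atLeast q i : ℝ) / √n

/-- The total time that customers, including those present at time `0`, spend waiting during
`[0, t]`: at time `s`, there are `∑_{i ≥ 2} Qᵢ(s)` customers who wait. -/
def waitDuring [NeZero n] (q₀ : Fin n → ℕ) (x : Clock n → ℝ) (t : ℝ) : ℝ≥0∞ :=
  ∫⁻ s in Set.Icc 0 t, ∑' i : ℕ, (atLeast (queueLength q₀ x s) (i + 2) : ℝ≥0∞)

end Dynamics

end JSQ

end

/-!
Conditionally on the initial queue lengths, which are independent of the clocks, all bounds come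
from means with respect to the product law of the clocks. Let `I` be the number of idle servers, and
let `W` be the number of waiting customers, so that `∑_{i ≥ 2} Qᵢ = W`.

The clocks give a path-by-path description of the system. Two facts turn it into rate equations for
means. An exponential time that is resampled with everything else frozen is compensated by its rate
(`lintegral_expMeasure`), and by causality (`causality`) the length of a service has no influence on
the system before this service ends. Hence arrivals occur at rate `lam * n`, and each busy server
releases customers at rate `1` (`lintegral_arrival`, `lintegral_departure`). Summation along the
path gives the inequality `mean_le` for the means of functions of the queue lengths. It is applied
three times.

* For `I ^ 2`: an arriving customer joins an idle server if there is one, so the drift is at most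
  `lam * n * (1 - 2 * I) + 2 * (1 + I) * (n - I)`. With `(1 - lam) * n = O(√n)`, completing the
  square bounds this by a multiple of `n`, whence `I` has mean `O(√n)` at all times up to `t`
  (`mean_idle_le`).
* For the number of customers, which is `n - I + W`: at most `n` customers per unit of time arrive,
  and `n - I` leave. So the mean of `W` exceeds its initial value by at most the means of `I` and of
  its integral, and it is `O(√n)`, too (`mean_backlog_le`). Integration gives the waiting time that
  all customers accumulate during `[0, t]`.
* For `W`: it grows by one at each arrival that finds no idle server, and the rate at which it
  decreases is at most `W`. So the mean number of such arrivals is at most the sum of the means of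
  `W` and of its integral, which is `O(√n)` (`occupation_busy_le`).

A new customer waits for the customers at a shortest queue, who need time `1` each on average. The
length of a shortest queue is at most `W / n + 1`, and it is `0` if a server is idle. As arriving
customers see time averages, the mean aggregate waiting time is at most the mean integral of `W`
plus the mean number of arrivals that find no idle server (`lintegral_aggregateWait_le`).

Markov's inequality and the tightness of the initial states (`exists_tail_le`) yield the first two
statements. Chernoff bounds for the arrival times (`clockLaw_arrivals_le`) show that the number of
arrivals is of order `n`, and division by it yields the others.
-/

noncomputable section

namespace JSQ

section

/-! ### Lists of departure times -/

theorem remaining_append (d e : List ℝ) (s : ℝ) :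
    remaining (d ++ e) s = remaining d s + remaining e s := by
  simp [remaining]

theorem remaining_singleton (y s : ℝ) : remaining [y] s = if s < y then 1 else 0 := by
  by_cases h : s < y <;> simp [remaining, h]

theorem remaining_eq_zero {d : List ℝ} {s : ℝ} : remaining d s = 0 ↔ ∀ y ∈ d, y ≤ s := by
  simp [remaining]

theorem remaining_pos {d : List ℝ} {s : ℝ} : 0 < remaining d s ↔ ∃ y ∈ d, s < y := by
  simp [remaining, List.length_pos_iff_exists_mem]

theorem remaining_antitone (d : List ℝ) : Antitone (remaining d) := fun a b hab => by
  induction d with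
  | nil => simp [remaining]
  | cons y d ih =>
    rw [← List.singleton_append, remaining_append, remaining_append, remaining_singleton,
      remaining_singleton]
    split_ifs <;> first | omega | linarith

theorem serviceStart_append (d : List ℝ) (y s : ℝ) :
    serviceStart (d ++ [y]) s = max y (serviceStart d s) := by
  induction d with
  | nil => simp [serviceStart]
  | cons z d ih => simp only [serviceStart, List.cons_append, List.foldr_cons] at ih ⊢
                   rw [ih, max_left_comm]

theorem serviceStart_le {d : List ℝ} {s u : ℝ} :
    serviceStart d s ≤ u ↔ s ≤ u ∧ ∀ y ∈ d, y ≤ u := by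
  induction d with
  | nil => simp [serviceStart]
  | cons z d ih => simp only [serviceStart, List.foldr_cons, max_le_iff] at ih ⊢
                   rw [ih]; simp; tauto

theorem le_serviceStart (d : List ℝ) (s : ℝ) : s ≤ serviceStart d s :=
  (serviceStart_le.1 le_rfl).1

theorem le_serviceStart_of_mem {d : List ℝ} {y : ℝ} (hy : y ∈ d) (s : ℝ) : y ≤ serviceStart d s :=
  (serviceStart_le.1 le_rfl).2 y hy

theorem serviceStart_mono (d : List ℝ) : Monotone (serviceStart d) := fun _ _ h =>
  serviceStart_le.2 ⟨h.trans (le_serviceStart _ _), fun _ hy => le_serviceStart_of_mem hy _⟩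

/-- The number of customers who leave in `(a, b]`, weighted by `B`. -/
def departed {ι : Type*} (L : List ι) (fin : ι → ℝ) (a b : ℝ) (B : ι → ℝ → ℕ) : ℕ :=
  (L.map (fun c => if a < fin c ∧ fin c ≤ b then B c (fin c) else 0)).sum

theorem departed_append {ι : Type*} (L L' : List ι) (fin : ι → ℝ) (a b : ℝ) (B : ι → ℝ → ℕ) :
    departed (L ++ L') fin a b B = departed L fin a b B + departed L' fin a b B := by
  simp [departed]

theorem remaining_add_departed {ι : Type*} (L : List ι) (fin : ι → ℝ) {a b : ℝ} (hab : a ≤ b) :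
    remaining (L.map fin) b + departed L fin a b (fun _ _ => 1) = remaining (L.map fin) a := by
  induction L with
  | nil => simp [departed, remaining]
  | cons c L ih =>
    rw [← List.singleton_append, departed_append, List.map_append, remaining_append,
      remaining_append]
    have : remaining ([c].map fin) b + departed [c] fin a b (fun _ _ => 1)
        = remaining ([c].map fin) a := by
      simp only [List.map_cons, List.map_nil, remaining_singleton, departed, List.sum_cons,
        List.sum_nil]
      split_ifs <;> grind
    omega

/-- `Fifo start fin a L` says that the customers in the list `L`, who arrive by time `a` and whose
services last from `start c` to `fin c`, are served one at a time in the order of the list. -/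
inductive Fifo {ι : Type*} (start fin : ι → ℝ) (a : ℝ) : List ι → Prop
  | nil : Fifo start fin a []
  | snoc {L : List ι} {c : ι} {s : ℝ} (h : Fifo start fin a L) (hs : s ≤ a)
      (hstart : start c = serviceStart (L.map fin) s) (hfin : start c < fin c) :
      Fifo start fin a (L ++ [c])

namespace Fifo

variable {ι : Type*} {start fin : ι → ℝ} {a : ℝ} {L : List ι}

theorem mono (h : Fifo start fin a L) {b : ℝ} (hab : a ≤ b) : Fifo start fin b L := by
  induction h with
  | nil => exact .nil
  | snoc _ hs h1 h2 ih => exact ih.snoc (hs.trans hab) h1 h2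

/-- After the last arrival, a busy server serves exactly one customer. -/
theorem sum_inService (h : Fifo start fin a L) {u : ℝ} (hu : a ≤ u) :
    (L.map (fun c => if start c ≤ u ∧ u < fin c then 1 else 0)).sum
      = if remaining (L.map fin) u = 0 then 0 else 1 := by
  induction h with
  | nil => simp [remaining]
  | @snoc L c s _ hs h1 h2 ih =>
    have hst : start c ≤ u ↔ remaining (L.map fin) u = 0 := by
      rw [h1, serviceStart_le, remaining_eq_zero]
      exact ⟨fun h => h.2, fun h => ⟨hs.trans hu, h⟩⟩
    rw [List.map_append, List.sum_append, ih, List.map_append, remaining_append,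
      List.map_singleton, List.map_singleton, List.sum_singleton, remaining_singleton]
    by_cases h0 : remaining (L.map fin) u = 0
    · have := hst.2 h0
      by_cases h3 : u < fin c <;> simp [h0, h3, this]
    · have : ¬ start c ≤ u := fun h => h0 (hst.1 h)
      simp [h0, this]

/-- The last customer of the list leaves after all others. So, unless the queue is empty, the number
of waiting customers is the number of customers present when the last one is not counted. -/
theorem remaining_dropLast (h : Fifo start fin a L) (u : ℝ) :
    remaining (L.dropLast.map fin) u = remaining (L.map fin) u - 1 := by
  cases h with
  | nil => simp [remaining]
  | @snoc L c s _ hs h1 h2 =>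
    rw [List.dropLast_concat, List.map_append, remaining_append, List.map_singleton,
      remaining_singleton]
    by_cases h0 : remaining (L.map fin) u = 0
    · split_ifs <;> omega
    · obtain ⟨y, hy, hy'⟩ := remaining_pos.1 (Nat.pos_of_ne_zero h0)
      have : u < fin c := by
        have := le_serviceStart_of_mem hy s
        linarith
      simp [this]

/-- The number of waiting customers decreases only at the departure of a customer who is not the
last of the list. -/
theorem backlog_le (h : Fifo start fin a L) {b b' : ℝ} (hb : b ≤ b') (B : ι → ℝ → ℕ)
    (hB : ∀ c ∈ L.dropLast, ∀ u, 1 ≤ B c u) :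
    remaining (L.map fin) b - 1 ≤ (remaining (L.map fin) b' - 1) + departed L fin b b' B := by
  rw [← h.remaining_dropLast, ← h.remaining_dropLast, ← remaining_add_departed _ _ hb]
  gcongr
  rcases L.eq_nil_or_concat' with rfl | ⟨L', c, rfl⟩
  · simp [departed]
  · rw [List.dropLast_concat] at hB ⊢
    rw [departed_append]
    refine le_trans ?_ (Nat.le_add_right _ _)
    refine List.sum_le_sum fun c hc => ?_
    split_ifs
    · exact hB c hc _
    · rfl

/-- The waiting time of a new customer is the sum of the remaining services of the others. -/
theorem serviceStart_sub_le (h : Fifo start fin a L) {s : ℝ} (hs : a ≤ s) :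
    ENNReal.ofReal (serviceStart (L.map fin) s - s)
      ≤ (L.map (fun c => ENNReal.ofReal (fin c - max (start c) s))).sum := by
  induction h with
  | nil => simp [serviceStart]
  | @snoc L c s' _ hs' h1 h2 ih =>
    rw [List.map_append, List.map_singleton, serviceStart_append, List.map_append,
      List.sum_append, List.map_singleton, List.sum_singleton]
    have h3 := le_serviceStart (L.map fin) s
    have h4 : start c ≤ serviceStart (L.map fin) s := by
      rw [h1]; exact serviceStart_mono _ (hs'.trans hs)
    have h5 := max_le h4 h3
    rcases le_total (fin c) (serviceStart (L.map fin) s) with h6 | h6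
    · rw [max_eq_right h6]
      exact ih.trans le_self_add
    · rw [max_eq_left h6]
      calc ENNReal.ofReal (fin c - s)
          ≤ ENNReal.ofReal ((serviceStart (L.map fin) s - s) + (fin c - max (start c) s)) :=
            ENNReal.ofReal_le_ofReal (by linarith)
        _ ≤ _ := ENNReal.ofReal_add_le
        _ ≤ _ := by gcongr

end Fifo

end

section

/-! ### The customers and the queues -/

variable {n : ℕ}

/-- The sum of the first `j` interarrival times: the time from which on the customers `0, …, j - 1`
have arrived. Customer `j` arrives at time `epoch x (j + 1)`. -/
def epoch (x : Clock n → ℝ) (j : ℕ) : ℝ := ∑ i ∈ Finset.range j, x (.interarrival i)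

theorem epoch_zero (x : Clock n → ℝ) : epoch x 0 = 0 := by simp [epoch]

theorem epoch_succ (x : Clock n → ℝ) (j : ℕ) :
    epoch x (j + 1) = epoch x j + x (.interarrival j) := by simp [epoch, Finset.sum_range_succ]

theorem arrivalTime_eq (x : Clock n → ℝ) (j : ℕ) : arrivalTime x j = epoch x (j + 1) := rfl

/-- All interarrival and service times are positive. -/
structure Regular (x : Clock n → ℝ) : Prop where
  interarrival : ∀ j, 0 < x (.interarrival j)
  service : ∀ j, 0 < x (.service j)
  initialService : ∀ v i, 0 < x (.initialService v i)

theorem Regular.strictMono_epoch {x : Clock n → ℝ} (h : Regular x) : StrictMono (epoch x) :=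
  strictMono_nat_of_lt_succ fun j => by rw [epoch_succ]; linarith [h.interarrival j]

theorem Regular.epoch_nonneg {x : Clock n → ℝ} (h : Regular x) (j : ℕ) : 0 ≤ epoch x j := by
  rw [← epoch_zero x]; exact h.strictMono_epoch.monotone (Nat.zero_le j)

variable [NeZero n] (q₀ : Fin n → ℕ) (x : Clock n → ℝ)

/-- The server joined by customer `j`. -/
def choice (j : ℕ) : Fin n := serverOf x j (departures q₀ x j)

/-- The service clocks of the customers of server `v` who were present at time `0` or are numbered
`0, …, j - 1`, in the order in which they are served. -/
def line : ℕ → Fin n → List (Clock n)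
  | 0 => fun v => (List.range (q₀ v)).map (.initialService v)
  | j + 1 => Function.update (line j) (choice q₀ x j)
      (line j (choice q₀ x j) ++ [.service j])

/-- The time at which the service with the given clock begins. -/
def start : Clock n → ℝ
  | .initialService v i => ∑ l ∈ Finset.range i, x (.initialService v l)
  | .service j => serviceStart (departures q₀ x j (choice q₀ x j)) (arrivalTime x j)
  | _ => 0

/-- The time at which the service with the given clock ends. -/
def finish (c : Clock n) : ℝ := start q₀ x c + x c

theorem line_zero (v : Fin n) :
    line q₀ x 0 v = (List.range (q₀ v)).map (.initialService v) := rfl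

theorem line_succ_choice (j : ℕ) :
    line q₀ x (j + 1) (choice q₀ x j) = line q₀ x j (choice q₀ x j) ++ [.service j] := by
  simp [line]

theorem line_succ_of_ne {j : ℕ} {v : Fin n} (h : v ≠ choice q₀ x j) :
    line q₀ x (j + 1) v = line q₀ x j v := by
  simp [line, h]

theorem departures_succ_choice (j : ℕ) :
    departures q₀ x (j + 1) (choice q₀ x j)
      = departures q₀ x j (choice q₀ x j) ++ [finish q₀ x (.service j)] := by
  simp [departures, choice, finish, start]

theorem departures_succ_of_ne {j : ℕ} {v : Fin n} (h : v ≠ choice q₀ x j) :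
    departures q₀ x (j + 1) v = departures q₀ x j v := by
  simp only [choice] at h
  simp [departures, h]

theorem map_finish_line (j : ℕ) (v : Fin n) :
    (line q₀ x j v).map (finish q₀ x) = departures q₀ x j v := by
  induction j generalizing v with
  | zero =>
    simp only [line, departures, initialDepartures, List.map_map]
    refine List.map_congr_left fun i _ => ?_
    simp [finish, start, Finset.sum_range_succ]
  | succ j ih =>
    by_cases h : v = choice q₀ x j
    · subst h
      rw [line_succ_choice, departures_succ_choice, List.map_append, ih]; simp
    · rw [line_succ_of_ne _ _ h, departures_succ_of_ne _ _ h, ih]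

/-- The clocks of all customers who were present at time `0` or are numbered `0, …, j - 1`. -/
def customers : ℕ → List (Clock n)
  | 0 => (List.ofFn fun v => (List.range (q₀ v)).map (.initialService v)).flatten
  | j + 1 => customers j ++ [.service j]

theorem sum_line {M : Type*} [AddCommMonoid M] (j : ℕ) (g : Clock n → M) :
    ∑ v, ((line q₀ x j v).map g).sum = ((customers q₀ j).map g).sum := by
  induction j with
  | zero =>
    rw [customers, List.map_flatten, List.sum_flatten, List.map_ofFn, List.map_ofFn, List.sum_ofFn]
    rfl
  | succ j ih =>
    rw [customers, List.map_append, List.sum_append, ← ih]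
    rw [← Finset.add_sum_erase _ _ (Finset.mem_univ (choice q₀ x j)),
      ← Finset.add_sum_erase _ _ (Finset.mem_univ (choice q₀ x j)),
      line_succ_choice, List.map_append, List.sum_append]
    rw [Finset.sum_congr rfl (g := fun v => ((line q₀ x j v).map g).sum) fun v hv => by
      rw [line_succ_of_ne _ _ (Finset.ne_of_mem_erase hv)]]
    simp only [List.map_singleton, List.sum_singleton]
    abel

theorem mem_line_zero {v : Fin n} {c : Clock n} :
    c ∈ line q₀ x 0 v ↔ ∃ i < q₀ v, c = .initialService v i := by
  simp [line, eq_comm]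

theorem mem_line_succ {j : ℕ} {v : Fin n} {c : Clock n} :
    c ∈ line q₀ x (j + 1) v ↔ c ∈ line q₀ x j v ∨ v = choice q₀ x j ∧ c = .service j := by
  by_cases h : v = choice q₀ x j
  · subst h; rw [line_succ_choice]; simp
  · rw [line_succ_of_ne _ _ h]; simp [h]

theorem lt_of_service_mem_line {i j : ℕ} {v : Fin n} (h : .service i ∈ line q₀ x j v) : i < j := by
  induction j with
  | zero => simp [mem_line_zero] at h
  | succ j ih =>
    rcases (mem_line_succ q₀ x).1 h with h | ⟨_, h⟩
    · exact (ih h).trans (Nat.lt_succ_self j)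
    · rw [Clock.service.injEq] at h; omega

theorem exists_of_mem_line {j : ℕ} {v : Fin n} {c : Clock n} (h : c ∈ line q₀ x j v) :
    (∃ i < q₀ v, c = .initialService v i) ∨ ∃ i < j, c = .service i := by
  induction j with
  | zero => exact .inl ((mem_line_zero q₀ x).1 h)
  | succ j ih =>
    rcases (mem_line_succ q₀ x).1 h with h | ⟨_, h⟩
    · rcases ih h with h | ⟨i, hi, h⟩
      · exact .inl h
      · exact .inr ⟨i, hi.trans (Nat.lt_succ_self j), h⟩
    · exact .inr ⟨j, Nat.lt_succ_self j, h⟩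

/-- No customer is at two servers. -/
theorem eq_of_mem_line {j : ℕ} {v w : Fin n} {c : Clock n} (hv : c ∈ line q₀ x j v)
    (hw : c ∈ line q₀ x j w) : v = w := by
  induction j with
  | zero =>
    obtain ⟨i, _, rfl⟩ := (mem_line_zero q₀ x).1 hv
    obtain ⟨i', _, h⟩ := (mem_line_zero q₀ x).1 hw
    exact (Clock.initialService.inj h).1
  | succ j ih =>
    rcases (mem_line_succ q₀ x).1 hv with hv | ⟨hv, hc⟩ <;>
    rcases (mem_line_succ q₀ x).1 hw with hw | ⟨hw, hc'⟩
    · exact ih hv hw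
    · subst hc'; exact absurd (lt_of_service_mem_line _ _ hv) (lt_irrefl _)
    · subst hc; exact absurd (lt_of_service_mem_line _ _ hw) (lt_irrefl _)
    · rw [hv, hw]

theorem finish_pos_of_initial (h : Regular x) (v : Fin n) (i : ℕ) :
    0 < finish q₀ x (.initialService v i) := by
  have : 0 ≤ ∑ l ∈ Finset.range i, x (.initialService v l) :=
    Finset.sum_nonneg fun l _ => (h.initialService v l).le
  have := h.initialService v i
  simp only [finish, start]; linarith

theorem start_initial_eq (h : Regular x) (v : Fin n) (i : ℕ) :
    start q₀ x (.initialService v i)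
      = serviceStart (((List.range i).map (.initialService v)).map (finish q₀ x)) 0 := by
  induction i with
  | zero => simp [start, serviceStart]
  | succ i ih =>
    rw [List.range_succ, List.map_append, List.map_append, List.map_singleton, List.map_singleton,
      serviceStart_append, ← ih]
    have := h.initialService v i
    rw [max_eq_left (by rw [finish]; linarith)]
    simp [finish, start, Finset.sum_range_succ]

variable {x}

theorem fifo_line (h : Regular x) (j : ℕ) (v : Fin n) :
    Fifo (start q₀ x) (finish q₀ x) (epoch x j) (line q₀ x j v) := by
  induction j generalizing v with
  | zero =>
    simp only [line]
    generalize q₀ v = m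
    induction m with
    | zero => exact .nil
    | succ m ih =>
      rw [List.range_succ, List.map_append, List.map_singleton]
      exact ih.snoc (epoch_zero x).ge (start_initial_eq q₀ x h v m)
        (by rw [finish]; linarith [h.initialService v m])
  | succ j ih =>
    have hmono := h.strictMono_epoch.monotone (Nat.le_succ j)
    by_cases hv : v = choice q₀ x j
    · subst hv
      rw [line_succ_choice]
      refine ((ih _).mono hmono).snoc le_rfl ?_ (by rw [finish]; linarith [h.service j])
      rw [map_finish_line]; rfl
    · rw [line_succ_of_ne _ _ hv]
      exact (ih v).mono hmono

variable (x)

/-- The queue length of server `v` at time `u` if no customers arrive after customer `j - 1`. -/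
def queue (j : ℕ) (u : ℝ) (v : Fin n) : ℕ := remaining (departures q₀ x j v) u

theorem choice_mem_shortest (j : ℕ) (w : Fin n) :
    queue q₀ x j (epoch x (j + 1)) (choice q₀ x j) ≤ queue q₀ x j (epoch x (j + 1)) w := by
  have : choice q₀ x j ∈ shortest (queue q₀ x j (epoch x (j + 1))) :=
    Finset.orderEmbOfFin_mem _ _ _
  simp only [shortest, Finset.mem_filter] at this
  exact this.2 w

variable {x}

theorem queue_zero_zero (h : Regular x) : queue q₀ x 0 0 = q₀ := by
  ext v
  rw [queue, ← map_finish_line, line_zero]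
  generalize q₀ v = m
  induction m with
  | zero => simp [remaining]
  | succ m ih =>
    rw [List.range_succ, List.map_append, List.map_append, remaining_append, ih,
      List.map_singleton, List.map_singleton, remaining_singleton,
      if_pos (finish_pos_of_initial q₀ x h v m)]

theorem queue_arrival_choice (h : Regular x) (j : ℕ) :
    queue q₀ x (j + 1) (epoch x (j + 1)) (choice q₀ x j)
      = queue q₀ x j (epoch x (j + 1)) (choice q₀ x j) + 1 := by
  rw [queue, queue, departures_succ_choice, remaining_append, remaining_singleton, if_pos]
  have h1 := le_serviceStart (departures q₀ x j (choice q₀ x j)) (arrivalTime x j)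
  have h2 := h.service j
  rw [finish, start]
  rw [arrivalTime_eq] at h1 ⊢
  linarith

theorem queue_arrival_of_ne {j : ℕ} {v : Fin n} (hv : v ≠ choice q₀ x j) (u : ℝ) :
    queue q₀ x (j + 1) u v = queue q₀ x j u v := by
  rw [queue, queue, departures_succ_of_ne _ _ hv]

theorem queue_arrival (h : Regular x) (j : ℕ) :
    queue q₀ x (j + 1) (epoch x (j + 1))
      = Function.update (queue q₀ x j (epoch x (j + 1))) (choice q₀ x j)
        (queue q₀ x j (epoch x (j + 1)) (choice q₀ x j) + 1) := by
  ext v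
  by_cases hv : v = choice q₀ x j
  · subst hv; rw [queue_arrival_choice q₀ h]; simp
  · rw [queue_arrival_of_ne q₀ hv]; simp [hv]

/-! ### Idle servers, customers, and waiting customers -/

/-- The number of idle servers. -/
def idle (q : Fin n → ℕ) : ℕ := (Finset.univ.filter (fun v => q v = 0)).card

/-- The number of customers. -/
def population (q : Fin n → ℕ) : ℕ := ∑ v, q v

/-- The number of waiting customers. -/
def backlog (q : Fin n → ℕ) : ℕ := ∑ v, (q v - 1)

end

section

variable {n : ℕ}

/-! ### The effect of an arrival -/

theorem population_update (q : Fin n → ℕ) (v : Fin n) :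
    population (Function.update q v (q v + 1)) = population q + 1 := by
  simp only [population]
  rw [Finset.sum_update_of_mem (Finset.mem_univ v), ← Finset.erase_eq,
    ← Finset.add_sum_erase _ q (Finset.mem_univ v)]
  ring

theorem backlog_update (q : Fin n → ℕ) (v : Fin n) (hv : ∀ w, q v ≤ q w) :
    backlog (Function.update q v (q v + 1)) = backlog q + if idle q = 0 then 1 else 0 := by
  have hidle : idle q = 0 ↔ q v ≠ 0 := by
    simp only [idle, Finset.card_eq_zero, Finset.filter_eq_empty_iff, Finset.mem_univ,
      forall_const]
    exact ⟨fun h => @h v, fun h w hw => h (Nat.le_zero.1 (hw ▸ hv w))⟩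
  simp only [backlog]
  rw [← Finset.add_sum_erase _ _ (Finset.mem_univ v),
    ← Finset.add_sum_erase Finset.univ (fun w => q w - 1) (Finset.mem_univ v),
    Finset.sum_congr rfl (g := fun w => q w - 1) fun w hw => by
      rw [Function.update_of_ne (Finset.ne_of_mem_erase hw)]]
  rw [Function.update_self]
  simp only [hidle]
  split_ifs <;> omega

theorem idle_update (q : Fin n → ℕ) (v : Fin n) (hv : ∀ w, q v ≤ q w) :
    idle (Function.update q v (q v + 1)) = idle q - 1 := by
  have h : (Finset.univ.filter (fun w => Function.update q v (q v + 1) w = 0))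
      = (Finset.univ.filter (fun w => q w = 0)).erase v := by
    ext w
    by_cases hw : w = v
    · subst hw; simp
    · simp [hw]
  rw [idle, h]
  by_cases h0 : q v = 0
  · rw [Finset.card_erase_of_mem (by simpa using h0)]; rfl
  · have : ∀ w, q w ≠ 0 := fun w hw => h0 (Nat.le_zero.1 (hw ▸ hv w))
    simp [idle, this]

/-- With the shortest queue having length `m`, there are at least `m - 1` waiting customers at each
server, and `m = 0` if there is an idle server. -/
theorem mul_le_backlog (q : Fin n → ℕ) (v : Fin n) (hv : ∀ w, q v ≤ q w) :
    n * q v ≤ backlog q + n * if idle q = 0 then 1 else 0 := by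
  have h1 : n * (q v - 1) ≤ backlog q := by
    calc n * (q v - 1) = ∑ _w : Fin n, (q v - 1) := by simp
      _ ≤ _ := Finset.sum_le_sum fun w _ => Nat.sub_le_sub_right (hv w) 1
  split_ifs with h
  · calc n * q v ≤ n * ((q v - 1) + 1) := Nat.mul_le_mul_left _ (by omega)
      _ = n * (q v - 1) + n * 1 := by ring
      _ ≤ _ := by omega
  · have : q v = 0 := by
      obtain ⟨w, hw⟩ := Finset.card_pos.1 (Nat.pos_of_ne_zero h)
      have := hv w
      simp only [Finset.mem_filter] at hw
      omega
    simp [this]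

theorem population_add_idle (q : Fin n → ℕ) : population q + idle q = n + backlog q := by
  have : ∑ _w : Fin n, 1 = n := by simp
  calc population q + idle q = ∑ _w : Fin n, 1 + backlog q := ?_
    _ = n + backlog q := by rw [this]
  rw [population, idle, backlog, Finset.card_filter, ← Finset.sum_add_distrib,
    ← Finset.sum_add_distrib]
  refine Finset.sum_congr rfl fun v _ => ?_
  split_ifs <;> omega

theorem idle_le (q : Fin n → ℕ) : idle q ≤ n :=
  (Finset.card_filter_le _ _).trans (by simp)

theorem sum_busy (q : Fin n → ℕ) : ∑ v, (if q v = 0 then 0 else 1) = n - idle q := by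
  have h : ∑ v, (if q v = 0 then 0 else 1) + idle q = n := by
    rw [idle, Finset.card_filter, ← Finset.sum_add_distrib,
      Finset.sum_congr rfl (g := fun _ => 1) (fun v _ => by split_ifs <;> rfl)]
    simp
  omega

/-! ### Summation over the arrivals -/

/-- Summation of the increments of a quantity `X - Y` that changes by at most `A - A'` at the
arrivals and by at most `D - D'` between them. The terms are placed so that no
subtraction is needed. -/
theorem telescope (a : ℕ → ℝ) (X Y : ℕ → ℝ → ℕ) (A A' : ℕ → ℕ) (D D' : ℕ → ℝ → ℕ)
    (ha : Monotone a)
    (harr : ∀ j, X (j + 1) (a (j + 1)) + Y j (a (j + 1)) + A' j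
      ≤ X j (a (j + 1)) + Y (j + 1) (a (j + 1)) + A j)
    (hgap : ∀ j u, a j ≤ u →
      X j u + Y j (a j) + D' j u ≤ X j (a j) + Y j u + D j u)
    (J : ℕ) (s : ℝ) (hs : a J ≤ s) :
    X J s + Y 0 (a 0) + ∑ j ∈ Finset.range J, A' j
        + (∑ j ∈ Finset.range J, D' j (a (j + 1)) + D' J s)
      ≤ X 0 (a 0) + Y J s + ∑ j ∈ Finset.range J, A j
        + (∑ j ∈ Finset.range J, D j (a (j + 1)) + D J s) := by
  induction J generalizing s with
  | zero => have := hgap 0 s hs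
            simpa using this
  | succ J ih =>
    have h1 := ih (a (J + 1)) (ha (Nat.le_succ J))
    have h2 := harr J
    have h3 := hgap (J + 1) s hs
    simp only [Finset.sum_range_succ]
    omega

open Classical in
/-- The number of idle servers, apart from the server of customer `c`. Unlike the number of all idle
servers, it does not depend on the length of the service of `c`. -/
def idleElsewhere (c : Clock n) (L : Fin n → List (Clock n)) (q : Fin n → ℕ) : ℕ :=
  (Finset.univ.filter (fun w => c ∉ L w ∧ q w = 0)).card

open Classical in
/-- `1` if someone is behind customer `c` in the line, and `0` otherwise. -/
def follower (c : Clock n) (L : Fin n → List (Clock n)) : ℕ :=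
  if ∃ v, c ∈ (L v).dropLast then 1 else 0

variable [NeZero n] (q₀ : Fin n → ℕ) (x : Clock n → ℝ)

/-! ### The effect of departures -/

/-- The departures in `(a, b]`, weighted by `B`, if no customers arrive after customer `j - 1`. -/
def outflow (j : ℕ) (a b : ℝ) (B : Clock n → ℝ → ℕ) : ℕ :=
  departed (customers q₀ j) (finish q₀ x) a b B

theorem outflow_eq_sum (j : ℕ) (a b : ℝ) (B : Clock n → ℝ → ℕ) :
    outflow q₀ x j a b B = ∑ v, departed (line q₀ x j v) (finish q₀ x) a b B :=
  (sum_line q₀ x j _).symm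

variable {x}

theorem population_add_outflow (j : ℕ) {a b : ℝ} (hab : a ≤ b) :
    population (queue q₀ x j b) + outflow q₀ x j a b (fun _ _ => 1)
      = population (queue q₀ x j a) := by
  rw [outflow_eq_sum, population, population, ← Finset.sum_add_distrib]
  refine Finset.sum_congr rfl fun v _ => ?_
  rw [queue, queue, ← map_finish_line, remaining_add_departed _ _ hab]

theorem backlog_le_outflow (h : Regular x) (j : ℕ) {a b : ℝ} (hab : a ≤ b) :
    backlog (queue q₀ x j a)
      ≤ backlog (queue q₀ x j b) + outflow q₀ x j a b (fun c _ => follower c (line q₀ x j)) := by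
  rw [outflow_eq_sum, backlog, backlog, ← Finset.sum_add_distrib]
  refine Finset.sum_le_sum fun v _ => ?_
  rw [queue, queue, ← map_finish_line]
  refine (fifo_line q₀ h j v).backlog_le hab _ fun c hc _ => ?_
  rw [follower, if_pos ⟨v, hc⟩]

theorem queue_antitone (j : ℕ) (v : Fin n) {a b : ℝ} (hab : a ≤ b) :
    queue q₀ x j b v ≤ queue q₀ x j a v := remaining_antitone _ hab

theorem exists_last_departure {j : ℕ} {v : Fin n} {a b : ℝ} (ha : queue q₀ x j a v ≠ 0)
    (hb : queue q₀ x j b v = 0) :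
    ∃ c ∈ line q₀ x j v, a < finish q₀ x c ∧ finish q₀ x c ≤ b ∧
      queue q₀ x j (finish q₀ x c) v = 0 := by
  rw [queue, ← map_finish_line] at *
  obtain ⟨y, hy, hay⟩ := remaining_pos.1 (Nat.pos_of_ne_zero ha)
  obtain ⟨c₁, hc₁, rfl⟩ := List.mem_map.1 hy
  classical
  obtain ⟨c, hc, hmax⟩ := Finset.exists_max_image (line q₀ x j v).toFinset (finish q₀ x)
    ⟨c₁, by simpa using hc₁⟩
  simp only [List.mem_toFinset] at hc hmax
  refine ⟨c, hc, hay.trans_le (hmax _ hc₁),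
    remaining_eq_zero.1 hb _ (List.mem_map_of_mem hc), ?_⟩
  rw [queue, ← map_finish_line, remaining_eq_zero]
  simpa using hmax

/-- Between arrivals, the square of the number `I` of idle servers grows by at most `2 I` at each
departure, where `I` is taken after the departure. -/
theorem idle_sq_le_outflow (j : ℕ) {a b : ℝ} (hab : a ≤ b) :
    idle (queue q₀ x j b) ^ 2 ≤ idle (queue q₀ x j a) ^ 2
      + outflow q₀ x j a b
        (fun c u => 2 * (1 + idleElsewhere c (line q₀ x j) (queue q₀ x j u))) := by
  classical
  have : Nonempty (Clock n) := ⟨.service 0⟩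
  set A := Finset.univ.filter (fun v => queue q₀ x j a v = 0) with hA
  set S := Finset.univ.filter (fun v => queue q₀ x j a v ≠ 0 ∧ queue q₀ x j b v = 0) with hS
  have hcard : idle (queue q₀ x j b) = A.card + S.card := by
    rw [idle, ← Finset.card_union_of_disjoint]
    · congr 1
      ext v
      have := queue_antitone q₀ (x := x) j v hab
      simp only [hA, hS, Finset.mem_filter, Finset.mem_univ, true_and, Finset.mem_union]
      omega
    · rw [Finset.disjoint_left]
      intro v hv hv'
      simp only [hA, hS, Finset.mem_filter] at hv hv'
      exact hv'.2.1 hv.2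
  have hex : ∀ v ∈ S, ∃ c ∈ line q₀ x j v, a < finish q₀ x c ∧ finish q₀ x c ≤ b ∧
      queue q₀ x j (finish q₀ x c) v = 0 := fun v hv => by
    simp only [hS, Finset.mem_filter] at hv
    exact exists_last_departure q₀ hv.2.1 hv.2.2
  choose! c hc hac hcb hc0 using hex
  set e : Fin n → ℝ := fun v => finish q₀ x (c v) with he
  -- the last customer of each server in `S` sees the servers of `A` and those that
  -- became idle before
  have hsee : ∀ v ∈ S, A.card + (S.filter (fun w => e w ≤ e v)).card
      ≤ 1 + idleElsewhere (c v) (line q₀ x j) (queue q₀ x j (e v)) := by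
    intro v hv
    have hdisj : Disjoint A ((S.filter (fun w => e w ≤ e v)).erase v) := by
      rw [Finset.disjoint_left]
      intro w hw hw'
      simp only [hA, hS, Finset.mem_filter, Finset.mem_erase] at hw hw'
      exact hw'.2.1.2.1 hw.2
    have hsub : A ∪ (S.filter (fun w => e w ≤ e v)).erase v ⊆ Finset.univ.filter
        (fun w => c v ∉ line q₀ x j w ∧ queue q₀ x j (e v) w = 0) := by
      intro w hw
      have hwv : w ≠ v := by
        rintro rfl
        rw [Finset.mem_union] at hw
        rcases hw with hw | hw
        · simp only [hA, hS, Finset.mem_filter] at hw hv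
          exact hv.2.1 hw.2
        · simp at hw
      rw [Finset.mem_filter]
      refine ⟨Finset.mem_univ _, fun h => hwv (eq_of_mem_line q₀ x h (hc v hv)), ?_⟩
      rw [Finset.mem_union] at hw
      rcases hw with hw | hw
      · simp only [hA, Finset.mem_filter] at hw
        have := queue_antitone q₀ (x := x) j w (hac v hv).le
        simp only [he]; omega
      · rw [Finset.mem_erase, Finset.mem_filter] at hw
        have := queue_antitone q₀ (x := x) j w hw.2.2
        have := hc0 w hw.2.1
        simp only [he] at *
        omega
    have h1 := Finset.card_le_card hsub
    rw [Finset.card_union_of_disjoint hdisj, Finset.card_erase_of_mem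
      (by simp [hv])] at h1
    rw [idleElsewhere]
    omega
  -- of two elements of `S`, one becomes idle after the other or at the same time
  have hpairs : S.card ^ 2 ≤ 2 * ∑ v ∈ S, (S.filter (fun w => e w ≤ e v)).card := by
    have h1 : ∑ v ∈ S, (S.filter (fun w => e w ≤ e v)).card
        = ∑ v ∈ S, (S.filter (fun w => e v ≤ e w)).card := by
      simp only [Finset.card_filter]; exact Finset.sum_comm
    rw [two_mul]
    nth_rewrite 2 [h1]
    rw [← Finset.sum_add_distrib, sq, ← smul_eq_mul, ← Finset.sum_const]
    refine Finset.sum_le_sum fun v _ => ?_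
    rw [← Finset.card_union_add_card_inter]
    refine le_trans (Finset.card_le_card fun w hw => ?_) (Nat.le_add_right _ _)
    simp only [Finset.mem_union, Finset.mem_filter, hw, true_and]
    exact le_total _ _
  have hout : ∑ v ∈ S, 2 * (1 + idleElsewhere (c v) (line q₀ x j) (queue q₀ x j (e v)))
      ≤ outflow q₀ x j a b
        (fun c u => 2 * (1 + idleElsewhere c (line q₀ x j) (queue q₀ x j u))) := by
    rw [outflow_eq_sum]
    refine le_trans (Finset.sum_le_sum fun v hv => ?_)
      (Finset.sum_le_univ_sum_of_nonneg (s := S) fun _ => Nat.zero_le _)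
    refine List.single_le_sum (fun _ _ => Nat.zero_le _) _ (List.mem_map.2 ⟨c v, hc v hv, ?_⟩)
    rw [if_pos ⟨hac v hv, hcb v hv⟩]
  have hsum := Finset.sum_le_sum hsee
  rw [Finset.sum_add_distrib, Finset.sum_const, smul_eq_mul] at hsum
  rw [← Finset.mul_sum] at hout
  have hI : idle (queue q₀ x j a) = A.card := rfl
  rw [hcard, hI]
  nlinarith

end

section

variable {n : ℕ}

/-! ### Causality -/

instance : DecidableEq (Clock n) := Classical.decEq _

/-- The service clocks, of the initial and of the arriving customers. -/
def Clock.IsService : Clock n → Prop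
  | .initialService _ _ => True
  | .service _ => True
  | _ => False

theorem epoch_congr {x x' : Clock n → ℝ} {j : ℕ}
    (h : ∀ k < j, x (.interarrival k) = x' (.interarrival k)) : epoch x j = epoch x' j :=
  Finset.sum_congr rfl fun k hk => h k (Finset.mem_range.1 hk)

variable [NeZero n] (q₀ : Fin n → ℕ)

theorem departures_line_congr {x x' : Clock n → ℝ} {j : ℕ}
    (h0 : ∀ v i, x (.initialService v i) = x' (.initialService v i))
    (h1 : ∀ k < j, x (.interarrival k) = x' (.interarrival k))
    (h2 : ∀ k < j, x (.service k) = x' (.service k))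
    (h3 : ∀ k < j, x (.tieBreak k) = x' (.tieBreak k)) :
    departures q₀ x j = departures q₀ x' j ∧ line q₀ x j = line q₀ x' j := by
  induction j with
  | zero => exact ⟨by ext1 v; simp only [departures, initialDepartures, h0], rfl⟩
  | succ j ih =>
    obtain ⟨hd, hl⟩ := ih (fun k hk => h1 k (by omega)) (fun k hk => h2 k (by omega))
      (fun k hk => h3 k (by omega))
    have he : arrivalTime x j = arrivalTime x' j := epoch_congr h1
    have hc : choice q₀ x j = choice q₀ x' j := by
      rw [choice, choice, serverOf, serverOf, hd, he, h3 j (by omega)]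
    constructor
    · have hc' := hc
      simp only [choice] at hc'
      simp only [departures]
      rw [← hc', hd, he, h2 j (by omega)]
    · simp only [line]
      rw [hc, hl]

theorem choice_congr {x x' : Clock n → ℝ} {j : ℕ}
    (h : queue q₀ x j (epoch x (j + 1)) = queue q₀ x' j (epoch x' (j + 1)))
    (h3 : x (.tieBreak j) = x' (.tieBreak j)) :
    choice q₀ x j = choice q₀ x' j := by
  have h' : (fun v => remaining (departures q₀ x j v) (arrivalTime x j))
    = (fun v => remaining (departures q₀ x' j v) (arrivalTime x' j)) := h
  rw [choice, choice, serverOf, serverOf, h', h3]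

/-- The start of a service does not depend on the length of this service. -/
theorem start_congr {x x' : Clock n → ℝ} {c : Clock n} (h : ∀ c' ≠ c, x c' = x' c') :
    start q₀ x c = start q₀ x' c := by
  cases c with
  | initialService v i =>
    refine Finset.sum_congr rfl fun l hl => h _ fun h => ?_
    rw [Clock.initialService.injEq] at h
    exact (Finset.mem_range.1 hl).ne h.2
  | service j =>
    have hd := (departures_line_congr q₀ (x := x) (x' := x') (j := j) (fun v i => h _ (by simp))
      (fun k _ => h _ (by simp)) (fun k hk => h _ (by simp; omega)) (fun k _ => h _ (by simp))).1
    have he : epoch x (j + 1) = epoch x' (j + 1) := epoch_congr fun k _ => h _ (by simp)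
    rw [start, start, arrivalTime_eq, arrivalTime_eq, he, hd,
      choice_congr q₀ (by ext v; rw [queue, queue, hd, he]) (h _ (by simp))]
  | interarrival j => rfl
  | tieBreak j => rfl

theorem departures_update_interarrival (x : Clock n → ℝ) (j : ℕ) (y : ℝ) :
    departures q₀ (Function.update x (.interarrival j) y) j = departures q₀ x j := by
  refine (departures_line_congr q₀ (fun v i => ?_) (fun k hk => ?_) (fun k hk => ?_)
    (fun k hk => ?_)).1 <;> rw [Function.update_of_ne]
  all_goals simp
  exact hk.ne

/-- Times that are not told apart by an observer until time `a`. -/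
def AgreeUntil (a p q : ℝ) : Prop := p = q ∨ a < p ∧ a < q

theorem AgreeUntil.max {a p q p' q' : ℝ} (h : AgreeUntil a p q) (h' : AgreeUntil a p' q') :
    AgreeUntil a (max p p') (max q q') := by
  rcases h with rfl | ⟨h1, h2⟩ <;> rcases h' with rfl | ⟨h3, h4⟩
  · exact .inl rfl
  · exact .inr ⟨lt_max_of_lt_right h3, lt_max_of_lt_right h4⟩
  · exact .inr ⟨lt_max_of_lt_left h1, lt_max_of_lt_left h2⟩
  · exact .inr ⟨lt_max_of_lt_left h1, lt_max_of_lt_left h2⟩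

theorem AgreeUntil.add {a p q y : ℝ} (h : AgreeUntil a p q) (hy : 0 ≤ y) :
    AgreeUntil a (p + y) (q + y) := by
  rcases h with rfl | ⟨h1, h2⟩
  · exact .inl rfl
  · exact .inr ⟨by linarith, by linarith⟩

theorem AgreeUntil.serviceStart {a s : ℝ} {d d' : List ℝ} (h : List.Forall₂ (AgreeUntil a) d d') :
    AgreeUntil a (serviceStart d s) (serviceStart d' s) := by
  induction h with
  | nil => exact .inl rfl
  | cons h _ ih => exact h.max ih

theorem AgreeUntil.remaining {a s : ℝ} {d d' : List ℝ} (h : List.Forall₂ (AgreeUntil a) d d')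
    (hs : s ≤ a) : remaining d s = remaining d' s := by
  induction h with
  | nil => rfl
  | @cons p q d d' h _ ih =>
    rw [← List.singleton_append, ← List.singleton_append (l := d'), remaining_append,
      remaining_append, ih, remaining_singleton, remaining_singleton]
    rcases h with rfl | ⟨h1, h2⟩
    · rfl
    · rw [if_pos (by linarith), if_pos (by linarith)]

/-- If two realizations differ only in the length of one service, and if this service does not end
until the time at which customer `j - 1` arrives, then the customers `0, …, j - 1` join the same
servers, and until then the two systems cannot be told apart. -/
theorem causality {x x' : Clock n → ℝ} (hx : Regular x) (hx' : Regular x') {c : Clock n}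
    (hc : c.IsService) (h : ∀ c' ≠ c, x c' = x' c') {j : ℕ} (hj : epoch x j < finish q₀ x c)
    (hj' : epoch x j < finish q₀ x' c) {i : ℕ} (hi : i ≤ j) :
    line q₀ x i = line q₀ x' i ∧
    (∀ v, List.Forall₂ (AgreeUntil (epoch x j)) (departures q₀ x i v) (departures q₀ x' i v)) ∧
    ∀ v, c ∉ line q₀ x i v → departures q₀ x i v = departures q₀ x' i v := by
  have hint : ∀ k, x (.interarrival k) = x' (.interarrival k) := fun k => h _ (by
    rintro rfl; exact hc)
  have htie : ∀ k, x (.tieBreak k) = x' (.tieBreak k) := fun k => h _ (by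
    rintro rfl; exact hc)
  have hepoch : ∀ k, epoch x k = epoch x' k := fun k => epoch_congr fun k _ => hint k
  induction i with
  | zero =>
    refine ⟨rfl, fun v => ?_, fun v hv => ?_⟩
    · rw [← map_finish_line, ← map_finish_line, line_zero, line_zero, List.map_map, List.map_map,
        List.forall₂_map_left_iff, List.forall₂_map_right_iff, List.forall₂_same]
      intro i _
      by_cases hcv : ∃ m, c = .initialService v m
      · obtain ⟨m, rfl⟩ := hcv
        rcases lt_or_ge i m with him | him
        · refine .inl ?_
          simp only [Function.comp, finish, start]
          rw [h _ (by simp; omega)]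
          congr 1
          refine Finset.sum_congr rfl fun l hl => h _ ?_
          have := Finset.mem_range.1 hl
          simp; omega
        · have hle : ∀ z : Clock n → ℝ, Regular z →
              finish q₀ z (.initialService v m) ≤ finish q₀ z (.initialService v i) := by
            intro z hz
            simp only [finish, start, ← Finset.sum_range_succ]
            exact Finset.sum_le_sum_of_subset_of_nonneg (Finset.range_mono (by omega))
              fun l _ _ => (hz.initialService v l).le
          exact .inr ⟨hj.trans_le (hle x hx), hj'.trans_le (hle x' hx')⟩
      · push Not at hcv
        refine .inl ?_
        simp only [Function.comp, finish, start]
        rw [h _ (hcv i).symm]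
        congr 1
        exact Finset.sum_congr rfl fun l _ => h _ (hcv l).symm
    · simp only [departures, initialDepartures]
      refine List.map_congr_left fun i hi => Finset.sum_congr rfl fun l hl => h _ ?_
      rintro rfl
      refine hv ((mem_line_zero q₀ x).2 ⟨l, ?_, rfl⟩)
      have := List.mem_range.1 hi
      have := Finset.mem_range.1 hl
      omega
  | succ i ih =>
    obtain ⟨hl, hd, he⟩ := ih (by omega)
    have hle : epoch x (i + 1) ≤ epoch x j := hx.strictMono_epoch.monotone hi
    have hch : choice q₀ x i = choice q₀ x' i := by
      refine choice_congr q₀ ?_ (htie i)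
      rw [← hepoch]
      ext v
      exact AgreeUntil.remaining (hd v) hle
    have hd' : departures q₀ x' (i + 1) (choice q₀ x i)
        = departures q₀ x' i (choice q₀ x i) ++ [finish q₀ x' (.service i)] := by
      rw [hch]; exact departures_succ_choice q₀ x' i
    refine ⟨by simp only [line]; rw [hl, hch], fun v => ?_, fun v hv => ?_⟩
    · by_cases hvc : v = choice q₀ x i
      · subst hvc
        rw [departures_succ_choice, hd']
        refine List.rel_append (hd _) (.cons ?_ .nil)
        by_cases hci : c = .service i
        · subst hci; exact .inr ⟨hj, hj'⟩
        · rw [finish, finish, ← h _ (Ne.symm hci), start, start, ← hch, arrivalTime_eq,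
            arrivalTime_eq, ← hepoch]
          exact (AgreeUntil.serviceStart (hd _)).add (hx.service i).le
      · rw [departures_succ_of_ne _ _ hvc, departures_succ_of_ne _ _ (hch ▸ hvc)]
        exact hd v
    · rw [mem_line_succ] at hv
      push Not at hv
      by_cases hvc : v = choice q₀ x i
      · subst hvc
        rw [departures_succ_choice, hd', he _ hv.1, finish, finish, start, start, ← hch,
          he _ hv.1, arrivalTime_eq, arrivalTime_eq, ← hepoch, h _ (Ne.symm (hv.2 rfl))]
      · rw [departures_succ_of_ne _ _ hvc, departures_succ_of_ne _ _ (hch ▸ hvc), he v hv.1]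

end

section

variable {n : ℕ}

/-! ### Measurability -/

instance : Countable (Clock n) := by
  refine Function.Injective.countable (β := (Fin n × ℕ) ⊕ ℕ ⊕ ℕ ⊕ ℕ) (f := fun c => match c with
    | .initialService v i => .inl (v, i)
    | .interarrival j => .inr (.inl j)
    | .service j => .inr (.inr (.inl j))
    | .tieBreak j => .inr (.inr (.inr j))) ?_
  intro c c' h
  cases c <;> cases c' <;> simp_all

/-- A function is measurable if it coincides with a measurable function on each fiber of a function
with countably many values and measurable fibers. -/
theorem measurable_of_fibers {α S E : Type*} [MeasurableSpace α] [MeasurableSpace E] [Countable S]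
    {f : α → S} (hf : ∀ s, MeasurableSet {x | f x = s}) {G : S → α → E}
    (hG : ∀ s ∈ Set.range f, Measurable (G s)) : Measurable (fun x => G (f x) x) := by
  intro t ht
  have : (fun x => G (f x) x) ⁻¹' t
      = ⋃ s, {x | f x = s} ∩ {x | ∃ _ : s ∈ Set.range f, G s x ∈ t} := by
    ext x
    simp only [Set.mem_preimage, Set.mem_iUnion, Set.mem_inter_iff, Set.mem_ofPred_eq]
    exact ⟨fun h => ⟨f x, rfl, ⟨x, rfl⟩, h⟩, fun ⟨s, hs, _, h⟩ => hs ▸ h⟩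
  rw [this]
  refine MeasurableSet.iUnion fun s => (hf s).inter ?_
  by_cases hs : s ∈ Set.range f
  · convert! hG s hs ht using 1
    ext x; simp [hs]
  · convert! MeasurableSet.empty using 1
    ext x; simp [hs]

theorem measurable_remaining {α ι : Type*} [MeasurableSpace α] {L : List ι} {g : ι → α → ℝ}
    {s : α → ℝ} (hg : ∀ c ∈ L, Measurable (g c)) (hs : Measurable s) :
    Measurable (fun a => remaining (L.map (fun c => g c a)) (s a)) := by
  induction L with
  | nil => simp [remaining]
  | cons c L ih =>
    have h : ∀ a, remaining ((c :: L).map (fun c => g c a)) (s a)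
        = (if s a < g c a then 1 else 0) + remaining (L.map (fun c => g c a)) (s a) := fun a => by
      rw [List.map_cons, ← List.singleton_append, remaining_append, remaining_singleton]
    simp only [h]
    refine Measurable.add (Measurable.ite ?_ measurable_const measurable_const)
      (ih fun c hc => hg c (List.mem_cons_of_mem _ hc))
    exact measurableSet_lt hs (hg c List.mem_cons_self)

theorem measurable_serviceStart {α ι : Type*} [MeasurableSpace α] {L : List ι} {g : ι → α → ℝ}
    {s : α → ℝ} (hg : ∀ c ∈ L, Measurable (g c)) (hs : Measurable s) :
    Measurable (fun a => serviceStart (L.map (fun c => g c a)) (s a)) := by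
  induction L with
  | nil => simpa [serviceStart] using hs
  | cons c L ih =>
    exact (hg c List.mem_cons_self).max (ih fun c hc => hg c (List.mem_cons_of_mem _ hc))

theorem measurable_epoch (j : ℕ) : Measurable (fun x : Clock n → ℝ => epoch x j) :=
  Finset.measurable_sum _ fun _ _ => measurable_pi_apply _

variable [NeZero n]

theorem measurable_joined (q : Fin n → ℕ) : Measurable (joined q) := by
  have : joined q = (fun m : ℕ => (shortest q).orderEmbOfFin rfl
      ⟨min m ((shortest q).card - 1),
      (min_le_right _ _).trans_lt (Nat.sub_lt (shortest_card_pos q) one_pos)⟩) ∘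
      (fun u : ℝ => ⌊u * (shortest q).card⌋₊) := rfl
  rw [this]
  exact measurable_from_top.comp (Nat.measurable_floor.comp (measurable_id.mul_const _))

variable (q₀ : Fin n → ℕ)

theorem measurable_start_initial (v : Fin n) (i : ℕ) :
    Measurable (fun x => start q₀ x (.initialService v i)) :=
  Finset.measurable_sum _ fun _ _ => measurable_pi_apply _

theorem measurable_queue_of {j : ℕ} (hl : ∀ L, MeasurableSet {x | line q₀ x j = L})
    (hs : ∀ k < j, Measurable (fun x => start q₀ x (.service k))) :
    Measurable (fun p : (Clock n → ℝ) × ℝ => queue q₀ p.1 j p.2) := by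
  refine measurable_pi_iff.2 fun v => ?_
  simp only [queue, ← map_finish_line]
  refine measurable_of_fibers (α := (Clock n → ℝ) × ℝ) (f := fun p => line q₀ p.1 j)
    (G := fun L p => remaining ((L v).map (fun c => finish q₀ p.1 c)) p.2)
    (fun L => measurable_fst (hl L)) ?_
  rintro L ⟨p, rfl⟩
  refine measurable_remaining (fun c hc => ?_) measurable_snd
  refine Measurable.add ?_ ((measurable_pi_apply c).comp measurable_fst)
  rcases exists_of_mem_line _ _ hc with ⟨i, _, rfl⟩ | ⟨i, hi, rfl⟩
  · exact (measurable_start_initial q₀ v i).comp measurable_fst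
  · exact (hs i hi).comp measurable_fst

theorem measurableSet_choice_of {j : ℕ} (hl : ∀ L, MeasurableSet {x | line q₀ x j = L})
    (hs : ∀ k < j, Measurable (fun x => start q₀ x (.service k))) :
    Measurable (fun x => choice q₀ x j) := by
  have hq : Measurable (fun x => queue q₀ x j (epoch x (j + 1))) :=
    (measurable_queue_of q₀ hl hs).comp (measurable_id.prodMk (measurable_epoch (j + 1)))
  exact measurable_of_fibers (f := fun x => queue q₀ x j (epoch x (j + 1)))
    (G := fun q x => joined q (x (.tieBreak j))) (fun q => hq (measurableSet_singleton q))
    (fun q _ => (measurable_joined q).comp (measurable_pi_apply _))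

/-- A joint induction: the lines and the starting times of the services of the customers
`0, …, j - 1` determine the server joined by customer `j`, and this server determines the new lines
and the starting time of the service of customer `j`. -/
theorem measurable_line_start (j : ℕ) :
    (∀ L, MeasurableSet {x | line q₀ x j = L}) ∧
      ∀ k < j, Measurable (fun x => start q₀ x (.service k)) := by
  induction j with
  | zero =>
    exact ⟨fun L => by simp only [line]; exact .const _, fun k hk => absurd hk (Nat.not_lt_zero k)⟩
  | succ j ih =>
    obtain ⟨hl, hs⟩ := ih
    have hc := measurableSet_choice_of q₀ hl hs
    have hlc : ∀ s : (Fin n → List (Clock n)) × Fin n,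
        MeasurableSet {x | (line q₀ x j, choice q₀ x j) = s} := fun s => by
      simp only [Prod.ext_iff]
      exact (hl s.1).inter (hc (measurableSet_singleton s.2))
    constructor
    · intro L
      have : {x | line q₀ x (j + 1) = L}
          = ⋃ s : (Fin n → List (Clock n)) × Fin n, {x | (line q₀ x j, choice q₀ x j) = s} ∩
            {_x | Function.update s.1 s.2 (s.1 s.2 ++ [.service j]) = L} := by
        ext x
        simp only [Set.mem_ofPred_eq, Set.mem_iUnion, Set.mem_inter_iff]
        exact ⟨fun h => ⟨_, rfl, h⟩, fun ⟨s, hs, h⟩ => by subst hs; exact h⟩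
      rw [this]
      exact MeasurableSet.iUnion fun s => (hlc s).inter (.const _)
    · intro k hk
      rcases Nat.lt_succ_iff_lt_or_eq.1 hk with hk | rfl
      · exact hs k hk
      simp only [start, ← map_finish_line]
      refine measurable_of_fibers (f := fun x => (line q₀ x k, choice q₀ x k))
        (G := fun s x => serviceStart ((s.1 s.2).map (fun c => finish q₀ x c)) (arrivalTime x k))
        hlc ?_
      rintro _ ⟨x, rfl⟩
      refine measurable_serviceStart (fun c hc => ?_) (measurable_epoch (k + 1))
      refine Measurable.add ?_ (measurable_pi_apply c)
      rcases exists_of_mem_line _ _ hc with ⟨i, _, rfl⟩ | ⟨i, hi, rfl⟩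
      · exact measurable_start_initial q₀ _ i
      · exact hs i hi

theorem measurableSet_line (j : ℕ) (L : Fin n → List (Clock n)) :
    MeasurableSet {x | line q₀ x j = L} := (measurable_line_start q₀ j).1 L

theorem measurable_choice (j : ℕ) : Measurable (fun x => choice q₀ x j) :=
  measurableSet_choice_of q₀ (measurable_line_start q₀ j).1 (measurable_line_start q₀ j).2

theorem measurable_start (c : Clock n) : Measurable (fun x => start q₀ x c) := by
  cases c with
  | initialService v i => exact measurable_start_initial q₀ v i
  | service j => exact (measurable_line_start q₀ (j + 1)).2 j (Nat.lt_succ_self j)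
  | interarrival j => exact measurable_const
  | tieBreak j => exact measurable_const

theorem measurable_finish (c : Clock n) : Measurable (fun x => finish q₀ x c) :=
  (measurable_start q₀ c).add (measurable_pi_apply c)

theorem measurable_queue (j : ℕ) :
    Measurable (fun p : (Clock n → ℝ) × ℝ => queue q₀ p.1 j p.2) :=
  measurable_queue_of q₀ (measurable_line_start q₀ j).1 (measurable_line_start q₀ j).2

theorem measurable_comp_queue {E : Type*} [MeasurableSpace E] (j : ℕ) (F : (Fin n → ℕ) → E) :
    Measurable (fun p : (Clock n → ℝ) × ℝ => F (queue q₀ p.1 j p.2)) :=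
  (measurable_of_countable F).comp (measurable_queue q₀ j)

theorem measurable_comp_line_queue {E : Type*} [MeasurableSpace E] (j : ℕ)
    (F : (Fin n → List (Clock n)) → (Fin n → ℕ) → E) :
    Measurable (fun p : (Clock n → ℝ) × ℝ => F (line q₀ p.1 j) (queue q₀ p.1 j p.2)) :=
  measurable_of_fibers (α := (Clock n → ℝ) × ℝ) (f := fun p => line q₀ p.1 j)
    (G := fun L p => F L (queue q₀ p.1 j p.2))
    (fun L => measurable_fst (measurableSet_line q₀ j L))
    fun L _ => measurable_comp_queue q₀ j (F L)

end

section

/-! ### Exponential clocks -/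

theorem expMeasure_eq (r : ℝ) : expMeasure r = volume.withDensity (exponentialPDF r) := rfl

theorem measurable_exponentialPDF (r : ℝ) : Measurable (exponentialPDF r) :=
  (measurable_exponentialPDFReal r).ennreal_ofReal

theorem expMeasure_Ioi {r : ℝ} (hr : 0 < r) {b : ℝ} (hb : 0 ≤ b) :
    expMeasure r (Set.Ioi b) = ENNReal.ofReal (Real.exp (-(r * b))) := by
  have := isProbabilityMeasure_expMeasure hr
  have h1 : expMeasure r (Set.Iic b) = ENNReal.ofReal (1 - Real.exp (-(r * b))) := by
    rw [← ENNReal.ofReal_toReal (measure_ne_top (expMeasure r) (Set.Iic b))]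
    have := cdf_expMeasure_eq hr b
    rw [cdf_eq_real, if_pos hb] at this
    rw [← this]; rfl
  rw [← Set.compl_Iic, prob_compl_eq_one_sub measurableSet_Iic, h1, ← ENNReal.ofReal_one,
    ← ENNReal.ofReal_sub]
  · congr 1; ring
  · have : Real.exp (-(r * b)) ≤ 1 := Real.exp_le_one_iff.2 (by nlinarith)
    linarith

theorem ae_pos_expMeasure {r : ℝ} (hr : 0 < r) : ∀ᵐ y ∂expMeasure r, 0 < y := by
  have := isProbabilityMeasure_expMeasure hr
  have h := expMeasure_Ioi hr le_rfl
  rw [mul_zero, neg_zero, Real.exp_zero, ENNReal.ofReal_one] at h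
  exact (mem_ae_iff_prob_eq_one measurableSet_Ioi).2 h

/-- For an exponential time `Y` of rate `r`, the event at time `a + Y` is compensated by the
rate `r` at all times from `a` until then. -/
theorem lintegral_expMeasure {r : ℝ} (hr : 0 < r) (a : ℝ) {g : ℝ → ℝ≥0∞} (hg : Measurable g) :
    ∫⁻ y, g (a + y) ∂expMeasure r
      = ENNReal.ofReal r * ∫⁻ y, (∫⁻ u, (Set.Ico a (a + y)).indicator g u) ∂expMeasure r := by
  have := isProbabilityMeasure_expMeasure hr
  have hmeas : Measurable (fun p : ℝ × ℝ => (Set.Ico a (a + p.1)).indicator g p.2) := by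
    refine Measurable.indicator (s := {p : ℝ × ℝ | p.2 ∈ Set.Ico a (a + p.1)})
      (hg.comp measurable_snd) ?_
    exact (measurableSet_le measurable_const measurable_snd).inter
      (measurableSet_lt measurable_snd (measurable_const.add measurable_fst))
  have hleft : ∫⁻ y, g (a + y) ∂expMeasure r = ∫⁻ y, exponentialPDF r y * g (a + y) := by
    rw [expMeasure_eq]
    exact lintegral_withDensity_eq_lintegral_mul _ (measurable_exponentialPDF r)
      (hg.comp (measurable_const_add a))
  rw [lintegral_lintegral_swap hmeas.aemeasurable, hleft,
    ← lintegral_const_mul _ (Measurable.lintegral_prod_left (by exact hmeas)),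
    ← lintegral_sub_right_eq_self _ a]
  refine lintegral_congr fun u => ?_
  rw [add_sub_cancel]
  rcases lt_or_ge u a with h | h
  · rw [exponentialPDF_of_neg (by linarith)]
    have : ∀ y, (Set.Ico a (a + y)).indicator g u = 0 := fun y =>
      Set.indicator_of_notMem (fun h' => absurd h'.1 (not_le.2 h)) _
    simp [this]
  · have : ∀ y, (Set.Ico a (a + y)).indicator g u
        = (Set.Ioi (u - a)).indicator (fun _ => g u) y := by
      intro y
      by_cases hy : u - a < y
      · rw [Set.indicator_of_mem (show u ∈ Set.Ico a (a + y) from ⟨h, by linarith⟩),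
          Set.indicator_of_mem (by exact hy)]
      · rw [Set.indicator_of_notMem fun h' => hy (by linarith [h'.2]),
          Set.indicator_of_notMem (by exact hy)]
    simp only [this]
    rw [lintegral_indicator_const measurableSet_Ioi, expMeasure_Ioi hr (by linarith),
      exponentialPDF_of_nonneg (by linarith), ENNReal.ofReal_mul hr.le]
    ring

variable {n : ℕ} {lam : ℝ}

/-- The joint law of all clocks. -/
def clockLaw (n : ℕ) (lam : ℝ) : Measure (Clock n → ℝ) := Measure.infinitePi (Clock.law n lam)

theorem isProbabilityMeasure_law [NeZero n] (hlam : 0 < lam) (c : Clock n) :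
    IsProbabilityMeasure (Clock.law n lam c) := by
  have hn : (0 : ℝ) < n := Nat.cast_pos.2 (Nat.pos_of_ne_zero (NeZero.ne n))
  cases c with
  | initialService v i => exact isProbabilityMeasure_expMeasure one_pos
  | interarrival j => exact isProbabilityMeasure_expMeasure (by positivity)
  | service j => exact isProbabilityMeasure_expMeasure one_pos
  | tieBreak j => exact ⟨by simp [Clock.law]⟩

theorem Regular.update {x : Clock n → ℝ} (h : Regular x) (c : Clock n) {y : ℝ} (hy : 0 < y) :
    Regular (Function.update x c y) := by
  have key : ∀ c', 0 < x c' → 0 < Function.update x c y c' := fun c' h' => by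
    by_cases hc : c' = c
    · subst hc; simpa using hy
    · simpa [hc] using h'
  exact ⟨fun j => key _ (h.interarrival j), fun j => key _ (h.service j),
    fun v i => key _ (h.initialService v i)⟩

theorem law_of_isService {c : Clock n} (hc : c.IsService) : Clock.law n lam c = expMeasure 1 := by
  cases c with
  | initialService v i => rfl
  | service j => rfl
  | interarrival j => exact hc.elim
  | tieBreak j => exact hc.elim

/-- The integral of a function over `[0, s]`, restricted to the times between the arrivals of
customers `j - 1` and `j`. -/
def windowIntegral (x : Clock n → ℝ) (j : ℕ) (s : ℝ) (g : ℝ → ℝ≥0∞) : ℝ≥0∞ :=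
  ∫⁻ u in Set.Icc 0 s, (Set.Ico (epoch x j) (epoch x (j + 1))).indicator g u

theorem measurable_window {f : (Clock n → ℝ) → ℝ → ℝ≥0∞} (hf : Measurable f.uncurry) (j : ℕ) :
    Measurable (fun p : (Clock n → ℝ) × ℝ =>
      (Set.Ico (epoch p.1 j) (epoch p.1 (j + 1))).indicator (f p.1) p.2) := by
  refine Measurable.indicator (s := {p : (Clock n → ℝ) × ℝ |
    p.2 ∈ Set.Ico (epoch p.1 j) (epoch p.1 (j + 1))}) hf ?_
  exact (measurableSet_le ((measurable_epoch j).comp measurable_fst) measurable_snd).inter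
    (measurableSet_lt measurable_snd ((measurable_epoch (j + 1)).comp measurable_fst))

theorem measurable_windowIntegral {f : (Clock n → ℝ) → ℝ → ℝ≥0∞} (hf : Measurable f.uncurry)
    (j : ℕ) (s : ℝ) : Measurable (fun x => windowIntegral x j s (f x)) :=
  Measurable.lintegral_prod_right' (measurable_window hf j)

theorem windowIntegral_eq {x : Clock n → ℝ} (hx : Regular x) (j : ℕ) (s : ℝ) (g : ℝ → ℝ≥0∞) :
    windowIntegral x j s g = ∫⁻ u,
      if epoch x j < u ∧ u ≤ epoch x (j + 1) ∧ u ≤ s then g u else 0 := by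
  rw [windowIntegral, ← lintegral_indicator measurableSet_Icc]
  refine lintegral_congr_ae ?_
  have h1 : ∀ᵐ u : ℝ, u ≠ epoch x j := by simp [ae_iff]
  have h2 : ∀ᵐ u : ℝ, u ≠ epoch x (j + 1) := by simp [ae_iff]
  filter_upwards [h1, h2] with u h1 h2
  have h0 := hx.epoch_nonneg j
  split_ifs with h
  · have h4 := h.2.1.lt_of_ne h2
    rw [Set.indicator_of_mem, Set.indicator_of_mem]
    · exact ⟨h.1.le, h4⟩
    · exact ⟨h0.trans h.1.le, h.2.2⟩
  · by_cases h3 : u ∈ Set.Icc 0 s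
    · rw [Set.indicator_of_mem h3, Set.indicator_of_notMem]
      exact fun h4 => h ⟨lt_of_le_of_ne h4.1 (Ne.symm h1), h4.2.le, h3.2⟩
    · rw [Set.indicator_of_notMem h3]

theorem epoch_update_of_isService (x : Clock n → ℝ) {c : Clock n} (hc : c.IsService) (y : ℝ)
    (j : ℕ) : epoch (Function.update x c y) j = epoch x j :=
  epoch_congr fun k _ => by rw [Function.update_of_ne]; rintro rfl; exact hc

theorem epoch_update_interarrival (x : Clock n → ℝ) (j : ℕ) (y : ℝ) :
    epoch (Function.update x (.interarrival j) y) j = epoch x j :=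
  epoch_congr fun k hk => by rw [Function.update_of_ne]; simp; omega

variable [NeZero n]

theorem isProbabilityMeasure_clockLaw (hlam : 0 < lam) :
    IsProbabilityMeasure (clockLaw n lam) := by
  have := isProbabilityMeasure_law (n := n) hlam
  rw [clockLaw]; infer_instance

/-- Replacing one clock by an independent copy does not change the joint law. -/
theorem lintegral_clockLaw_update (hlam : 0 < lam) (c : Clock n) {Φ : (Clock n → ℝ) → ℝ≥0∞}
    (hΦ : Measurable Φ) :
    ∫⁻ x, Φ x ∂clockLaw n lam
      = ∫⁻ x, ∫⁻ y, Φ (Function.update x c y) ∂Clock.law n lam c ∂clockLaw n lam := by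
  have := isProbabilityMeasure_law (n := n) hlam
  have := isProbabilityMeasure_clockLaw (n := n) hlam
  have hupd : Measurable (fun p : (Clock n → ℝ) × ℝ => Function.update p.1 c p.2) := by
    refine measurable_pi_iff.2 fun c' => ?_
    by_cases h : c' = c
    · subst h; simpa using measurable_snd
    · simp only [Function.update_of_ne h]
      exact (measurable_pi_apply c').comp measurable_fst
  have h : ((clockLaw n lam).prod (Clock.law n lam c)).map
      (fun p => Function.update p.1 c p.2) = clockLaw n lam := by
    refine Measure.eq_infinitePi _ fun s t ht => ?_
    rw [Measure.map_apply hupd (MeasurableSet.pi s.countable_toSet fun i _ => ht i)]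
    have hpre : (fun p : (Clock n → ℝ) × ℝ => Function.update p.1 c p.2) ⁻¹' (Set.pi s t)
        = (Set.pi (s.erase c) t) ×ˢ (if c ∈ s then t c else Set.univ) := by
      ext p
      simp only [Set.mem_preimage, Set.mem_pi, Set.mem_prod, Finset.mem_coe, Finset.mem_erase]
      constructor
      · intro h
        refine ⟨fun i hi => by simpa [hi.1] using h i hi.2, ?_⟩
        split_ifs with hc
        · simpa using h c hc
        · trivial
      · rintro ⟨h1, h2⟩ i hi
        by_cases hic : i = c
        · subst hic; simpa [hi] using h2
        · simpa [hic] using h1 i ⟨hic, hi⟩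
    rw [hpre, Measure.prod_prod, clockLaw, Measure.infinitePi_pi _ fun i _ => ht i]
    split_ifs with hc
    · rw [Finset.prod_erase_mul _ _ hc]
    · rw [measure_univ, mul_one, Finset.erase_eq_of_notMem hc]
  nth_rewrite 1 [← h]
  rw [lintegral_map hΦ hupd]
  exact lintegral_prod _ (hΦ.comp hupd).aemeasurable

theorem ae_regular (hlam : 0 < lam) : ∀ᵐ x ∂clockLaw n lam, Regular x := by
  have := isProbabilityMeasure_law (n := n) hlam
  have hn : (0 : ℝ) < n := Nat.cast_pos.2 (Nat.pos_of_ne_zero (NeZero.ne n))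
  have key : ∀ (c : Clock n), (∀ᵐ y ∂Clock.law n lam c, 0 < y) →
      ∀ᵐ x ∂clockLaw n lam, 0 < x c := fun c hc =>
    (measurePreserving_eval_infinitePi (Clock.law n lam) c).quasiMeasurePreserving.ae hc
  have h1 : ∀ᵐ x ∂clockLaw n lam, ∀ j, 0 < x (.interarrival j) :=
    ae_all_iff.2 fun j => key _ (ae_pos_expMeasure (by positivity))
  have h2 : ∀ᵐ x ∂clockLaw n lam, ∀ j, 0 < x (.service j) :=
    ae_all_iff.2 fun j => key _ (ae_pos_expMeasure one_pos)
  have h3 : ∀ᵐ x ∂clockLaw n lam, ∀ v i, 0 < x (.initialService v i) :=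
    ae_all_iff.2 fun v => ae_all_iff.2 fun i => key _ (ae_pos_expMeasure one_pos)
  filter_upwards [h1, h2, h3] with x h1 h2 h3 using ⟨h1, h2, h3⟩

/-- The compensation of `lintegral_expMeasure` for a single clock, the others being frozen. -/
theorem lintegral_compensate (hlam : 0 < lam) {r : ℝ} (hr : 0 < r) {c : Clock n}
    (hc : Clock.law n lam c = expMeasure r) {Φ Ψ : (Clock n → ℝ) → ℝ≥0∞}
    (hΦ : Measurable Φ) (hΨ : Measurable Ψ)
    (h : ∀ x, Regular x → ∃ (a : ℝ) (g : ℝ → ℝ≥0∞), Measurable g ∧ ∀ y, 0 < y →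
      Φ (Function.update x c y) = g (a + y) ∧
      Ψ (Function.update x c y) = ∫⁻ u, (Set.Ico a (a + y)).indicator g u) :
    ∫⁻ x, Φ x ∂clockLaw n lam = ENNReal.ofReal r * ∫⁻ x, Ψ x ∂clockLaw n lam := by
  rw [lintegral_clockLaw_update hlam c hΦ, lintegral_clockLaw_update hlam c hΨ,
    ← lintegral_const_mul']
  swap; · exact ENNReal.ofReal_ne_top
  refine lintegral_congr_ae ?_
  filter_upwards [ae_regular hlam] with x hx
  obtain ⟨a, g, hg, hyg⟩ := h x hx
  rw [hc, lintegral_congr_ae (g := fun y => g (a + y)), lintegral_expMeasure hr a hg]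
  · congr 1
    refine lintegral_congr_ae ?_
    filter_upwards [ae_pos_expMeasure hr] with y hy using (hyg y hy).2.symm
  · filter_upwards [ae_pos_expMeasure hr] with y hy using (hyg y hy).1

/-- Arrivals occur at rate `lam * n`. -/
theorem lintegral_arrival (hlam : 0 < lam) (j : ℕ) (s : ℝ) {f : (Clock n → ℝ) → ℝ → ℝ≥0∞}
    (hf : Measurable f.uncurry)
    (hinv : ∀ x y, f (Function.update x (.interarrival j) y) = f x) :
    ∫⁻ x, (if epoch x (j + 1) ≤ s then f x (epoch x (j + 1)) else 0) ∂clockLaw n lam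
      = ENNReal.ofReal (lam * n) * ∫⁻ x, windowIntegral x j s (f x) ∂clockLaw n lam := by
  have hn : (0 : ℝ) < n := Nat.cast_pos.2 (Nat.pos_of_ne_zero (NeZero.ne n))
  refine lintegral_compensate hlam (by positivity) (c := .interarrival j) rfl ?_
    (measurable_windowIntegral hf j s) fun x hx => ⟨epoch x j, fun u => if u ≤ s then f x u else 0,
      ?_, fun y hy => ⟨?_, ?_⟩⟩
  · exact Measurable.ite (measurableSet_le (measurable_epoch _) measurable_const)
      (hf.comp (measurable_id.prodMk (measurable_epoch (j + 1)))) measurable_const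
  · exact Measurable.ite measurableSet_Iic (hf.comp (measurable_const.prodMk measurable_id))
      measurable_const
  · rw [hinv, epoch_succ, epoch_update_interarrival]; simp
  · rw [windowIntegral_eq (hx.update _ hy), hinv, epoch_succ, epoch_update_interarrival]
    refine lintegral_congr_ae ?_
    have h1 : ∀ᵐ u : ℝ, u ≠ epoch x j := by simp [ae_iff]
    have h2 : ∀ᵐ u : ℝ, u ≠ epoch x j + y := by simp [ae_iff]
    filter_upwards [h1, h2] with u h1 h2
    simp only [Function.update_self]
    by_cases h : u ∈ Set.Ico (epoch x j) (epoch x j + y)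
    · rw [Set.indicator_of_mem h]
      have := lt_of_le_of_ne h.1 (Ne.symm h1)
      simp [this, h.2.le]
    · rw [Set.indicator_of_notMem h, if_neg]
      exact fun h' => h ⟨h'.1.le, lt_of_le_of_ne h'.2.1 h2⟩

variable (q₀ : Fin n → ℕ)

/-- Customers in service leave at rate `1`. The weight `f` at the end of the service with clock `c`
may depend on everything but the length of this service. -/
theorem lintegral_departure (hlam : 0 < lam) {c : Clock n} (hc : c.IsService) (j : ℕ) (s : ℝ)
    {f : (Clock n → ℝ) → ℝ → ℝ≥0∞} (hf : Measurable f.uncurry)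
    (hinv : ∀ x x', Regular x → Regular x' → (∀ c' ≠ c, x c' = x' c') →
      epoch x j < finish q₀ x c → epoch x j < finish q₀ x' c → f x = f x') :
    ∫⁻ x, (if epoch x j < finish q₀ x c ∧ finish q₀ x c ≤ epoch x (j + 1) ∧ finish q₀ x c ≤ s
        then f x (finish q₀ x c) else 0) ∂clockLaw n lam
      = ∫⁻ x, windowIntegral x j s
          (fun u => if start q₀ x c ≤ u ∧ u < finish q₀ x c then f x u else 0)
          ∂clockLaw n lam := by
  have hfin := measurable_finish q₀ c
  have hst := measurable_start q₀ c
  have hf' : Measurable (fun p : (Clock n → ℝ) × ℝ =>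
      if start q₀ p.1 c ≤ p.2 ∧ p.2 < finish q₀ p.1 c then f p.1 p.2 else 0) :=
    Measurable.ite ((measurableSet_le (hst.comp measurable_fst) measurable_snd).inter
      (measurableSet_lt measurable_snd (hfin.comp measurable_fst))) hf measurable_const
  rw [← one_mul (∫⁻ x, windowIntegral x j s _ ∂_), ← ENNReal.ofReal_one]
  refine lintegral_compensate hlam one_pos (law_of_isService hc) ?_
    (measurable_windowIntegral hf' j s) fun x hx => ?_
  · refine Measurable.ite ?_ (hf.comp (measurable_id.prodMk hfin)) measurable_const
    exact (measurableSet_lt (measurable_epoch j) hfin).inter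
      ((measurableSet_le hfin (measurable_epoch (j + 1))).inter
        (measurableSet_le hfin measurable_const))
  -- a realization with a service that is long enough
  set y₀ := max 1 (epoch x j - start q₀ x c + 1) with hy₀
  set x₀ := Function.update x c y₀ with hx₀
  have hy₀pos : 0 < y₀ := lt_max_of_lt_left one_pos
  have hstart : ∀ y, start q₀ (Function.update x c y) c = start q₀ x c := fun y =>
    start_congr q₀ fun c' hc' => by rw [Function.update_of_ne hc']
  have hfinish : ∀ y, finish q₀ (Function.update x c y) c = start q₀ x c + y := fun y => by
    rw [finish, hstart, Function.update_self]
  have hlong : epoch x j < start q₀ x c + y₀ := by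
    have := le_max_right 1 (epoch x j - start q₀ x c + 1)
    linarith
  have heq : ∀ y, 0 < y → epoch x j < start q₀ x c + y → f (Function.update x c y) = f x₀ := by
    intro y hy h
    refine hinv _ _ (hx.update c hy) (hx.update c hy₀pos) (fun c' hc' => ?_) ?_ ?_
    · rw [hx₀, Function.update_of_ne hc', Function.update_of_ne hc']
    · rwa [epoch_update_of_isService x hc, hfinish]
    · rwa [epoch_update_of_isService x hc, hx₀, hfinish]
  refine ⟨start q₀ x c, fun u => if epoch x j < u ∧ u ≤ epoch x (j + 1) ∧ u ≤ s then f x₀ u else 0,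
    ?_, fun y hy => ⟨?_, ?_⟩⟩
  · exact Measurable.ite (measurableSet_Ioi.inter (measurableSet_Iic.inter measurableSet_Iic))
      (hf.comp (measurable_const.prodMk measurable_id)) measurable_const
  · simp only [epoch_update_of_isService x hc, hfinish]
    split_ifs with h
    · rw [heq y hy h.1]
    · rfl
  · rw [windowIntegral_eq (hx.update c hy)]
    refine lintegral_congr fun u => ?_
    simp only [epoch_update_of_isService x hc, hfinish, hstart]
    rw [Set.indicator_apply]
    by_cases h1 : u ∈ Set.Ico (start q₀ x c) (start q₀ x c + y)
    · rw [if_pos h1]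
      split_ifs with h2 h3
      · rw [heq y hy (h2.1.trans h1.2)]
      · exact absurd h1 h3
      · rfl
    · rw [if_neg h1]
      split_ifs with h2 h3
      · exact absurd h3 h1
      · rfl
      · rfl

/-- The mean remaining service time is `1`. -/
theorem lintegral_remaining_service (hlam : 0 < lam) {c : Clock n} (hc : c.IsService) (j : ℕ)
    {F : (Clock n → ℝ) → ℝ≥0∞} (hF : Measurable F)
    (hinv : ∀ x x', Regular x → Regular x' → (∀ c' ≠ c, x c' = x' c') →
      epoch x j < finish q₀ x c → epoch x j < finish q₀ x' c → F x = F x') :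
    ∫⁻ x, F x * ENNReal.ofReal (finish q₀ x c - max (start q₀ x c) (epoch x j)) ∂clockLaw n lam
      = ∫⁻ x, (if epoch x j < finish q₀ x c then F x else 0) ∂clockLaw n lam := by
  have hfin := measurable_finish q₀ c
  have hst := measurable_start q₀ c
  symm
  rw [← one_mul (∫⁻ x, F x * _ ∂_), ← ENNReal.ofReal_one]
  refine lintegral_compensate hlam one_pos (law_of_isService hc) ?_ ?_ fun x hx => ?_
  · exact Measurable.ite (measurableSet_lt (measurable_epoch j) hfin) hF measurable_const
  · exact hF.mul (hfin.sub (hst.max (measurable_epoch j))).ennreal_ofReal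
  set y₀ := max 1 (epoch x j - start q₀ x c + 1) with hy₀
  set x₀ := Function.update x c y₀ with hx₀
  have hy₀pos : 0 < y₀ := lt_max_of_lt_left one_pos
  have hstart : ∀ y, start q₀ (Function.update x c y) c = start q₀ x c := fun y =>
    start_congr q₀ fun c' hc' => by rw [Function.update_of_ne hc']
  have hfinish : ∀ y, finish q₀ (Function.update x c y) c = start q₀ x c + y := fun y => by
    rw [finish, hstart, Function.update_self]
  have hlong : epoch x j < start q₀ x c + y₀ := by
    have := le_max_right 1 (epoch x j - start q₀ x c + 1)
    linarith
  have heq : ∀ y, 0 < y → epoch x j < start q₀ x c + y → F (Function.update x c y) = F x₀ := by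
    intro y hy h
    refine hinv _ _ (hx.update c hy) (hx.update c hy₀pos) (fun c' hc' => ?_) ?_ ?_
    · rw [hx₀, Function.update_of_ne hc', Function.update_of_ne hc']
    · rwa [epoch_update_of_isService x hc, hfinish]
    · rwa [epoch_update_of_isService x hc, hx₀, hfinish]
  refine ⟨start q₀ x c, (Set.Ioi (epoch x j)).indicator fun _ => F x₀,
    measurable_const.indicator measurableSet_Ioi, fun y hy => ⟨?_, ?_⟩⟩
  · rw [epoch_update_of_isService x hc, hfinish, Set.indicator_apply]
    split_ifs with h h'
    · rw [heq y hy h]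
    · exact absurd h h'
    · exact absurd ‹_› h
    · rfl
  · rw [epoch_update_of_isService x hc, hfinish, hstart]
    have hvol : volume (Set.Ico (start q₀ x c) (start q₀ x c + y) ∩ Set.Ioi (epoch x j))
        = ENNReal.ofReal (start q₀ x c + y - max (start q₀ x c) (epoch x j)) := by
      rw [← Real.volume_Ioo, ← Set.Ioo_inter_Ioi]
      exact measure_congr (Ioo_ae_eq_Ico.symm.inter (ae_eq_refl _))
    rw [Set.indicator_indicator, lintegral_indicator_const
      (measurableSet_Ico.inter measurableSet_Ioi), hvol]
    rcases lt_or_ge (epoch x j) (start q₀ x c + y) with h | h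
    · rw [heq y hy h]
    · rw [ENNReal.ofReal_of_nonpos, mul_zero, mul_zero]
      linarith [le_max_right (start q₀ x c) (epoch x j)]

end

section

variable {n : ℕ} {lam : ℝ}

/-! ### The state at a fixed time -/

/-- All times are positive, and only finitely many customers arrive in bounded time. -/
structure Good (x : Clock n → ℝ) : Prop extends Regular x where
  exists_lt_epoch : ∀ s, ∃ j, s < epoch x j

theorem Regular.window_unique {x : Clock n → ℝ} (h : Regular x) {i j : ℕ} {u : ℝ}
    (hi : u ∈ Set.Ico (epoch x i) (epoch x (i + 1)))
    (hj : u ∈ Set.Ico (epoch x j) (epoch x (j + 1))) : i = j := by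
  have h1 := h.strictMono_epoch.lt_iff_lt.1 (hi.1.trans_lt hj.2)
  have h2 := h.strictMono_epoch.lt_iff_lt.1 (hj.1.trans_lt hi.2)
  omega

theorem Good.exists_window {x : Clock n → ℝ} (h : Good x) {s : ℝ} (hs : 0 ≤ s) :
    ∃ j, s ∈ Set.Ico (epoch x j) (epoch x (j + 1)) := by
  classical
  have hex := h.exists_lt_epoch s
  have hpos : Nat.find hex ≠ 0 := fun h0 => by
    have := Nat.find_spec hex
    rw [h0, epoch_zero] at this
    linarith
  obtain ⟨j, hj⟩ := Nat.exists_eq_succ_of_ne_zero hpos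
  refine ⟨j, not_lt.1 (Nat.find_min hex (by omega)), ?_⟩
  have := Nat.find_spec hex
  rwa [hj] at this

theorem Regular.arrivals_eq {x : Clock n → ℝ} (h : Regular x) {j : ℕ} {s : ℝ}
    (hj : s ∈ Set.Ico (epoch x j) (epoch x (j + 1))) : arrivals x s = j := by
  have : {i | arrivalTime x i ≤ s} = (Finset.range j : Set ℕ) := by
    ext i
    simp only [arrivalTime_eq, Set.mem_ofPred_eq, Finset.coe_range, Set.mem_Iio]
    constructor
    · intro hi
      have := h.strictMono_epoch.lt_iff_lt.1 (hi.trans_lt hj.2)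
      omega
    · exact fun hi => (h.strictMono_epoch.monotone (by omega)).trans hj.1
  rw [arrivals, this, Set.encard_coe_eq_coe_finsetCard, Finset.card_range]

variable [NeZero n] (q₀ : Fin n → ℕ)

theorem Regular.queueLength_eq {x : Clock n → ℝ} (h : Regular x) {j : ℕ} {s : ℝ}
    (hj : s ∈ Set.Ico (epoch x j) (epoch x (j + 1))) :
    queueLength q₀ x s = queue q₀ x j s := by
  ext v
  rw [queueLength, h.arrivals_eq hj]; rfl

/-- A function of the queue lengths at time `u`, as a sum over the numbers of earlier arrivals. -/
def windowSum (F : (Fin n → ℕ) → ℝ≥0∞) (x : Clock n → ℝ) (u : ℝ) : ℝ≥0∞ :=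
  ∑' j, (Set.Ico (epoch x j) (epoch x (j + 1))).indicator (fun u => F (queue q₀ x j u)) u

theorem measurable_windowSum (F : (Fin n → ℕ) → ℝ≥0∞) :
    Measurable (fun p : (Clock n → ℝ) × ℝ => windowSum q₀ F p.1 p.2) :=
  Measurable.tsum fun j => measurable_window (f := fun x u => F (queue q₀ x j u))
    (measurable_comp_queue q₀ j F) j

theorem Regular.windowSum_eq {x : Clock n → ℝ} (h : Regular x) {j : ℕ} {s : ℝ}
    (hj : s ∈ Set.Ico (epoch x j) (epoch x (j + 1))) (F : (Fin n → ℕ) → ℝ≥0∞) :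
    windowSum q₀ F x s = F (queue q₀ x j s) := by
  rw [windowSum, tsum_eq_single j, Set.indicator_of_mem hj]
  exact fun i hi => Set.indicator_of_notMem (fun hi' => hi (h.window_unique hi' hj)) _

theorem Good.windowSum_eq_queueLength {x : Clock n → ℝ} (h : Good x) {s : ℝ} (hs : 0 ≤ s)
    (F : (Fin n → ℕ) → ℝ≥0∞) : windowSum q₀ F x s = F (queueLength q₀ x s) := by
  obtain ⟨j, hj⟩ := h.exists_window hs
  rw [h.windowSum_eq q₀ hj, h.queueLength_eq q₀ hj]

theorem sum_windowIntegral_eq {x : Clock n → ℝ} (s : ℝ) (F : (Fin n → ℕ) → ℝ≥0∞) :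
    ∑' j, windowIntegral x j s (fun u => F (queue q₀ x j u))
      = ∫⁻ u in Set.Icc 0 s, windowSum q₀ F x u := by
  simp only [windowIntegral, windowSum]
  rw [lintegral_tsum]
  exact fun j => ((measurable_window (f := fun x u => F (queue q₀ x j u))
    (measurable_comp_queue q₀ j F) j).comp (measurable_prodMk_left (x := x))).aemeasurable

/-- The mean number of arrivals in `[0, s]` is at most `lam * n * s`, hence this number is almost
surely finite. -/
theorem ae_good (hlam : 0 < lam) : ∀ᵐ x ∂clockLaw n lam, Good x := by
  have := isProbabilityMeasure_clockLaw (n := n) hlam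
  have key : ∀ s : ℕ, ∀ᵐ x ∂clockLaw n lam, ∃ j, (s : ℝ) < epoch x j := by
    intro s
    have hmeas : ∀ j, Measurable (fun x : Clock n → ℝ =>
        if epoch x (j + 1) ≤ s then (1 : ℝ≥0∞) else 0) := fun j =>
      Measurable.ite (measurableSet_le (measurable_epoch _) measurable_const)
        measurable_const measurable_const
    have h1 : ∀ j, ∫⁻ x, (if epoch x (j + 1) ≤ s then (1 : ℝ≥0∞) else 0) ∂clockLaw n lam
        = ENNReal.ofReal (lam * n) * ∫⁻ x, windowIntegral x j s (fun _ => 1) ∂clockLaw n lam :=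
      fun j => lintegral_arrival hlam j s (f := fun _ _ => 1) measurable_const fun _ _ => rfl
    have h2 : ∫⁻ x, ∑' j, (if epoch x (j + 1) ≤ s then (1 : ℝ≥0∞) else 0) ∂clockLaw n lam
        ≤ ENNReal.ofReal (lam * n) * s := by
      rw [lintegral_tsum fun j => (hmeas j).aemeasurable]
      simp only [h1]
      rw [ENNReal.tsum_mul_left, ← lintegral_tsum fun j => (measurable_windowIntegral
        (f := fun _ _ => 1) measurable_const j s).aemeasurable]
      gcongr
      calc ∫⁻ x, ∑' j, windowIntegral x j s (fun _ => 1) ∂clockLaw n lam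
          ≤ ∫⁻ _x, s ∂clockLaw n lam := by
            refine lintegral_mono_ae ?_
            filter_upwards [ae_regular hlam] with x hx
            rw [sum_windowIntegral_eq (0 : Fin n → ℕ) s fun _ => 1]
            calc ∫⁻ u in Set.Icc 0 (s : ℝ), windowSum 0 (fun _ => 1) x u
                ≤ ∫⁻ u in Set.Icc 0 (s : ℝ), 1 := by
                  refine lintegral_mono fun u => ?_
                  by_cases hu : ∃ j, u ∈ Set.Ico (epoch x j) (epoch x (j + 1))
                  · obtain ⟨j, hj⟩ := hu
                    rw [hx.windowSum_eq _ hj]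
                  · push Not at hu
                    rw [windowSum, ENNReal.tsum_eq_zero.2 fun j => Set.indicator_of_notMem (hu j) _]
                    exact zero_le
              _ = s := by simp
        _ = s := by simp
    have h3 : ∀ᵐ x ∂clockLaw n lam, ∑' j, (if epoch x (j + 1) ≤ s then (1 : ℝ≥0∞) else 0) < ∞ :=
      ae_lt_top (Measurable.tsum hmeas)
        (ne_top_of_le_ne_top (ENNReal.mul_ne_top ENNReal.ofReal_ne_top (by simp)) h2)
    filter_upwards [h3] with x hx
    by_contra! hcon
    simp only [hcon, if_true] at hx
    exact absurd hx (by simp [ENNReal.tsum_const_eq_top_of_ne_zero one_ne_zero])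
  filter_upwards [ae_regular hlam, ae_all_iff.2 key] with x hx hx'
  refine ⟨hx, fun s => ?_⟩
  obtain ⟨m, hm⟩ := exists_nat_ge s
  obtain ⟨j, hj⟩ := hx' m
  exact ⟨j, hm.trans_lt hj⟩

/-- The mean of a function of the queue lengths at time `s`. -/
def mean (lam : ℝ) (F : (Fin n → ℕ) → ℝ≥0∞) (s : ℝ) : ℝ≥0∞ :=
  ∫⁻ x, F (queueLength q₀ x s) ∂clockLaw n lam

/-- The mean of the integral over `[0, s]` of a function of the queue lengths. -/
def occupation (lam : ℝ) (F : (Fin n → ℕ) → ℝ≥0∞) (s : ℝ) : ℝ≥0∞ :=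
  ∫⁻ u in Set.Icc 0 s, mean q₀ lam F u

variable {q₀}

theorem aemeasurable_queueLength (hlam : 0 < lam) (F : (Fin n → ℕ) → ℝ≥0∞) {s : ℝ} (hs : 0 ≤ s) :
    AEMeasurable (fun x => F (queueLength q₀ x s)) (clockLaw n lam) := by
  refine ⟨fun x => windowSum q₀ F x s,
    (measurable_windowSum q₀ F).comp (measurable_id.prodMk measurable_const), ?_⟩
  filter_upwards [ae_good hlam] with x hx using (hx.windowSum_eq_queueLength q₀ hs F).symm

theorem mean_eq (hlam : 0 < lam) (F : (Fin n → ℕ) → ℝ≥0∞) {s : ℝ} (hs : 0 ≤ s) :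
    mean q₀ lam F s = ∫⁻ x, windowSum q₀ F x s ∂clockLaw n lam := by
  refine lintegral_congr_ae ?_
  filter_upwards [ae_good hlam] with x hx using (hx.windowSum_eq_queueLength q₀ hs F).symm

theorem occupation_eq_lintegral (hlam : 0 < lam) (F : (Fin n → ℕ) → ℝ≥0∞) (s : ℝ) :
    occupation q₀ lam F s
      = ∫⁻ x, (∫⁻ u in Set.Icc 0 s, windowSum q₀ F x u) ∂clockLaw n lam := by
  have := isProbabilityMeasure_clockLaw (n := n) hlam
  rw [lintegral_lintegral_swap (measurable_windowSum q₀ F).aemeasurable]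
  exact setLIntegral_congr_fun measurableSet_Icc fun u hu => mean_eq hlam F hu.1

theorem occupation_eq_tsum (hlam : 0 < lam) (F : (Fin n → ℕ) → ℝ≥0∞) (s : ℝ) :
    occupation q₀ lam F s = ∑' j, ∫⁻ x, windowIntegral x j s (fun u => F (queue q₀ x j u))
      ∂clockLaw n lam := by
  rw [occupation_eq_lintegral hlam, ← lintegral_tsum fun j => (measurable_windowIntegral
    (f := fun x u => F (queue q₀ x j u)) (measurable_comp_queue q₀ j F) j s).aemeasurable]
  exact lintegral_congr fun x => (sum_windowIntegral_eq q₀ s F).symm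

theorem mean_mono {F G : (Fin n → ℕ) → ℝ≥0∞} (h : ∀ q, F q ≤ G q) (s : ℝ) :
    mean q₀ lam F s ≤ mean q₀ lam G s := lintegral_mono fun _ => h _

theorem mean_const (hlam : 0 < lam) (C : ℝ≥0∞) (s : ℝ) : mean q₀ lam (fun _ => C) s = C := by
  have := isProbabilityMeasure_clockLaw (n := n) hlam
  simp [mean]

theorem mean_mul {C : ℝ≥0∞} (hC : C ≠ ∞) (F : (Fin n → ℕ) → ℝ≥0∞) (s : ℝ) :
    mean q₀ lam (fun q => C * F q) s = C * mean q₀ lam F s := lintegral_const_mul' _ _ hC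

theorem mean_add (hlam : 0 < lam) (F G : (Fin n → ℕ) → ℝ≥0∞) {s : ℝ} (hs : 0 ≤ s) :
    mean q₀ lam (fun q => F q + G q) s = mean q₀ lam F s + mean q₀ lam G s :=
  lintegral_add_left' (aemeasurable_queueLength hlam F hs) _

theorem occupation_mono {F G : (Fin n → ℕ) → ℝ≥0∞} (h : ∀ q, F q ≤ G q) (s : ℝ) :
    occupation q₀ lam F s ≤ occupation q₀ lam G s := lintegral_mono fun _ => mean_mono h _

theorem occupation_const (hlam : 0 < lam) (C : ℝ≥0∞) (s : ℝ) :
    occupation q₀ lam (fun _ => C) s = C * ENNReal.ofReal s := by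
  simp [occupation, mean_const hlam]

theorem occupation_mul {C : ℝ≥0∞} (hC : C ≠ ∞) (F : (Fin n → ℕ) → ℝ≥0∞) (s : ℝ) :
    occupation q₀ lam (fun q => C * F q) s = C * occupation q₀ lam F s := by
  simp only [occupation, mean_mul hC]
  exact lintegral_const_mul' _ _ hC

theorem occupation_add (hlam : 0 < lam) (F G : (Fin n → ℕ) → ℝ≥0∞) (s : ℝ) :
    occupation q₀ lam (fun q => F q + G q) s
      = occupation q₀ lam F s + occupation q₀ lam G s := by
  have := isProbabilityMeasure_clockLaw (n := n) hlam
  have hF : AEMeasurable (fun u => mean q₀ lam F u) (volume.restrict (Set.Icc 0 s)) := by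
    refine ⟨fun u => ∫⁻ x, windowSum q₀ F x u ∂clockLaw n lam,
      (measurable_windowSum q₀ F).lintegral_prod_left', ?_⟩
    filter_upwards [ae_restrict_mem measurableSet_Icc] with u hu using mean_eq hlam F hu.1
  simp only [occupation]
  rw [← lintegral_add_left' hF]
  exact setLIntegral_congr_fun measurableSet_Icc fun u hu => mean_add hlam F G hu.1

theorem occupation_le {F : (Fin n → ℕ) → ℝ≥0∞} {C : ℝ≥0∞} {s : ℝ}
    (h : ∀ u ∈ Set.Icc 0 s, mean q₀ lam F u ≤ C) :
    occupation q₀ lam F s ≤ C * ENNReal.ofReal s := by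
  calc occupation q₀ lam F s ≤ ∫⁻ _u in Set.Icc 0 s, C := setLIntegral_mono measurable_const h
    _ = _ := by simp

end

section

variable {n : ℕ} {lam : ℝ} {q₀ : Fin n → ℕ}

/-! ### The evolution of means -/

theorem isService_of_mem_customers {j : ℕ} {c : Clock n} (h : c ∈ customers q₀ j) :
    c.IsService := by
  induction j with
  | zero =>
    simp only [customers, List.mem_flatten, List.mem_ofFn] at h
    obtain ⟨_, ⟨v, rfl⟩, h⟩ := h
    obtain ⟨i, _, rfl⟩ := List.mem_map.1 h
    trivial
  | succ j ih =>
    rcases List.mem_append.1 h with h | h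
    · exact ih h
    · rw [List.mem_singleton.1 h]; trivial

theorem windowIntegral_mono {x : Clock n → ℝ} {j : ℕ} {s : ℝ} {f g : ℝ → ℝ≥0∞}
    (h : ∀ u, epoch x j ≤ u → f u ≤ g u) : windowIntegral x j s f ≤ windowIntegral x j s g := by
  refine lintegral_mono fun u => Set.indicator_le_indicator' fun hu => h u hu.1

theorem Regular.tsum_arrivals {x : Clock n → ℝ} (h : Regular x) {J : ℕ} {s : ℝ}
    (hJ : s ∈ Set.Ico (epoch x J) (epoch x (J + 1))) (A : ℕ → ℝ≥0∞) :
    ∑' j, (if epoch x (j + 1) ≤ s then A j else 0) = ∑ j ∈ Finset.range J, A j := by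
  rw [tsum_eq_sum (s := Finset.range J)]
  · refine Finset.sum_congr rfl fun j hj => if_pos ?_
    exact (h.strictMono_epoch.monotone (by simpa using hj)).trans hJ.1
  · intro j hj
    refine if_neg fun hle => hj ?_
    have := h.strictMono_epoch.lt_iff_lt.1 (hle.trans_lt hJ.2)
    simpa using this

/-- `G` depends on the queue lengths only at servers without customer `c`. -/
def DependsElsewhere (G : Clock n → (Fin n → List (Clock n)) → (Fin n → ℕ) → ℕ) : Prop :=
  ∀ c L q q', (∀ w, c ∉ L w → q w = q' w) → G c L q = G c L q'

variable [NeZero n]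

/-- The sum of a weight over the customers in service. -/
def inService (q₀ : Fin n → ℕ) (G : Clock n → (Fin n → List (Clock n)) → (Fin n → ℕ) → ℕ)
    (x : Clock n → ℝ) (j : ℕ) (u : ℝ) : ℕ :=
  ((customers q₀ j).map fun c => if start q₀ x c ≤ u ∧ u < finish q₀ x c
    then G c (line q₀ x j) (queue q₀ x j u) else 0).sum

theorem inService_eq_sum (G : Clock n → (Fin n → List (Clock n)) → (Fin n → ℕ) → ℕ)
    (x : Clock n → ℝ) (j : ℕ) (u : ℝ) :
    inService q₀ G x j u = ∑ v, ((line q₀ x j v).map fun c =>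
      if start q₀ x c ≤ u ∧ u < finish q₀ x c
        then G c (line q₀ x j) (queue q₀ x j u) else 0).sum :=
  (sum_line q₀ x j _).symm

theorem causal_weight {G : Clock n → (Fin n → List (Clock n)) → (Fin n → ℕ) → ℕ}
    (hG : DependsElsewhere G) {c : Clock n} (hc : c.IsService) {j : ℕ} {x x' : Clock n → ℝ}
    (hx : Regular x) (hx' : Regular x') (h : ∀ c' ≠ c, x c' = x' c')
    (hj : epoch x j < finish q₀ x c) (hj' : epoch x j < finish q₀ x' c) (u : ℝ) :
    G c (line q₀ x j) (queue q₀ x j u) = G c (line q₀ x' j) (queue q₀ x' j u) := by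
  obtain ⟨hl, _, hd⟩ := causality q₀ hx hx' hc h hj hj' le_rfl
  rw [← hl]
  exact hG c _ _ _ fun w hw => by rw [queue, queue, hd w hw]

theorem measurable_weight (G : Clock n → (Fin n → List (Clock n)) → (Fin n → ℕ) → ℕ) (c : Clock n)
    (j : ℕ) : Measurable (fun p : (Clock n → ℝ) × ℝ =>
      (G c (line q₀ p.1 j) (queue q₀ p.1 j p.2) : ℝ≥0∞)) :=
  measurable_comp_line_queue q₀ j fun L q => (G c L q : ℝ≥0∞)

/-- The departures between the arrivals of the customers `j - 1` and `j` are compensated by the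
customers in service. -/
theorem lintegral_outflow (hlam : 0 < lam)
    {G : Clock n → (Fin n → List (Clock n)) → (Fin n → ℕ) → ℕ} (hG : DependsElsewhere G)
    (j : ℕ) (s : ℝ) :
    Measurable (fun x => (outflow q₀ x j (epoch x j) (min (epoch x (j + 1)) s)
      (fun c u => G c (line q₀ x j) (queue q₀ x j u)) : ℝ≥0∞)) ∧
    ∫⁻ x, (outflow q₀ x j (epoch x j) (min (epoch x (j + 1)) s)
      (fun c u => G c (line q₀ x j) (queue q₀ x j u)) : ℝ≥0∞) ∂clockLaw n lam
      = ∫⁻ x, windowIntegral x j s (fun u => (inService q₀ G x j u : ℝ≥0∞))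
        ∂clockLaw n lam := by
  simp only [outflow, inService, departed]
  have hserv := fun c => isService_of_mem_customers (q₀ := q₀) (j := j) (c := c)
  generalize customers q₀ j = L at hserv
  induction L with
  | nil => simp [windowIntegral]
  | cons c L ih =>
    obtain ⟨ihm, ih⟩ := ih fun c hc => hserv c (List.mem_cons_of_mem _ hc)
    have hc := hserv c List.mem_cons_self
    have hfin := measurable_finish q₀ c
    have hst := measurable_start q₀ c
    have hw := measurable_weight (q₀ := q₀) G c j
    have hdep := lintegral_departure q₀ hlam hc j s
      (f := fun x u => (G c (line q₀ x j) (queue q₀ x j u) : ℝ≥0∞)) hw fun x x' hx hx' h h1 h2 => by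
      ext u; rw [causal_weight hG hc hx hx' h h1 h2]
    have hm1 : Measurable (fun x : Clock n → ℝ => if epoch x j < finish q₀ x c ∧
        finish q₀ x c ≤ epoch x (j + 1) ∧ finish q₀ x c ≤ s
        then (G c (line q₀ x j) (queue q₀ x j (finish q₀ x c)) : ℝ≥0∞) else 0) := by
      refine Measurable.ite ?_ (hw.comp (measurable_id.prodMk hfin)) measurable_const
      exact (measurableSet_lt (measurable_epoch j) hfin).inter
        ((measurableSet_le hfin (measurable_epoch (j + 1))).inter
          (measurableSet_le hfin measurable_const))
    have hm2 : Measurable (fun p : (Clock n → ℝ) × ℝ =>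
        if start q₀ p.1 c ≤ p.2 ∧ p.2 < finish q₀ p.1 c
        then (G c (line q₀ p.1 j) (queue q₀ p.1 j p.2) : ℝ≥0∞) else 0) :=
      Measurable.ite ((measurableSet_le (hst.comp measurable_fst) measurable_snd).inter
        (measurableSet_lt measurable_snd (hfin.comp measurable_fst))) hw measurable_const
    have h1 : ∀ x, windowIntegral x j s (fun u =>
        (((c :: L).map fun c => if start q₀ x c ≤ u ∧ u < finish q₀ x c
          then G c (line q₀ x j) (queue q₀ x j u) else 0).sum : ℝ≥0∞))
        = windowIntegral x j s (fun u => if start q₀ x c ≤ u ∧ u < finish q₀ x c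
          then (G c (line q₀ x j) (queue q₀ x j u) : ℝ≥0∞) else 0)
        + windowIntegral x j s (fun u => ((L.map fun c => if start q₀ x c ≤ u ∧ u < finish q₀ x c
          then G c (line q₀ x j) (queue q₀ x j u) else 0).sum : ℝ≥0∞)) := by
      intro x
      simp only [windowIntegral]
      rw [← lintegral_add_left]
      · refine lintegral_congr fun u => ?_
        by_cases hu : u ∈ Set.Ico (epoch x j) (epoch x (j + 1))
        · rw [Set.indicator_of_mem hu, Set.indicator_of_mem hu, Set.indicator_of_mem hu,
            List.map_cons, List.sum_cons, Nat.cast_add, Nat.cast_ite, Nat.cast_zero]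
        · rw [Set.indicator_of_notMem hu, Set.indicator_of_notMem hu, Set.indicator_of_notMem hu,
            add_zero]
      · exact (measurable_window (f := fun x u => if start q₀ x c ≤ u ∧ u < finish q₀ x c
          then (G c (line q₀ x j) (queue q₀ x j u) : ℝ≥0∞) else 0) hm2 j).comp
          (measurable_prodMk_left (x := x))
    have h2 : ∀ x, (((c :: L).map fun c => if epoch x j < finish q₀ x c ∧
          finish q₀ x c ≤ min (epoch x (j + 1)) s
          then G c (line q₀ x j) (queue q₀ x j (finish q₀ x c)) else 0).sum : ℝ≥0∞)
        = (if epoch x j < finish q₀ x c ∧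
        finish q₀ x c ≤ epoch x (j + 1) ∧ finish q₀ x c ≤ s
        then (G c (line q₀ x j) (queue q₀ x j (finish q₀ x c)) : ℝ≥0∞) else 0)
        + ((L.map fun c => if epoch x j < finish q₀ x c ∧
          finish q₀ x c ≤ min (epoch x (j + 1)) s
          then G c (line q₀ x j) (queue q₀ x j (finish q₀ x c)) else 0).sum : ℝ≥0∞) := by
      intro x
      simp only [List.map_cons, List.sum_cons, Nat.cast_add, le_min_iff]
      push_cast
      rfl
    simp only [h1, h2]
    refine ⟨hm1.add ihm, ?_⟩
    rw [lintegral_add_left hm1, lintegral_add_left (measurable_windowIntegral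
      (f := fun x u => if start q₀ x c ≤ u ∧ u < finish q₀ x c
        then (G c (line q₀ x j) (queue q₀ x j u) : ℝ≥0∞) else 0) hm2 j s), hdep, ih]

theorem Regular.tsum_outflow {x : Clock n → ℝ} (h : Regular x) {J : ℕ} {s : ℝ}
    (hJ : s ∈ Set.Ico (epoch x J) (epoch x (J + 1))) (B : ℕ → Clock n → ℝ → ℕ) :
    ∑' j, (outflow q₀ x j (epoch x j) (min (epoch x (j + 1)) s) (B j) : ℝ≥0∞)
      = ∑ j ∈ Finset.range J, (outflow q₀ x j (epoch x j) (epoch x (j + 1)) (B j) : ℝ≥0∞)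
        + outflow q₀ x J (epoch x J) s (B J) := by
  rw [tsum_eq_sum (s := Finset.range (J + 1)), Finset.sum_range_succ, min_eq_right hJ.2.le]
  · congr 1
    refine Finset.sum_congr rfl fun j hj => ?_
    rw [min_eq_left]
    exact (h.strictMono_epoch.monotone (by simpa using hj)).trans hJ.1
  · intro j hj
    have hlt : s < epoch x j :=
      hJ.2.trans_le (h.strictMono_epoch.monotone (by simpa using hj))
    rw [Nat.cast_eq_zero, outflow, departed, List.sum_eq_zero]
    intro y hy
    obtain ⟨c, _, rfl⟩ := List.mem_map.1 hy
    refine if_neg fun hc => ?_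
    have := hc.2.trans (min_le_right _ _)
    linarith [hc.1]

theorem measurable_at_arrival (A : (Fin n → ℕ) → ℝ≥0∞) (j : ℕ) (s : ℝ) :
    Measurable (fun x : Clock n → ℝ =>
      if epoch x (j + 1) ≤ s then A (queue q₀ x j (epoch x (j + 1))) else 0) :=
  Measurable.ite (measurableSet_le (measurable_epoch _) measurable_const)
    ((measurable_comp_queue q₀ j A).comp (measurable_id.prodMk (measurable_epoch (j + 1))))
    measurable_const

/-- Arriving customers see time averages. -/
theorem occupation_arrival (hlam : 0 < lam) (A : (Fin n → ℕ) → ℝ≥0∞) (s : ℝ) :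
    ENNReal.ofReal (lam * n) * occupation q₀ lam A s
      = ∫⁻ x, ∑' j, (if epoch x (j + 1) ≤ s then A (queue q₀ x j (epoch x (j + 1))) else 0)
        ∂clockLaw n lam := by
  rw [lintegral_tsum fun j => (measurable_at_arrival A j s).aemeasurable, occupation_eq_tsum hlam,
    ← ENNReal.tsum_mul_left]
  refine tsum_congr fun j => ?_
  have h := lintegral_arrival (n := n) hlam j s (f := fun x u => A (queue q₀ x j u))
    (measurable_comp_queue q₀ j A) fun x y => by
      ext u
      congr 1
      ext v
      rw [queue, queue, departures_update_interarrival]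
  exact h.symm

/-- If `X - Y` changes by at most `A - A'` at each arrival, and between the arrivals by at most the
sum of `G - G'` over the customers who leave, then `X - Y` grows on average by at most the integral
of `lam * n * (A - A')` plus `R - R'`, where `R` and `R'` are the sums of `G` and `G'` over the
customers in service. -/
theorem mean_le (hlam : 0 < lam) (X Y A A' R R' : (Fin n → ℕ) → ℕ)
    {G G' : Clock n → (Fin n → List (Clock n)) → (Fin n → ℕ) → ℕ}
    (hG : DependsElsewhere G) (hG' : DependsElsewhere G')
    (harr : ∀ q v, (∀ w, q v ≤ q w) → X (Function.update q v (q v + 1)) + Y q + A' q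
      ≤ X q + Y (Function.update q v (q v + 1)) + A q)
    (hgap : ∀ x, Regular x → ∀ j u, epoch x j ≤ u →
      X (queue q₀ x j u) + Y (queue q₀ x j (epoch x j))
          + outflow q₀ x j (epoch x j) u (fun c u => G' c (line q₀ x j) (queue q₀ x j u))
        ≤ X (queue q₀ x j (epoch x j)) + Y (queue q₀ x j u)
          + outflow q₀ x j (epoch x j) u (fun c u => G c (line q₀ x j) (queue q₀ x j u)))
    (hR : ∀ x, Regular x → ∀ j u, epoch x j ≤ u → inService q₀ G x j u ≤ R (queue q₀ x j u))
    (hR' : ∀ x, Regular x → ∀ j u, epoch x j ≤ u → R' (queue q₀ x j u) ≤ inService q₀ G' x j u)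
    {s : ℝ} (hs : 0 ≤ s) :
    mean q₀ lam (fun q => (X q : ℝ≥0∞)) s + Y q₀
        + ENNReal.ofReal (lam * n) * occupation q₀ lam (fun q => (A' q : ℝ≥0∞)) s
        + occupation q₀ lam (fun q => (R' q : ℝ≥0∞)) s
      ≤ X q₀ + mean q₀ lam (fun q => (Y q : ℝ≥0∞)) s
        + ENNReal.ofReal (lam * n) * occupation q₀ lam (fun q => (A q : ℝ≥0∞)) s
        + occupation q₀ lam (fun q => (R q : ℝ≥0∞)) s := by
  have := isProbabilityMeasure_clockLaw (n := n) hlam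
  have hmA := fun (A : (Fin n → ℕ) → ℕ) (j : ℕ) =>
    measurable_at_arrival (q₀ := q₀) (fun q => (A q : ℝ≥0∞)) j s
  have hA := fun (A : (Fin n → ℕ) → ℕ) =>
    occupation_arrival (q₀ := q₀) hlam (fun q => (A q : ℝ≥0∞)) s
  have hout := fun j => lintegral_outflow (q₀ := q₀) hlam hG j s
  have hout' := fun j => lintegral_outflow (q₀ := q₀) hlam hG' j s
  have hle : ∫⁻ x, ∑' j, (outflow q₀ x j (epoch x j) (min (epoch x (j + 1)) s)
      (fun c u => G c (line q₀ x j) (queue q₀ x j u)) : ℝ≥0∞) ∂clockLaw n lam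
      ≤ occupation q₀ lam (fun q => (R q : ℝ≥0∞)) s := by
    rw [lintegral_tsum fun j => (hout j).1.aemeasurable, occupation_eq_tsum hlam]
    refine ENNReal.tsum_le_tsum fun j => ?_
    rw [(hout j).2]
    refine lintegral_mono_ae ?_
    filter_upwards [ae_regular hlam] with x hx
    exact windowIntegral_mono fun u hu => Nat.cast_le.2 (hR x hx j u hu)
  have hle' : occupation q₀ lam (fun q => (R' q : ℝ≥0∞)) s
      ≤ ∫⁻ x, ∑' j, (outflow q₀ x j (epoch x j) (min (epoch x (j + 1)) s)
      (fun c u => G' c (line q₀ x j) (queue q₀ x j u)) : ℝ≥0∞) ∂clockLaw n lam := by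
    rw [lintegral_tsum fun j => (hout' j).1.aemeasurable, occupation_eq_tsum hlam]
    refine ENNReal.tsum_le_tsum fun j => ?_
    rw [(hout' j).2]
    refine lintegral_mono_ae ?_
    filter_upwards [ae_regular hlam] with x hx
    exact windowIntegral_mono fun u hu => Nat.cast_le.2 (hR' x hx j u hu)
  refine le_trans (add_le_add_right hle' _) (le_trans ?_ (add_le_add_right hle _))
  rw [hA, hA, mean, mean]
  have hmX := aemeasurable_queueLength (q₀ := q₀) hlam (fun q => (X q : ℝ≥0∞)) hs
  have hmY := aemeasurable_queueLength (q₀ := q₀) hlam (fun q => (Y q : ℝ≥0∞)) hs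
  have hX₀ : (X q₀ : ℝ≥0∞) = ∫⁻ _, (X q₀ : ℝ≥0∞) ∂clockLaw n lam := by simp
  have hY₀ : (Y q₀ : ℝ≥0∞) = ∫⁻ _, (Y q₀ : ℝ≥0∞) ∂clockLaw n lam := by simp
  have hmA1 : ∀ A : (Fin n → ℕ) → ℕ, Measurable (fun x : Clock n → ℝ => ∑' j,
      (if epoch x (j + 1) ≤ s then (A (queue q₀ x j (epoch x (j + 1))) : ℝ≥0∞) else 0)) :=
    fun A => Measurable.tsum (hmA A)
  rw [hX₀, hY₀, ← lintegral_add_right _ measurable_const, ← lintegral_add_right _ (hmA1 A'),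
    ← lintegral_add_right _ (Measurable.tsum fun j => (hout' j).1),
    ← lintegral_add_left measurable_const, ← lintegral_add_right _ (hmA1 A),
    ← lintegral_add_right _ (Measurable.tsum fun j => (hout j).1)]
  refine lintegral_mono_ae ?_
  filter_upwards [ae_good hlam] with x hx
  obtain ⟨J, hJ⟩ := hx.exists_window hs
  have ht := telescope (epoch x) (fun j u => X (queue q₀ x j u)) (fun j u => Y (queue q₀ x j u))
    (fun j => A (queue q₀ x j (epoch x (j + 1)))) (fun j => A' (queue q₀ x j (epoch x (j + 1))))
    (fun j u => outflow q₀ x j (epoch x j) u (fun c u => G c (line q₀ x j) (queue q₀ x j u)))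
    (fun j u => outflow q₀ x j (epoch x j) u (fun c u => G' c (line q₀ x j) (queue q₀ x j u)))
    hx.strictMono_epoch.monotone
    (fun j => by
      rw [queue_arrival q₀ hx.toRegular]
      exact harr _ _ (choice_mem_shortest q₀ x j))
    (fun j u hu => hgap x hx.toRegular j u hu) J s hJ.1
  rw [epoch_zero, queue_zero_zero q₀ hx.toRegular] at ht
  rw [hx.queueLength_eq q₀ hJ, hx.tsum_arrivals hJ, hx.tsum_arrivals hJ, hx.tsum_outflow hJ,
    hx.tsum_outflow hJ]
  exact_mod_cast ht

end

section

variable {n : ℕ} {lam : ℝ} {q₀ : Fin n → ℕ}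

/-! ### Bounds for the idle servers and for the waiting customers -/

theorem dependsElsewhere_const (m : ℕ) : DependsElsewhere (n := n) fun _ _ _ => m :=
  fun _ _ _ _ _ => rfl

theorem dependsElsewhere_follower : DependsElsewhere (n := n) fun c L _ => follower c L :=
  fun _ _ _ _ _ => rfl

theorem dependsElsewhere_idle :
    DependsElsewhere (n := n) fun c L q => 2 * (1 + idleElsewhere c L q) := by
  intro c L q q' h
  have : idleElsewhere c L q = idleElsewhere c L q' := by
    refine congrArg Finset.card (Finset.filter_congr fun w _ => ?_)
    exact and_congr_right fun hw => by rw [h w hw]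
  simp only [this]

variable [NeZero n]

theorem sum_inService_line {x : Clock n → ℝ} (hx : Regular x) (j : ℕ) {u : ℝ}
    (hu : epoch x j ≤ u) (v : Fin n) :
    ((line q₀ x j v).map fun c => if start q₀ x c ≤ u ∧ u < finish q₀ x c then 1 else 0).sum
      = if queue q₀ x j u v = 0 then 0 else 1 := by
  rw [(fifo_line q₀ hx j v).sum_inService hu, map_finish_line]; rfl

theorem inService_one {x : Clock n → ℝ} (hx : Regular x) (j : ℕ) {u : ℝ} (hu : epoch x j ≤ u) :
    inService q₀ (fun _ _ _ => 1) x j u = n - idle (queue q₀ x j u) := by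
  rw [inService_eq_sum, ← sum_busy]
  exact Finset.sum_congr rfl fun v _ => sum_inService_line hx j hu v

theorem inService_idleElsewhere_le {x : Clock n → ℝ} (hx : Regular x) (j : ℕ) {u : ℝ}
    (hu : epoch x j ≤ u) :
    inService q₀ (fun c L q => 2 * (1 + idleElsewhere c L q)) x j u
      ≤ 2 * (1 + idle (queue q₀ x j u)) * (n - idle (queue q₀ x j u)) := by
  have hle : ∀ c, idleElsewhere c (line q₀ x j) (queue q₀ x j u) ≤ idle (queue q₀ x j u) :=
    fun c => Finset.card_le_card fun w hw => by
      simp only [Finset.mem_filter] at hw ⊢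
      exact ⟨hw.1, hw.2.2⟩
  rw [← inService_one hx j hu, inService, inService, ← List.sum_map_mul_left]
  refine List.sum_le_sum fun c _ => ?_
  split_ifs
  · have := hle c
    omega
  · simp

theorem inService_follower_le {x : Clock n → ℝ} (hx : Regular x) (j : ℕ) {u : ℝ}
    (hu : epoch x j ≤ u) :
    inService q₀ (fun c L _ => follower c L) x j u ≤ backlog (queue q₀ x j u) := by
  rw [inService_eq_sum, backlog]
  refine Finset.sum_le_sum fun v _ => ?_
  have hone : ((line q₀ x j v).map fun c => if start q₀ x c ≤ u ∧ u < finish q₀ x c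
      then follower c (line q₀ x j) else 0).sum ≤ 1 := by
    refine le_trans (List.sum_le_sum fun c _ => ?_)
      ((sum_inService_line (q₀ := q₀) hx j hu v).trans_le (by split_ifs <;> simp))
    rw [follower]
    split_ifs <;> simp
  have hdrop := (fifo_line q₀ hx j v).remaining_dropLast u
  rw [map_finish_line] at hdrop
  change _ = queue q₀ x j u v - 1 at hdrop
  by_cases h : queue q₀ x j u v - 1 = 0
  · rw [h, Nat.le_zero]
    refine List.sum_eq_zero fun y hy => ?_
    obtain ⟨c, hc, rfl⟩ := List.mem_map.1 hy
    split_ifs with hcu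
    · rw [follower, if_neg]
      rintro ⟨v', hv'⟩
      obtain rfl := eq_of_mem_line q₀ x (List.mem_of_mem_dropLast hv') hc
      rw [h, remaining_eq_zero] at hdrop
      exact absurd (hdrop _ (List.mem_map_of_mem hv')) (not_le.2 hcu.2)
    · rfl
  · omega

theorem outflow_zero (x : Clock n → ℝ) (j : ℕ) (a b : ℝ) :
    outflow q₀ x j a b (fun _ _ => 0) = 0 := by
  rw [outflow, departed]
  exact List.sum_eq_zero fun y hy => by
    obtain ⟨c, _, rfl⟩ := List.mem_map.1 hy
    simp

theorem inService_zero (x : Clock n → ℝ) (j : ℕ) (u : ℝ) :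
    inService q₀ (fun _ _ _ => 0) x j u = 0 := by
  rw [inService]
  exact List.sum_eq_zero fun y hy => by
    obtain ⟨c, _, rfl⟩ := List.mem_map.1 hy
    simp

/-- The balance of the square of the number `I` of idle servers. An arrival adds at most
`1 - 2 * I`: it makes an idle server busy, or `I = 0`. A departure adds at most `2 * (1 + I)`. -/
theorem mean_idle_sq_le (hlam : 0 < lam) {s : ℝ} (hs : 0 ≤ s) :
    mean q₀ lam (fun q => ((idle q ^ 2 : ℕ) : ℝ≥0∞)) s
        + ENNReal.ofReal (lam * n) * occupation q₀ lam (fun q => ((2 * idle q : ℕ) : ℝ≥0∞)) s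
      ≤ ((idle q₀ ^ 2 : ℕ) : ℝ≥0∞) + ENNReal.ofReal (lam * n) * ENNReal.ofReal s
        + occupation q₀ lam (fun q => ((2 * (1 + idle q) * (n - idle q) : ℕ) : ℝ≥0∞)) s := by
  have h := mean_le (q₀ := q₀) hlam (fun q => idle q ^ 2) (fun _ => 0) (fun _ => 1)
    (fun q => 2 * idle q) (fun q => 2 * (1 + idle q) * (n - idle q)) (fun _ => 0)
    dependsElsewhere_idle (dependsElsewhere_const 0)
    (fun q v hv => by
      simp only [idle_update q v hv]
      rcases idle q with _ | m
      · simp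
      · simp; nlinarith)
    (fun x hx j u hu => by
      rw [outflow_zero]
      simpa using idle_sq_le_outflow q₀ (x := x) j hu)
    (fun x hx j u hu => inService_idleElsewhere_le hx j hu)
    (fun x hx j u hu => Nat.zero_le _) hs
  simpa [mean_const hlam, occupation_const hlam] using h

/-- The balance of the customers: each arrival adds a customer, and each busy server releases
customers at rate `1`. -/
theorem mean_population_le (hlam : 0 < lam) {s : ℝ} (hs : 0 ≤ s) :
    mean q₀ lam (fun q => (population q : ℝ≥0∞)) s
        + occupation q₀ lam (fun q => ((n - idle q : ℕ) : ℝ≥0∞)) s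
      ≤ population q₀ + ENNReal.ofReal (lam * n) * ENNReal.ofReal s := by
  have h := mean_le (q₀ := q₀) hlam population (fun _ => 0) (fun _ => 1)
    (fun _ => 0) (fun _ => 0) (fun q => n - idle q)
    (dependsElsewhere_const 0) (dependsElsewhere_const 1)
    (fun q v hv => by simp [population_update])
    (fun x hx j u hu => by
      rw [outflow_zero]
      simpa using (population_add_outflow q₀ (x := x) j hu).le)
    (fun x hx j u hu => (inService_zero x j u).le)
    (fun x hx j u hu => (inService_one hx j hu).ge) hs
  simpa [mean_const hlam, occupation_const hlam] using h

/-- The balance of the waiting customers: there is one more after an arrival that finds no idle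
server, and one fewer only after the departure of a customer with someone behind. The latter happens
at most at a rate equal to the number of servers with a waiting customer. -/
theorem occupation_busy_le (hlam : 0 < lam) {s : ℝ} (hs : 0 ≤ s) :
    ENNReal.ofReal (lam * n)
        * occupation q₀ lam (fun q => ((if idle q = 0 then 1 else 0 : ℕ) : ℝ≥0∞)) s
      ≤ mean q₀ lam (fun q => (backlog q : ℝ≥0∞)) s
        + occupation q₀ lam (fun q => (backlog q : ℝ≥0∞)) s := by
  have h := mean_le (q₀ := q₀) hlam (fun _ => 0) backlog (fun _ => 0)
    (fun q => if idle q = 0 then 1 else 0) backlog (fun _ => 0)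
    dependsElsewhere_follower (dependsElsewhere_const 0)
    (fun q v hv => by rw [backlog_update q v hv]; omega)
    (fun x hx j u hu => by
      rw [outflow_zero]
      simpa using backlog_le_outflow q₀ hx j hu)
    (fun x hx j u hu => inService_follower_le hx j hu)
    (fun x hx j u hu => Nat.zero_le _) hs
  refine le_trans (le_trans ?_ h) ?_
  · rw [add_assoc, add_comm]; exact le_trans le_self_add le_self_add
  · simp [occupation_const hlam]

theorem occupation_idle_ne_top (hlam : 0 < lam) (s : ℝ) :
    occupation q₀ lam (fun q => (idle q : ℝ≥0∞)) s ≠ ∞ := by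
  refine ne_top_of_le_ne_top (b := (n : ℝ≥0∞) * ENNReal.ofReal s)
    (ENNReal.mul_ne_top (by simp) ENNReal.ofReal_ne_top) ?_
  rw [← occupation_const (q₀ := q₀) hlam]
  exact occupation_mono (fun q => Nat.cast_le.2 (idle_le q)) s

/-- Completing the square: with `(1 - lam) n ≤ b √n`, the drift of the square of the number of idle
servers is bounded by `(3 + b ^ 2 / 2) n`. -/
theorem mean_idle_sq_le_of_le (hlam : 0 < lam) (hlam1 : lam ≤ 1) {b : ℝ}
    (hb : (1 - lam) * n ≤ b * √n) {s : ℝ} (hs : 0 ≤ s) :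
    mean q₀ lam (fun q => ((idle q ^ 2 : ℕ) : ℝ≥0∞)) s
      ≤ ENNReal.ofReal ((idle q₀ : ℝ) ^ 2 + (3 + b ^ 2 / 2) * n * s) := by
  have h := mean_idle_sq_le (q₀ := q₀) hlam hs
  have hdrift : occupation q₀ lam (fun q => ((2 * (1 + idle q) * (n - idle q) : ℕ) : ℝ≥0∞)) s
      ≤ ENNReal.ofReal ((2 + b ^ 2 / 2) * n) * ENNReal.ofReal s
        + ENNReal.ofReal (lam * n) * occupation q₀ lam (fun q => ((2 * idle q : ℕ) : ℝ≥0∞)) s := by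
    rw [← occupation_const (q₀ := q₀) hlam, ← occupation_mul ENNReal.ofReal_ne_top,
      ← occupation_add hlam]
    refine occupation_mono (fun q => ?_) s
    rw [← ENNReal.ofReal_natCast, ← ENNReal.ofReal_natCast, ← ENNReal.ofReal_mul (by positivity),
      ← ENNReal.ofReal_add (by positivity) (by positivity)]
    refine ENNReal.ofReal_le_ofReal ?_
    push_cast [idle_le q]
    have hI : (0 : ℝ) ≤ idle q := Nat.cast_nonneg _
    have hsq : √(n : ℝ) ^ 2 = n := Real.sq_sqrt (Nat.cast_nonneg n)
    have h1 : (1 - lam) * n * idle q ≤ b * √n * idle q := mul_le_mul_of_nonneg_right hb hI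
    have h2 : 0 ≤ (2 * (idle q : ℝ) - b * √n) ^ 2 := sq_nonneg _
    have h3 : (b * √n) ^ 2 = b ^ 2 * n := by rw [mul_pow, hsq]
    nlinarith
  have hfin : ENNReal.ofReal (lam * n)
      * occupation q₀ lam (fun q => ((2 * idle q : ℕ) : ℝ≥0∞)) s ≠ ∞ := by
    refine ENNReal.mul_ne_top ENNReal.ofReal_ne_top ?_
    simp only [Nat.cast_mul, Nat.cast_ofNat]
    rw [occupation_mul (by simp)]
    exact ENNReal.mul_ne_top (by simp) (occupation_idle_ne_top hlam s)
  have h' := h.trans (add_le_add_right hdrift _)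
  rw [← add_assoc, ENNReal.add_le_add_iff_right hfin] at h'
  refine h'.trans ?_
  rw [← ENNReal.ofReal_natCast, ← ENNReal.ofReal_mul (by positivity),
    ← ENNReal.ofReal_mul (by positivity), ← ENNReal.ofReal_add (by positivity) (by positivity),
    ← ENNReal.ofReal_add (by positivity) (by positivity)]
  refine ENNReal.ofReal_le_ofReal ?_
  push_cast
  have : lam * n * s ≤ 1 * n * s := by gcongr
  nlinarith

/-- By the inequality `I ≤ I ^ 2 / √n + √n`, the mean number of idle servers is of order `√n`. -/
theorem mean_idle_le (hlam : 0 < lam) (hlam1 : lam ≤ 1) {b K : ℝ}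
    (hb : (1 - lam) * n ≤ b * √n) (hK : (idle q₀ : ℝ) ≤ K * √n) {s t : ℝ} (hs : 0 ≤ s)
    (hst : s ≤ t) :
    mean q₀ lam (fun q => (idle q : ℝ≥0∞)) s
      ≤ ENNReal.ofReal ((K ^ 2 + (3 + b ^ 2 / 2) * t + 1) * √n) := by
  have hn : (0 : ℝ) < n := Nat.cast_pos.2 (Nat.pos_of_ne_zero (NeZero.ne n))
  have hsqrt : 0 < √(n : ℝ) := Real.sqrt_pos.2 hn
  have hsq : √(n : ℝ) * √n = n := Real.mul_self_sqrt hn.le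
  calc mean q₀ lam (fun q => (idle q : ℝ≥0∞)) s
      ≤ mean q₀ lam (fun q => ENNReal.ofReal (1 / √n) * ((idle q ^ 2 : ℕ) : ℝ≥0∞)
          + ENNReal.ofReal √n) s := by
        refine mean_mono (fun q => ?_) s
        rw [← ENNReal.ofReal_natCast, ← ENNReal.ofReal_natCast,
          ← ENNReal.ofReal_mul (by positivity), ← ENNReal.ofReal_add (by positivity)
          (by positivity)]
        refine ENNReal.ofReal_le_ofReal ?_
        rw [← sub_nonneg]
        push_cast
        have h1 : 1 / √(n : ℝ) * (idle q : ℝ) ^ 2 + √n - idle q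
            = (((idle q : ℝ) - √n) ^ 2 + idle q * √n) / √n := by
          field_simp
          ring
        rw [h1]
        positivity
    _ = ENNReal.ofReal (1 / √n) * mean q₀ lam (fun q => ((idle q ^ 2 : ℕ) : ℝ≥0∞)) s
          + ENNReal.ofReal √n := by
        rw [mean_add hlam _ _ hs, mean_mul ENNReal.ofReal_ne_top, mean_const hlam]
    _ ≤ ENNReal.ofReal (1 / √n) * ENNReal.ofReal ((idle q₀ : ℝ) ^ 2 + (3 + b ^ 2 / 2) * n * s)
          + ENNReal.ofReal √n := by
        gcongr
        exact mean_idle_sq_le_of_le hlam hlam1 hb hs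
    _ = ENNReal.ofReal (1 / √n * ((idle q₀ : ℝ) ^ 2 + (3 + b ^ 2 / 2) * n * s) + √n) := by
        rw [← ENNReal.ofReal_mul (by positivity), ← ENNReal.ofReal_add (by positivity)
          (by positivity)]
    _ ≤ _ := by
        refine ENNReal.ofReal_le_ofReal ?_
        have h1 : (idle q₀ : ℝ) ^ 2 ≤ (K * √n) ^ 2 := by gcongr
        have h2 : (3 + b ^ 2 / 2) * n * s ≤ (3 + b ^ 2 / 2) * n * t := by gcongr
        have h3 : (K ^ 2 + (3 + b ^ 2 / 2) * t + 1) * √n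
            = 1 / √n * ((K * √n) ^ 2 + (3 + b ^ 2 / 2) * n * t) + √n := by
          rw [show (3 + b ^ 2 / 2) * (n : ℝ) * t = (3 + b ^ 2 / 2) * (√n * √n) * t by rw [hsq]]
          field_simp
        rw [h3]
        gcongr

/-- The balance of the customers bounds the waiting ones, as there are `n - I + W` customers if `I`
servers are idle and `W` customers wait. -/
theorem mean_backlog_le (hlam : 0 < lam) (hlam1 : lam ≤ 1) {s : ℝ} (hs : 0 ≤ s) :
    mean q₀ lam (fun q => (backlog q : ℝ≥0∞)) s
      ≤ backlog q₀ + occupation q₀ lam (fun q => (idle q : ℝ≥0∞)) s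
        + mean q₀ lam (fun q => (idle q : ℝ≥0∞)) s := by
  have h := mean_population_le (q₀ := q₀) hlam hs
  have hsum : occupation q₀ lam (fun q => ((n - idle q : ℕ) : ℝ≥0∞)) s
      + occupation q₀ lam (fun q => (idle q : ℝ≥0∞)) s = n * ENNReal.ofReal s := by
    rw [← occupation_add hlam, ← occupation_const (q₀ := q₀) hlam]
    congr 1
    ext q
    rw [← Nat.cast_add, Nat.sub_add_cancel (idle_le q)]
  have hrate : ENNReal.ofReal (lam * n) ≤ n := by
    rw [← ENNReal.ofReal_natCast]
    exact ENNReal.ofReal_le_ofReal (mul_le_of_le_one_left (Nat.cast_nonneg n) hlam1)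
  have hpop : mean q₀ lam (fun q => (population q : ℝ≥0∞)) s
      ≤ population q₀ + occupation q₀ lam (fun q => (idle q : ℝ≥0∞)) s := by
    have hfin : (n : ℝ≥0∞) * ENNReal.ofReal s ≠ ∞ :=
      ENNReal.mul_ne_top (by simp) ENNReal.ofReal_ne_top
    rw [← ENNReal.add_le_add_iff_right hfin]
    calc mean q₀ lam (fun q => (population q : ℝ≥0∞)) s + n * ENNReal.ofReal s
        = (mean q₀ lam (fun q => (population q : ℝ≥0∞)) s
          + occupation q₀ lam (fun q => ((n - idle q : ℕ) : ℝ≥0∞)) s)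
          + occupation q₀ lam (fun q => (idle q : ℝ≥0∞)) s := by rw [← hsum, add_assoc]
      _ ≤ (population q₀ + n * ENNReal.ofReal s)
          + occupation q₀ lam (fun q => (idle q : ℝ≥0∞)) s := by
        refine add_le_add_left (h.trans ?_) _
        gcongr
      _ = _ := by ring
  have hn : (n : ℝ≥0∞) ≠ ∞ := by simp
  rw [← ENNReal.add_le_add_iff_left hn]
  calc (n : ℝ≥0∞) + mean q₀ lam (fun q => (backlog q : ℝ≥0∞)) s
      = mean q₀ lam (fun q => (population q : ℝ≥0∞)) s
        + mean q₀ lam (fun q => (idle q : ℝ≥0∞)) s := by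
        rw [← mean_add hlam _ _ hs]
        nth_rewrite 1 [← mean_const (q₀ := q₀) hlam n s]
        rw [← mean_add hlam _ _ hs]
        congr 1
        ext q
        exact_mod_cast (population_add_idle q).symm
    _ ≤ (population q₀ + occupation q₀ lam (fun q => (idle q : ℝ≥0∞)) s)
        + mean q₀ lam (fun q => (idle q : ℝ≥0∞)) s := by gcongr
    _ ≤ ((n + backlog q₀) + occupation q₀ lam (fun q => (idle q : ℝ≥0∞)) s)
        + mean q₀ lam (fun q => (idle q : ℝ≥0∞)) s := by
        gcongr
        have := population_add_idle q₀
        exact_mod_cast (by omega : population q₀ ≤ n + backlog q₀)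
    _ = _ := by ring

/-- In the Halfin-Whitt regime, both the waiting time and the number of customers who have to wait
are of order `√n` on average, if initially there are `O(√n)` idle servers and waiting customers. -/
theorem exists_occupation_le (b K : ℝ) (hK : 0 ≤ K) {t : ℝ} (ht : 0 ≤ t) :
    ∃ C : ℝ, 0 ≤ C ∧ ∀ (n : ℕ) [NeZero n] (lam : ℝ) (q₀ : Fin n → ℕ), 0 < lam → lam ≤ 1 →
      (1 - lam) * n ≤ b * √n → (idle q₀ : ℝ) ≤ K * √n → (backlog q₀ : ℝ) ≤ K * √n →
      occupation q₀ lam (fun q => (backlog q : ℝ≥0∞)) t ≤ ENNReal.ofReal (C * √n) ∧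
      ENNReal.ofReal (lam * n)
        * occupation q₀ lam (fun q => ((if idle q = 0 then 1 else 0 : ℕ) : ℝ≥0∞)) t
        ≤ ENNReal.ofReal (C * √n) := by
  set C₁ := K ^ 2 + (3 + b ^ 2 / 2) * t + 1 with hC₁
  set C₂ := K + C₁ * t + C₁ with hC₂
  have hC₁0 : 0 ≤ C₁ := by positivity
  have hC₂0 : 0 ≤ C₂ := by positivity
  refine ⟨C₂ + C₂ * t, by positivity, fun n _ lam q₀ hlam hlam1 hb hI hW => ?_⟩
  have hidle : ∀ u ∈ Set.Icc 0 t, mean q₀ lam (fun q => (idle q : ℝ≥0∞)) u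
      ≤ ENNReal.ofReal (C₁ * √n) := fun u hu => mean_idle_le hlam hlam1 hb hI hu.1 hu.2
  have hback : ∀ u ∈ Set.Icc 0 t, mean q₀ lam (fun q => (backlog q : ℝ≥0∞)) u
      ≤ ENNReal.ofReal (C₂ * √n) := by
    intro u hu
    have hocc := occupation_le (s := u) fun r hr => hidle r ⟨hr.1, hr.2.trans hu.2⟩
    have hW' : (backlog q₀ : ℝ≥0∞) ≤ ENNReal.ofReal (K * √n) := by
      rw [← ENNReal.ofReal_natCast]; exact ENNReal.ofReal_le_ofReal hW
    refine (mean_backlog_le hlam hlam1 hu.1).trans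
      ((add_le_add (add_le_add hW' hocc) (hidle u hu)).trans ?_)
    rw [← ENNReal.ofReal_mul (by positivity), ← ENNReal.ofReal_add (by positivity)
      (mul_nonneg (by positivity) hu.1), ← ENNReal.ofReal_add
      (add_nonneg (by positivity) (mul_nonneg (by positivity) hu.1)) (by positivity)]
    refine ENNReal.ofReal_le_ofReal ?_
    have : C₁ * √n * u ≤ C₁ * √n * t := by gcongr; exact hu.2
    nlinarith
  have hocc := occupation_le hback
  rw [← ENNReal.ofReal_mul (by positivity)] at hocc
  constructor
  · refine hocc.trans (ENNReal.ofReal_le_ofReal ?_)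
    have : 0 ≤ C₂ * √n := by positivity
    nlinarith
  · refine (occupation_busy_le hlam ht).trans
      ((add_le_add (hback t ⟨ht, le_rfl⟩) hocc).trans ?_)
    rw [← ENNReal.ofReal_add (by positivity) (by positivity)]
    exact ENNReal.ofReal_le_ofReal (by nlinarith)

end

section

variable {n : ℕ} {lam : ℝ}

/-! ### The waiting time of the arriving customers -/

/-- Each waiting customer is counted once, at its position in the queue. -/
theorem sum_atLeast (q : Fin n → ℕ) {M : ℕ} (hM : ∀ v, q v - 1 ≤ M) :
    ∑ i ∈ Finset.range M, atLeast q (i + 2) = backlog q := by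
  simp only [atLeast, Finset.card_filter]
  rw [Finset.sum_comm, backlog]
  refine Finset.sum_congr rfl fun v _ => ?_
  rw [← Finset.card_filter]
  have : (Finset.range M).filter (fun i => i + 2 ≤ q v) = Finset.range (q v - 1) := by
    ext i
    have := hM v
    simp only [Finset.mem_filter, Finset.mem_range]
    omega
  rw [this, Finset.card_range]

theorem tsum_atLeast (q : Fin n → ℕ) : ∑' i, (atLeast q (i + 2) : ℝ≥0∞) = backlog q := by
  have hM : ∀ v, q v ≤ ∑ w, q w := fun v => Finset.single_le_sum (fun _ _ => Nat.zero_le _)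
    (Finset.mem_univ v)
  rw [← sum_atLeast q (M := ∑ w, q w) fun v => (Nat.sub_le _ _).trans (hM v), Nat.cast_sum]
  refine tsum_eq_sum fun i hi => ?_
  rw [Nat.cast_eq_zero, atLeast, Finset.card_eq_zero, Finset.filter_eq_empty_iff]
  intro v _ hv
  have := hM v
  rw [Finset.mem_range] at hi
  omega

variable [NeZero n] {q₀ : Fin n → ℕ}

theorem waitDuring_eq {x : Clock n → ℝ} (hx : Good x) (t : ℝ) :
    waitDuring q₀ x t = ∫⁻ u in Set.Icc 0 t, windowSum q₀ (fun q => (backlog q : ℝ≥0∞)) x u :=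
  setLIntegral_congr_fun measurableSet_Icc fun u hu => by
    rw [hx.windowSum_eq_queueLength q₀ hu.1 fun q => (backlog q : ℝ≥0∞), tsum_atLeast]

theorem aemeasurable_waitDuring (hlam : 0 < lam) (t : ℝ) :
    AEMeasurable (fun x => waitDuring q₀ x t) (clockLaw n lam) := by
  refine ⟨fun x => ∫⁻ u in Set.Icc 0 t, windowSum q₀ (fun q => (backlog q : ℝ≥0∞)) x u,
    (measurable_windowSum q₀ _).lintegral_prod_right', ?_⟩
  filter_upwards [ae_good hlam] with x hx using waitDuring_eq hx t

theorem lintegral_waitDuring (hlam : 0 < lam) (t : ℝ) :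
    ∫⁻ x, waitDuring q₀ x t ∂clockLaw n lam
      = occupation q₀ lam (fun q => (backlog q : ℝ≥0∞)) t := by
  rw [occupation_eq_lintegral hlam]
  refine lintegral_congr_ae ?_
  filter_upwards [ae_good hlam] with x hx using waitDuring_eq hx t

theorem aggregateWait_eq (x : Clock n → ℝ) (t : ℝ) :
    aggregateWait q₀ x t = ∑' j, if epoch x (j + 1) ≤ t
      then ENNReal.ofReal (start q₀ x (.service j) - epoch x (j + 1)) else 0 := by
  have h := tsum_subtype {j | arrivalTime x j ≤ t} (fun j => ENNReal.ofReal (waitingTime q₀ x j))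
  rw [aggregateWait, h]
  refine tsum_congr fun j => ?_
  rw [Set.indicator_apply]
  rfl

theorem measurable_wait (t : ℝ) (j : ℕ) : Measurable (fun x : Clock n → ℝ =>
    if epoch x (j + 1) ≤ t
      then ENNReal.ofReal (start q₀ x (.service j) - epoch x (j + 1)) else 0) :=
  Measurable.ite (measurableSet_le (measurable_epoch _) measurable_const)
    ((measurable_start q₀ _).sub (measurable_epoch _)).ennreal_ofReal measurable_const

theorem measurable_aggregateWait (t : ℝ) :
    Measurable (fun x : Clock n → ℝ => aggregateWait q₀ x t) := by
  simp only [aggregateWait_eq]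
  exact Measurable.tsum (measurable_wait t)

open Classical in
/-- The indicator of the event that customer `j` arrives in `[0, t]` and joins the server of the
customer with service clock `c`. -/
def joins (q₀ : Fin n → ℕ) (t : ℝ) (j : ℕ) (c : Clock n) (x : Clock n → ℝ) : ℝ≥0∞ :=
  if epoch x (j + 1) ≤ t ∧ c ∈ line q₀ x j (choice q₀ x j) then 1 else 0

theorem measurable_joins (t : ℝ) (j : ℕ) (c : Clock n) : Measurable (joins q₀ t j c) := by
  have : {x | c ∈ line q₀ x j (choice q₀ x j)}
      = ⋃ (L : Fin n → List (Clock n)) (v : Fin n) (_ : c ∈ L v),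
        {x | line q₀ x j = L} ∩ {x | choice q₀ x j = v} := by
    ext x
    simp only [Set.mem_ofPred_eq, Set.mem_iUnion, Set.mem_inter_iff]
    exact ⟨fun h => ⟨_, _, h, rfl, rfl⟩, by rintro ⟨_, _, h, rfl, rfl⟩; exact h⟩
  have hmem : MeasurableSet {x | c ∈ line q₀ x j (choice q₀ x j)} := by
    rw [this]
    exact MeasurableSet.iUnion fun L => MeasurableSet.iUnion fun v => MeasurableSet.iUnion fun _ =>
      (measurableSet_line q₀ j L).inter (measurable_choice q₀ j (measurableSet_singleton v))
  exact Measurable.ite ((measurableSet_le (measurable_epoch _) measurable_const).inter hmem)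
    measurable_const measurable_const

/-- The mean remaining service time of a customer who is at the server joined by customer `j`. -/
theorem lintegral_joins (hlam : 0 < lam) (t : ℝ) (j : ℕ) {c : Clock n} (hc : c.IsService) :
    ∫⁻ x, joins q₀ t j c x
        * ENNReal.ofReal (finish q₀ x c - max (start q₀ x c) (epoch x (j + 1))) ∂clockLaw n lam
      = ∫⁻ x, (if epoch x (j + 1) < finish q₀ x c then joins q₀ t j c x else 0)
        ∂clockLaw n lam := by
  refine lintegral_remaining_service q₀ hlam hc (j + 1) (measurable_joins t j c)
    fun x x' hx hx' h h1 h2 => ?_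
  have hne : ∀ k, Clock.interarrival k ≠ c ∧ Clock.tieBreak k ≠ c := fun k => by
    constructor <;> (rintro rfl; exact hc)
  have he : epoch x (j + 1) = epoch x' (j + 1) := epoch_congr fun k _ => h _ (hne k).1
  obtain ⟨hl, hd, _⟩ := causality q₀ hx hx' hc h h1 h2 (Nat.le_succ j)
  have hch : choice q₀ x j = choice q₀ x' j := by
    refine choice_congr q₀ ?_ (h _ (hne j).2)
    rw [← he]
    ext v
    exact AgreeUntil.remaining (hd v) le_rfl
  rw [joins, joins, hl, hch, he]

/-- The waiting time of customer `j` is at most the total remaining service time of the customers at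
the server that is joined. -/
theorem wait_le {x : Clock n → ℝ} (hx : Regular x) (t : ℝ) (j : ℕ) :
    (if epoch x (j + 1) ≤ t
      then ENNReal.ofReal (start q₀ x (.service j) - epoch x (j + 1)) else 0)
    ≤ ((customers q₀ j).map fun c => joins q₀ t j c x
        * ENNReal.ofReal (finish q₀ x c - max (start q₀ x c) (epoch x (j + 1)))).sum := by
  split_ifs with ht
  · rw [← sum_line q₀ x j]
    refine le_trans ?_ (Finset.single_le_sum (fun _ _ => zero_le)
      (Finset.mem_univ (choice q₀ x j)))
    have h := (fifo_line q₀ hx j (choice q₀ x j)).serviceStart_sub_le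
      (hx.strictMono_epoch.monotone (Nat.le_succ j))
    rw [map_finish_line] at h
    refine h.trans (le_of_eq ?_)
    congr 1
    refine List.map_congr_left fun c hc => ?_
    rw [joins, if_pos ⟨ht, hc⟩, one_mul]
  · exact zero_le

theorem sum_joins {x : Clock n → ℝ} (t : ℝ) (j : ℕ) :
    ((customers q₀ j).map fun c =>
        if epoch x (j + 1) < finish q₀ x c then joins q₀ t j c x else 0).sum
      = if epoch x (j + 1) ≤ t
        then (queue q₀ x j (epoch x (j + 1)) (choice q₀ x j) : ℝ≥0∞) else 0 := by
  rw [← sum_line q₀ x j]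
  split_ifs with ht
  · rw [Finset.sum_eq_single_of_mem _ (Finset.mem_univ (choice q₀ x j))]
    · rw [queue, ← map_finish_line]
      have : ∀ c ∈ line q₀ x j (choice q₀ x j), joins q₀ t j c x = 1 := fun c hc => by
        rw [joins, if_pos ⟨ht, hc⟩]
      generalize line q₀ x j (choice q₀ x j) = L at this
      induction L with
      | nil => simp [remaining]
      | cons c L ih =>
        rw [List.map_cons, List.sum_cons, ih fun c' hc' => this c' (List.mem_cons_of_mem _ hc'),
          List.map_cons, ← List.singleton_append, remaining_append, remaining_singleton,
          this c List.mem_cons_self]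
        push_cast
        rfl
    · intro v _ hv
      refine List.sum_eq_zero fun y hy => ?_
      obtain ⟨c, hc, rfl⟩ := List.mem_map.1 hy
      have h0 : joins q₀ t j c x = 0 := if_neg fun h => hv (eq_of_mem_line q₀ x hc h.2)
      rw [h0, ite_self]
  · refine Finset.sum_eq_zero fun v _ => List.sum_eq_zero fun y hy => ?_
    obtain ⟨c, hc, rfl⟩ := List.mem_map.1 hy
    have h0 : joins q₀ t j c x = 0 := if_neg fun h => ht h.1
    rw [h0, ite_self]

theorem lintegral_list_sum {α ι : Type*} [MeasurableSpace α] {μ : Measure α} (L : List ι)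
    {f : ι → α → ℝ≥0∞} (hf : ∀ c, Measurable (f c)) :
    ∫⁻ x, (L.map fun c => f c x).sum ∂μ = (L.map fun c => ∫⁻ x, f c x ∂μ).sum := by
  induction L with
  | nil => simp
  | cons c L ih =>
    simp only [List.map_cons, List.sum_cons]
    rw [lintegral_add_left (hf c), ih]

/-- A customer waits on average as long as there are customers at the shortest queue; this number is
at most the number of waiting customers divided by `n`, plus `1` if no server is idle. -/
theorem lintegral_aggregateWait_le (hlam : 0 < lam) (hlam1 : lam ≤ 1) (t : ℝ) :
    ∫⁻ x, aggregateWait q₀ x t ∂clockLaw n lam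
      ≤ occupation q₀ lam (fun q => (backlog q : ℝ≥0∞)) t
        + ENNReal.ofReal (lam * n)
          * occupation q₀ lam (fun q => ((if idle q = 0 then 1 else 0 : ℕ) : ℝ≥0∞)) t := by
  have hn : (n : ℝ≥0∞) ≠ 0 := Nat.cast_ne_zero.2 (NeZero.ne n)
  have hn' : (n : ℝ≥0∞) ≠ ∞ := by simp
  have hwait : ∫⁻ x, aggregateWait q₀ x t ∂clockLaw n lam
      ≤ ∫⁻ x, ∑' j, (if epoch x (j + 1) ≤ t
        then (queue q₀ x j (epoch x (j + 1)) (choice q₀ x j) : ℝ≥0∞) else 0) ∂clockLaw n lam := by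
    have hm : ∀ j c, Measurable (fun x : Clock n → ℝ =>
        if epoch x (j + 1) < finish q₀ x c then joins q₀ t j c x else 0) := fun j c =>
      Measurable.ite (measurableSet_lt (measurable_epoch _) (measurable_finish q₀ c))
        (measurable_joins t j c) measurable_const
    have hm' : ∀ j c, Measurable (fun x : Clock n → ℝ => joins q₀ t j c x
        * ENNReal.ofReal (finish q₀ x c - max (start q₀ x c) (epoch x (j + 1)))) := fun j c =>
      (measurable_joins t j c).mul ((measurable_finish q₀ c).sub
        ((measurable_start q₀ c).max (measurable_epoch _))).ennreal_ofReal
    simp only [aggregateWait_eq, ← sum_joins]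
    rw [lintegral_tsum fun j => (measurable_wait t j).aemeasurable, lintegral_tsum]
    swap
    · refine fun j => Measurable.aemeasurable ?_
      generalize customers q₀ j = L
      induction L with
      | nil => simp
      | cons c L ih =>
        simp only [List.map_cons, List.sum_cons]
        exact (hm j c).add ih
    refine ENNReal.tsum_le_tsum fun j => ?_
    calc _ ≤ ∫⁻ x, ((customers q₀ j).map fun c => joins q₀ t j c x
        * ENNReal.ofReal (finish q₀ x c - max (start q₀ x c) (epoch x (j + 1)))).sum
          ∂clockLaw n lam := by
          refine lintegral_mono_ae ?_
          filter_upwards [ae_regular hlam] with x hx using wait_le hx t j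
      _ = _ := by
          rw [lintegral_list_sum _ (hm' j), lintegral_list_sum _ (hm j)]
          congr 1
          exact List.map_congr_left fun c hc =>
            lintegral_joins hlam t j (isService_of_mem_customers hc)
  have hrate : ENNReal.ofReal (lam * n) ≤ n := by
    rw [← ENNReal.ofReal_natCast]
    exact ENNReal.ofReal_le_ofReal (mul_le_of_le_one_left (Nat.cast_nonneg n) hlam1)
  rw [← ENNReal.mul_le_mul_iff_right hn hn']
  calc (n : ℝ≥0∞) * ∫⁻ x, aggregateWait q₀ x t ∂clockLaw n lam
      ≤ n * ∫⁻ x, ∑' j, (if epoch x (j + 1) ≤ t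
        then (queue q₀ x j (epoch x (j + 1)) (choice q₀ x j) : ℝ≥0∞) else 0)
          ∂clockLaw n lam := by gcongr
    _ ≤ ENNReal.ofReal (lam * n) * occupation q₀ lam (fun q => (backlog q : ℝ≥0∞)
          + n * ((if idle q = 0 then 1 else 0 : ℕ) : ℝ≥0∞)) t := by
        rw [occupation_arrival hlam, ← lintegral_const_mul' _ _ hn']
        refine lintegral_mono fun x => ?_
        rw [← ENNReal.tsum_mul_left]
        refine ENNReal.tsum_le_tsum fun j => ?_
        by_cases ht : epoch x (j + 1) ≤ t
        · rw [if_pos ht, if_pos ht]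
          exact_mod_cast mul_le_backlog _ _ (choice_mem_shortest q₀ x j)
        · simp [ht]
    _ = ENNReal.ofReal (lam * n) * occupation q₀ lam (fun q => (backlog q : ℝ≥0∞)) t
        + n * (ENNReal.ofReal (lam * n)
          * occupation q₀ lam (fun q => ((if idle q = 0 then 1 else 0 : ℕ) : ℝ≥0∞)) t) := by
        rw [occupation_add hlam, occupation_mul hn']
        ring
    _ ≤ n * occupation q₀ lam (fun q => (backlog q : ℝ≥0∞)) t
        + n * (ENNReal.ofReal (lam * n)
          * occupation q₀ lam (fun q => ((if idle q = 0 then 1 else 0 : ℕ) : ℝ≥0∞)) t) := by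
        gcongr
    _ = _ := by ring

/-! ### The number of arrivals -/

theorem lintegral_exp_expMeasure {r a : ℝ} (hr : 0 < r) (ha : a < r) :
    ∫⁻ y, ENNReal.ofReal (Real.exp (a * y)) ∂expMeasure r = ENNReal.ofReal (r / (r - a)) := by
  have hra : 0 < r - a := by linarith
  have h1 : ∫⁻ y, ENNReal.ofReal (Real.exp (a * y)) ∂expMeasure r
      = ∫⁻ y, exponentialPDF r y * ENNReal.ofReal (Real.exp (a * y)) := by
    rw [expMeasure_eq]
    exact lintegral_withDensity_eq_lintegral_mul _ (measurable_exponentialPDF r) (by fun_prop)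
  rw [h1, ← mul_one (ENNReal.ofReal (r / (r - a))), ← lintegral_exponentialPDF_eq_one hra,
    ← lintegral_const_mul' _ _ ENNReal.ofReal_ne_top]
  refine lintegral_congr fun y => ?_
  rcases lt_or_ge y 0 with hy | hy
  · simp [exponentialPDF_of_neg hy]
  · rw [exponentialPDF_of_nonneg hy, exponentialPDF_of_nonneg hy,
      ← ENNReal.ofReal_mul (by positivity), ← ENNReal.ofReal_mul (by positivity), mul_assoc,
      ← Real.exp_add]
    congr 1
    rw [show -(r * y) + a * y = -((r - a) * y) by ring]
    field_simp

theorem lintegral_exp_epoch (hlam : 0 < lam) {a : ℝ} (ha : a < lam * n) (m : ℕ) :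
    ∫⁻ x, ENNReal.ofReal (Real.exp (a * epoch x m)) ∂clockLaw n lam
      = ENNReal.ofReal (lam * n / (lam * n - a)) ^ m := by
  have := isProbabilityMeasure_clockLaw (n := n) hlam
  have hn : (0 : ℝ) < n := Nat.cast_pos.2 (Nat.pos_of_ne_zero (NeZero.ne n))
  have hmeas : ∀ m, Measurable (fun x : Clock n → ℝ =>
      ENNReal.ofReal (Real.exp (a * epoch x m))) := fun m =>
    (Real.measurable_exp.comp ((measurable_epoch m).const_mul a)).ennreal_ofReal
  induction m with
  | zero => simp [epoch_zero]
  | succ m ih =>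
    rw [lintegral_clockLaw_update hlam (.interarrival m) (hmeas (m + 1)), pow_succ, ← ih,
      ← lintegral_mul_const' _ _ ENNReal.ofReal_ne_top]
    refine lintegral_congr fun x => ?_
    rw [← lintegral_exp_expMeasure (by positivity) ha,
      ← lintegral_const_mul' _ _ ENNReal.ofReal_ne_top]
    refine lintegral_congr fun y => ?_
    rw [epoch_succ, epoch_update_interarrival, Function.update_self, mul_add, Real.exp_add,
      ENNReal.ofReal_mul (Real.exp_pos _).le]

/-- Chernoff bounds for the arrival times. -/
theorem clockLaw_exp_le (hlam : 0 < lam) {a : ℝ} (ha : a < lam * n) (m : ℕ) {t ρ : ℝ}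
    (hρ : lam * n / (lam * n - a) ≤ Real.exp ρ) :
    clockLaw n lam {x | a * t ≤ a * epoch x m} ≤ ENNReal.ofReal (Real.exp (m * ρ - a * t)) := by
  have hmeas : Measurable (fun x : Clock n → ℝ =>
      ENNReal.ofReal (Real.exp (a * epoch x m))) :=
    (Real.measurable_exp.comp ((measurable_epoch m).const_mul a)).ennreal_ofReal
  have h := mul_meas_ge_le_lintegral₀ (μ := clockLaw n lam) hmeas.aemeasurable
    (ENNReal.ofReal (Real.exp (a * t)))
  rw [lintegral_exp_epoch hlam ha] at h
  have hset : {x : Clock n → ℝ | ENNReal.ofReal (Real.exp (a * t))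
      ≤ ENNReal.ofReal (Real.exp (a * epoch x m))} = {x | a * t ≤ a * epoch x m} := by
    ext x
    simp only [Set.mem_ofPred_eq]
    rw [ENNReal.ofReal_le_ofReal_iff (Real.exp_pos _).le, Real.exp_le_exp]
  rw [hset] at h
  have h0 : ENNReal.ofReal (Real.exp (a * t)) ≠ 0 := by simp [Real.exp_pos]
  rw [← ENNReal.mul_le_mul_iff_right h0 ENNReal.ofReal_ne_top]
  refine h.trans ?_
  rw [← ENNReal.ofReal_mul (Real.exp_pos _).le, ← Real.exp_add, add_sub_cancel, Real.exp_nat_mul,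
    ENNReal.ofReal_pow (Real.exp_pos _).le]
  gcongr

/-- Up to an exponentially small probability, the number of arrivals in `[0, t]` is between
`(t / 8) n` and `(2 t + 1) n`. -/
theorem clockLaw_arrivals_le (hlam : 1 / 2 ≤ lam) (hlam1 : lam ≤ 1) {t : ℝ} (ht : 0 < t) :
    clockLaw n lam {x | ¬ (ENNReal.ofReal (t / 8 * n) ≤ (arrivals x t : ℝ≥0∞) ∧
        (arrivals x t : ℝ≥0∞) ≤ ENNReal.ofReal ((2 * t + 1) * n))}
      ≤ ENNReal.ofReal (Real.exp (1 - t / 8 * n)) + ENNReal.ofReal (Real.exp (-n)) := by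
  have hlam0 : 0 < lam := by linarith
  have hn : (0 : ℝ) < n := Nat.cast_pos.2 (Nat.pos_of_ne_zero (NeZero.ne n))
  set r := lam * n with hr
  have hr0 : 0 < r := by positivity
  have hrn : r ≤ n := mul_le_of_le_one_left hn.le hlam1
  have hrn' : n / 2 ≤ r := by nlinarith
  set m₁ := ⌈t / 8 * n⌉₊ with hm₁
  set m₂ := ⌊(2 * t + 1) * n⌋₊ + 1 with hm₂
  have h2 : (2 : ℝ) ≤ Real.exp 1 := by have := Real.add_one_le_exp (1 : ℝ); linarith
  have h3 : (1 : ℝ) / 3 ≤ Real.exp (-1) := by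
    rw [Real.exp_neg, one_div]
    exact inv_anti₀ (Real.exp_pos 1) (Real.exp_one_lt_d9.le.trans (by norm_num))
  -- at `r / 2` and `-2 * r`, the moment generating function of an interarrival time is `2` and
  -- `1 / 3`; these values are compared with `exp 1` and `exp (-1)`
  have hlow := clockLaw_exp_le (n := n) hlam0 (a := r / 2) (by linarith) m₁ (t := t) (ρ := 1)
    (by rw [← hr, show r / (r - r / 2) = 2 by field_simp; norm_num]; exact h2)
  have hhigh := clockLaw_exp_le (n := n) hlam0 (a := -2 * r) (by linarith) m₂ (t := t) (ρ := -1)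
    (by rw [← hr, show r / (r - -2 * r) = 1 / 3 by field_simp; norm_num]; exact h3)
  have hsub : {x | ¬ (ENNReal.ofReal (t / 8 * n) ≤ (arrivals x t : ℝ≥0∞) ∧
        (arrivals x t : ℝ≥0∞) ≤ ENNReal.ofReal ((2 * t + 1) * n))} ≤ᵐ[clockLaw n lam]
      ({x | r / 2 * t ≤ r / 2 * epoch x m₁} ∪ {x | -2 * r * t ≤ -2 * r * epoch x m₂} :
        Set (Clock n → ℝ)) := by
    filter_upwards [ae_good hlam0] with x hx hcon
    obtain ⟨J, hJ⟩ := hx.exists_window ht.le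
    have harr : (arrivals x t : ℝ≥0∞) = ENNReal.ofReal J := by
      rw [hx.arrivals_eq hJ, ENNReal.ofReal_natCast]; rfl
    change ¬ _ at hcon
    rw [harr, not_and_or, not_le, not_le] at hcon
    rcases hcon with hcon | hcon
    · left
      have hlt := (ENNReal.ofReal_lt_ofReal_iff (by positivity)).1 hcon
      have hJm : J + 1 ≤ m₁ := by
        have h := hlt.trans_le (Nat.le_ceil (t / 8 * n))
        exact_mod_cast h
      have := hJ.2.le.trans (hx.strictMono_epoch.monotone hJm)
      change r / 2 * t ≤ r / 2 * epoch x m₁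
      gcongr
    · right
      have hlt := lt_of_not_ge fun h => absurd hcon (not_lt.2 (ENNReal.ofReal_le_ofReal h))
      have hJm : m₂ ≤ J := (Nat.floor_lt (by positivity)).2 hlt
      have := (hx.strictMono_epoch.monotone hJm).trans hJ.1
      change -2 * r * t ≤ -2 * r * epoch x m₂
      nlinarith
  refine (measure_mono_ae hsub).trans ((measure_union_le _ _).trans
    (add_le_add (hlow.trans ?_) (hhigh.trans ?_)))
  · refine ENNReal.ofReal_le_ofReal (Real.exp_le_exp.2 ?_)
    have := (Nat.ceil_lt_add_one (show 0 ≤ t / 8 * n by positivity)).le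
    rw [← hm₁] at this
    nlinarith
  · refine ENNReal.ofReal_le_ofReal (Real.exp_le_exp.2 ?_)
    have := (Nat.lt_floor_add_one ((2 * t + 1) * (n : ℝ))).le
    have h4 : (m₂ : ℝ) = ⌊(2 * t + 1) * (n : ℝ)⌋₊ + 1 := by rw [hm₂]; push_cast; rfl
    rw [← h4] at this
    nlinarith

end

section

/-! ### Random initial queue lengths -/

section Input

variable {Ω : Type*} [MeasurableSpace Ω] {P : Measure Ω} [IsProbabilityMeasure P] {n : ℕ}
  [NeZero n] {lam : ℝ} {init : Ω → Fin n → ℕ} {clock : Clock n → Ω → ℝ}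

theorem IsInput.map_clock (h : IsInput P n lam init clock) (hlam : 0 < lam) :
    P.map (fun ω c => clock c ω) = clockLaw n lam := by
  have := isProbabilityMeasure_law (n := n) hlam
  rw [(iIndepFun_iff_map_fun_eq_infinitePi_map h.measurable_clock).1 h.iIndepFun_clock, clockLaw]
  congr 1
  ext1 c
  exact (h.hasLaw_clock c).map_eq

/-- A bound for fixed initial queue lengths in a set `G` gives one for random queue lengths. -/
theorem IsInput.measure_le (h : IsInput P n lam init clock) (hlam : 0 < lam)
    (G : Set (Fin n → ℕ)) (E : (Fin n → ℕ) → Set (Clock n → ℝ)) {ε : ℝ≥0∞}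
    (hE : ∀ q ∈ G, clockLaw n lam (E q) ≤ ε) :
    P {ω | (fun c => clock c ω) ∈ E (init ω)} ≤ P {ω | init ω ∉ G} + ε := by
  -- `E q` need not be measurable
  set E' := fun q => toMeasurable (clockLaw n lam) (E q) with hE'
  have hclock : Measurable (fun ω c => clock c ω) := measurable_pi_iff.2 h.measurable_clock
  have hsub : {ω | (fun c => clock c ω) ∈ E (init ω)} ⊆ {ω | init ω ∉ G} ∪
      ⋃ q : G, (init ⁻¹' {(q : Fin n → ℕ)} ∩ (fun ω c => clock c ω) ⁻¹' E' q) := by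
    intro ω hω
    by_cases hG : init ω ∈ G
    · exact .inr (Set.mem_iUnion.2 ⟨⟨_, hG⟩, rfl, subset_toMeasurable _ _ hω⟩)
    · exact .inl hG
  refine (measure_mono hsub).trans ((measure_union_le _ _).trans (add_le_add le_rfl ?_))
  refine (measure_iUnion_le _).trans ?_
  have hterm : ∀ q : G, P (init ⁻¹' {(q : Fin n → ℕ)} ∩ (fun ω c => clock c ω) ⁻¹' E' q)
      ≤ P (init ⁻¹' {(q : Fin n → ℕ)}) * ε := by
    intro q
    rw [h.indepFun_init_clock.measure_inter_preimage_eq_mul _ _ (measurableSet_singleton _)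
      (measurableSet_toMeasurable _ _)]
    gcongr
    rw [← Measure.map_apply hclock (measurableSet_toMeasurable _ _), h.map_clock hlam,
      measure_toMeasurable]
    exact hE q q.2
  calc ∑' q : G, P (init ⁻¹' {(q : Fin n → ℕ)} ∩ (fun ω c => clock c ω) ⁻¹' E' q)
      ≤ ∑' q : G, P (init ⁻¹' {(q : Fin n → ℕ)}) * ε := ENNReal.tsum_le_tsum hterm
    _ = P (⋃ q : G, init ⁻¹' {(q : Fin n → ℕ)}) * ε := by
        rw [ENNReal.tsum_mul_right, measure_iUnion]
        · intro q q' hqq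
          exact Disjoint.preimage _ (Set.disjoint_singleton.2 fun h => hqq (Subtype.ext h))
        · exact fun q => h.measurable_init (measurableSet_singleton _)
    _ ≤ 1 * ε := by gcongr; exact prob_le_one
    _ = ε := one_mul ε

end Input

/-- Markov's inequality for a waiting time of order `√n`. -/
theorem clockLaw_ge_le {n : ℕ} [NeZero n] {lam : ℝ} {Z : (Clock n → ℝ) → ℝ≥0∞}
    (hZ : AEMeasurable Z (clockLaw n lam)) {B : ℝ}
    (hB : ∫⁻ x, Z x ∂clockLaw n lam ≤ ENNReal.ofReal (B * √n)) {C : ℝ} (hC : 0 < C) :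
    clockLaw n lam {x | ENNReal.ofReal (C * √n) ≤ Z x} ≤ ENNReal.ofReal (B / C) := by
  have hn : (0 : ℝ) < n := Nat.cast_pos.2 (Nat.pos_of_ne_zero (NeZero.ne n))
  have hsqrt : 0 < √(n : ℝ) := Real.sqrt_pos.2 hn
  have h0 : 0 < C * √n := by positivity
  refine (meas_ge_le_lintegral_div hZ (by simpa using h0) ENNReal.ofReal_ne_top).trans ?_
  refine (ENNReal.div_le_div_right hB _).trans ?_
  rw [← ENNReal.ofReal_div_of_pos h0, mul_div_mul_right _ _ hsqrt.ne']

/-- Probabilities `u n C` of exceeding the level `C` that are small for large `C`, uniformly in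
all large `n`. -/
def SmallTails (u : ℕ+ → ℝ → ℝ≥0∞) : Prop :=
  ∀ ε : ℝ≥0∞, 0 < ε → ∃ B : ℝ, ∀ C : ℝ, 0 < C → ∀ᶠ n in atTop, u n C ≤ ε + ENNReal.ofReal (B / C)

theorem SmallTails.tendsto {u : ℕ+ → ℝ → ℝ≥0∞} (h : SmallTails u) :
    Tendsto (fun C => limsup (fun n => u n C) atTop) atTop (𝓝 0) := by
  rw [ENNReal.tendsto_nhds_zero]
  intro ε hε
  have hε2 : 0 < ε / 2 := ENNReal.half_pos hε.ne'
  obtain ⟨B, hB⟩ := h (ε / 2) hε2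
  have hlim : Tendsto (fun C : ℝ => ENNReal.ofReal (B / C)) atTop (𝓝 0) := by
    rw [← ENNReal.ofReal_zero]
    exact ENNReal.tendsto_ofReal (tendsto_const_nhds.div_atTop tendsto_id)
  filter_upwards [eventually_gt_atTop 0, (ENNReal.tendsto_nhds_zero.1 hlim) (ε / 2) hε2]
    with C hC hC'
  calc limsup (fun n => u n C) atTop ≤ ε / 2 + ENNReal.ofReal (B / C) :=
        limsup_le_of_le (by isBoundedDefault) (hB C hC)
    _ ≤ ε / 2 + ε / 2 := by gcongr
    _ = ε := ENNReal.add_halves ε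

/-- Division by a number of arrivals that is at least `c * n` with high probability. -/
theorem SmallTails.div {u u' : ℕ+ → ℝ → ℝ≥0∞} (h : SmallTails u) {c : ℝ} (hc : 0 < c)
    {p : ℕ+ → ℝ≥0∞} (hp : Tendsto p atTop (𝓝 0))
    (hu : ∀ n C, 0 < C → u' n C ≤ p n + u n (c * C)) : SmallTails u' := by
  intro ε hε
  have hε2 : 0 < ε / 2 := ENNReal.half_pos hε.ne'
  obtain ⟨B, hB⟩ := h (ε / 2) hε2
  refine ⟨B / c, fun C hC => ?_⟩
  filter_upwards [ENNReal.tendsto_nhds_zero.1 hp _ hε2, hB (c * C) (by positivity)] with n h1 h2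
  calc u' n C ≤ ε / 2 + (ε / 2 + ENNReal.ofReal (B / (c * C))) :=
        (hu n C hC).trans (add_le_add h1 h2)
    _ = ε + ENNReal.ofReal (B / c / C) := by
        rw [← add_assoc, ENNReal.add_halves, div_div]

/-- A sequence that converges in distribution is tight. -/
theorem exists_tail_le {Ω : ℕ+ → Type*} [∀ n, MeasurableSpace (Ω n)]
    {P : ∀ n, Measure (Ω n)} [∀ n, IsProbabilityMeasure (P n)] {Ω' : Type*} [MeasurableSpace Ω']
    {P' : Measure Ω'} [IsProbabilityMeasure P'] {X : ∀ n, Ω n → ℝ} {Y : Ω' → ℝ}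
    (h : TendstoInDistribution X atTop Y P P') {ε : ℝ≥0∞} (hε : 0 < ε) :
    ∃ K : ℝ, 0 < K ∧ ∀ᶠ n in atTop, P n {ω | K ≤ |X n ω|} ≤ ε := by
  have hY := Measure.isProbabilityMeasure_map (μ := P') h.aemeasurable_limit
  have hclosed : ∀ K : ℝ, IsClosed {y : ℝ | K ≤ |y|} := fun K =>
    isClosed_le continuous_const continuous_abs
  have hlim : Tendsto (fun K : ℕ => P'.map Y {y | (K : ℝ) ≤ |y|}) atTop (𝓝 0) := by
    have hempty : ⋂ K : ℕ, {y : ℝ | (K : ℝ) ≤ |y|} = ∅ := by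
      ext y
      simp only [Set.mem_iInter, Set.mem_ofPred_eq, Set.mem_empty_iff_false, iff_false, not_forall,
        not_le]
      exact exists_nat_gt |y|
    rw [← measure_empty (μ := P'.map Y), ← hempty]
    refine tendsto_measure_iInter_atTop (fun K => (hclosed K).measurableSet.nullMeasurableSet)
      (fun K K' hK y hy => ?_) ⟨0, measure_ne_top _ _⟩
    exact le_trans (Nat.cast_le.2 hK) (show (K' : ℝ) ≤ |y| from hy)
  obtain ⟨K, hK, hK1⟩ := ((hlim.eventually (gt_mem_nhds hε)).and (eventually_ge_atTop 1)).exists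
  refine ⟨K, by exact_mod_cast hK1, ?_⟩
  have hsup := ProbabilityMeasure.limsup_measure_closed_le_of_tendsto h.tendsto (hclosed K)
  filter_upwards [eventually_lt_of_limsup_lt (hsup.trans_lt hK)] with n hn
  refine le_trans (le_of_eq ?_) hn.le
  exact (Measure.map_apply_of_aemeasurable (h.forall_aemeasurable n)
    (hclosed K).measurableSet).symm

/-- If all scaled numbers are bounded by `K`, and if they vanish beyond `k`, then there are at most
`K √n` idle servers and `k K √n` waiting customers. -/
theorem idle_backlog_le {n : ℕ} [NeZero n] {q : Fin n → ℕ} {k : ℕ} {K : ℝ}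
    (hK : ∀ i, 0 < i → |scaled q i| ≤ K) (hk : ∀ i, k < i → scaled q i = 0) :
    (idle q : ℝ) ≤ K * √n ∧ (backlog q : ℝ) ≤ k * K * √n := by
  have hn : (0 : ℝ) < n := Nat.cast_pos.2 (Nat.pos_of_ne_zero (NeZero.ne n))
  have hsqrt : 0 < √(n : ℝ) := Real.sqrt_pos.2 hn
  constructor
  · have h1 := (neg_le_abs _).trans (hK 1 one_pos)
    have h2 : atLeast q 1 + idle q = n := by
      have := Finset.card_filter_add_card_filter_not (s := (Finset.univ : Finset (Fin n)))
        (fun v => 1 ≤ q v)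
      rw [Finset.card_univ, Fintype.card_fin] at this
      rw [atLeast, idle]
      convert! this using 4
      omega
    have h3 : (atLeast q 1 : ℝ) + idle q = n := by exact_mod_cast h2
    rw [scaled, if_pos rfl, ← neg_div, div_le_iff₀ hsqrt] at h1
    linarith
  · have hle : ∀ i, (atLeast q (i + 2) : ℝ) ≤ K * √n := fun i => by
      have h1 := (le_abs_self _).trans (hK (i + 2) (by omega))
      rwa [scaled, if_neg (by omega), div_le_iff₀ hsqrt] at h1
    have hM : ∀ v, q v - 1 ≤ k := by
      intro v
      by_contra! hv
      have h1 := hk (k + 2) (by omega)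
      rw [scaled, if_neg (by omega), div_eq_zero_iff] at h1
      have h2 : atLeast q (k + 2) = 0 := by
        exact_mod_cast h1.resolve_right hsqrt.ne'
      rw [atLeast, Finset.card_eq_zero, Finset.filter_eq_empty_iff] at h2
      exact h2 (Finset.mem_univ v) (by omega)
    rw [← sum_atLeast q hM, Nat.cast_sum]
    refine (Finset.sum_le_card_nsmul _ _ _ fun i _ => hle i).trans (le_of_eq ?_)
    rw [Finset.card_range, nsmul_eq_mul]
    ring

end

end JSQ

/-! ### The asymptotics -/

theorem theorem3
    -- the Halfin-Whitt regime
    (lam : ℕ+ → ℝ) (hlam : ∀ n, 0 < lam n ∧ lam n < 1) (β : ℝ) (hβ : 0 < β)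
    (hlim : Tendsto (fun n : ℕ+ => √(n : ℝ) * (1 - lam n)) atTop (𝓝 β))
    -- for each `n`, an `M/M/n`-JSQ system with arrival rate `lam n * n`
    {Ω : ℕ+ → Type*} [∀ n, MeasurableSpace (Ω n)]
    (P : ∀ n, Measure (Ω n)) [∀ n, IsProbabilityMeasure (P n)]
    (init : ∀ n : ℕ+, Ω n → Fin n → ℕ) (clock : ∀ n : ℕ+, JSQ.Clock n → Ω n → ℝ)
    (hinput : ∀ n, JSQ.IsInput (P n) n (lam n) (init n) (clock n))
    -- the scaled initial states converge in distribution and have no coordinates beyond `k`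
    (k : ℕ) {Ω' : Type*} [MeasurableSpace Ω'] (P' : Measure Ω') [IsProbabilityMeasure P']
    (X₀ : Fin k → Ω' → ℝ)
    (hinit : ∀ i : Fin k,
      TendstoInDistribution (fun n ω => JSQ.scaled (init n ω) (i + 1)) atTop (X₀ i) P P')
    (hinit_zero : ∀ n, ∀ᵐ ω ∂(P n), ∀ i, k < i → JSQ.scaled (init n ω) i = 0)
    (t : ℝ) (ht : 0 ≤ t) :
    -- the waiting time of the customers who arrive in `[0, t]` is `O(√n)` in probability
    Tendsto (fun C : ℝ => limsup (fun n : ℕ+ => P n {ω |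
        ENNReal.ofReal (C * √(n : ℝ)) ≤
          JSQ.aggregateWait (init n ω) (fun c => clock n c ω) t}) atTop) atTop (𝓝 0) ∧
    -- so is the waiting time that all customers accumulate during `[0, t]`
    Tendsto (fun C : ℝ => limsup (fun n : ℕ+ => P n {ω |
        ENNReal.ofReal (C * √(n : ℝ)) ≤
          JSQ.waitDuring (init n ω) (fun c => clock n c ω) t}) atTop) atTop (𝓝 0) ∧
    (0 < t →
      -- the number of arrivals in `[0, t]` is of order `n` with high probability
      (∃ c₁ c₂ : ℝ, 0 < c₁ ∧ c₁ ≤ c₂ ∧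
        Tendsto (fun n : ℕ+ => P n {ω |
          ENNReal.ofReal (c₁ * n) ≤ (JSQ.arrivals (fun c => clock n c ω) t : ℝ≥0∞) ∧
          (JSQ.arrivals (fun c => clock n c ω) t : ℝ≥0∞) ≤ ENNReal.ofReal (c₂ * n)})
          atTop (𝓝 1)) ∧
      -- both waiting times, per arrival in `[0, t]`, are `O(1 / √n)` in probability
      Tendsto (fun C : ℝ => limsup (fun n : ℕ+ => P n {ω |
        ENNReal.ofReal (C / √(n : ℝ)) ≤
          JSQ.aggregateWait (init n ω) (fun c => clock n c ω) t /
            (JSQ.arrivals (fun c => clock n c ω) t : ℝ≥0∞)}) atTop) atTop (𝓝 0) ∧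
      Tendsto (fun C : ℝ => limsup (fun n : ℕ+ => P n {ω |
        ENNReal.ofReal (C / √(n : ℝ)) ≤
          JSQ.waitDuring (init n ω) (fun c => clock n c ω) t /
            (JSQ.arrivals (fun c => clock n c ω) t : ℝ≥0∞)}) atTop) atTop (𝓝 0)) := by
  have hsqrt : ∀ n : ℕ+, 0 < √(n : ℝ) := fun n => Real.sqrt_pos.2 (Nat.cast_pos.2 n.pos)
  have hdiv : ∀ n : ℕ+, √(n : ℝ) * √(n : ℝ) = n := fun n => Real.mul_self_sqrt (Nat.cast_nonneg _)
  have hsqrt_top : Tendsto (fun n : ℕ+ => √(n : ℝ)) atTop atTop :=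
    Real.tendsto_sqrt_atTop.comp (tendsto_natCast_atTop_atTop.comp tendsto_PNat_val_atTop_atTop)
  -- the Halfin-Whitt regime
  have hb : ∀ᶠ n : ℕ+ in atTop, (1 - lam n) * n ≤ (β + 1) * √(n : ℝ) := by
    filter_upwards [hlim.eventually (gt_mem_nhds (lt_add_one β))] with n hn
    calc (1 - lam n) * n = (1 - lam n) * (√(n : ℝ) * √(n : ℝ)) := by rw [hdiv n]
      _ = (√(n : ℝ) * (1 - lam n)) * √(n : ℝ) := by ring
      _ ≤ _ := by gcongr
  have hhalf : ∀ᶠ n : ℕ+ in atTop, 1 / 2 ≤ lam n := by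
    filter_upwards [hb, hsqrt_top.eventually_ge_atTop (2 * (β + 1))] with n h1 h2
    have h3 : (1 - lam n) * √(n : ℝ) ≤ β + 1 := by
      refine le_of_mul_le_mul_right ?_ (hsqrt n)
      rwa [mul_assoc, hdiv n]
    nlinarith [hsqrt n, (hlam n).2]
  -- the initial state is bounded on the scale `√n`, up to small probabilities
  have hgood : ∀ ε : ℝ≥0∞, 0 < ε → ∃ K : ℝ, 0 ≤ K ∧ ∀ᶠ n : ℕ+ in atTop,
      P n {ω | init n ω ∉ {q : Fin n → ℕ | (JSQ.idle q : ℝ) ≤ K * √(n : ℝ) ∧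
        (JSQ.backlog q : ℝ) ≤ K * √(n : ℝ)}} ≤ ε := by
    intro ε hε
    have hεk : 0 < ε / k := ENNReal.div_pos hε.ne' (by simp)
    choose κ hκ0 hκ using fun i => JSQ.exists_tail_le (hinit i) hεk
    set K := ∑ i, κ i with hK
    have hK0 : 0 ≤ K := Finset.sum_nonneg fun i _ => (hκ0 i).le
    refine ⟨(k + 1) * K, by positivity, ?_⟩
    filter_upwards [eventually_all.2 hκ] with n hn
    have hsub : {ω | init n ω ∉ {q : Fin n → ℕ | (JSQ.idle q : ℝ) ≤ (k + 1) * K * √(n : ℝ) ∧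
        (JSQ.backlog q : ℝ) ≤ (k + 1) * K * √(n : ℝ)}} ≤ᵐ[P n]
        (⋃ i : Fin k, {ω | κ i ≤ |JSQ.scaled (init n ω) (i + 1)|} : Set (Ω n)) := by
      filter_upwards [hinit_zero n] with ω hω hcon
      by_contra hall
      replace hall : ¬ ω ∈ (⋃ i : Fin k, {ω | κ i ≤ |JSQ.scaled (init n ω) (i + 1)|} : Set (Ω n)) :=
        hall
      simp only [Set.mem_iUnion, Set.mem_ofPred_eq, not_exists, not_le] at hall
      have hbound : ∀ i, 0 < i → |JSQ.scaled (init n ω) i| ≤ K := by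
        intro i hi
        by_cases hik : i ≤ k
        · have h1 := hall ⟨i - 1, by omega⟩
          rw [show ((⟨i - 1, by omega⟩ : Fin k) : ℕ) + 1 = i by simp; omega] at h1
          exact h1.le.trans (Finset.single_le_sum (fun i _ => (hκ0 i).le) (Finset.mem_univ _))
        · rw [hω i (by omega), abs_zero]; exact hK0
      obtain ⟨h1, h2⟩ := JSQ.idle_backlog_le hbound hω
      have h3 : (0 : ℝ) ≤ k * (K * √(n : ℝ)) := by positivity
      have h4 : 0 ≤ K * √(n : ℝ) := by positivity
      exact hcon ⟨by nlinarith, by nlinarith⟩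
    calc _ ≤ P n (⋃ i : Fin k, {ω | κ i ≤ |JSQ.scaled (init n ω) (i + 1)|}) :=
          measure_mono_ae hsub
      _ ≤ ∑ i : Fin k, P n {ω | κ i ≤ |JSQ.scaled (init n ω) (i + 1)|} :=
          measure_iUnion_fintype_le _ _
      _ ≤ ∑ _i : Fin k, ε / k := Finset.sum_le_sum fun i _ => hn i
      _ ≤ ε := by
        rw [Finset.sum_const, Finset.card_univ, Fintype.card_fin, nsmul_eq_mul]
        exact ENNReal.mul_div_le
  -- Markov's inequality for fixed initial queue lengths in this range
  have key : ∀ Z : (n : ℕ+) → (Fin n → ℕ) → (JSQ.Clock n → ℝ) → ℝ≥0∞,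
      (∀ n q, AEMeasurable (Z n q) (JSQ.clockLaw n (lam n))) →
      (∀ K : ℝ, 0 ≤ K → ∃ B : ℝ, ∀ (n : ℕ+) (q : Fin n → ℕ),
        (1 - lam n) * n ≤ (β + 1) * √(n : ℝ) → (JSQ.idle q : ℝ) ≤ K * √(n : ℝ) →
        (JSQ.backlog q : ℝ) ≤ K * √(n : ℝ) →
        ∫⁻ x, Z n q x ∂JSQ.clockLaw n (lam n) ≤ ENNReal.ofReal (B * √(n : ℝ))) →
      JSQ.SmallTails fun n C => P n {ω | ENNReal.ofReal (C * √(n : ℝ)) ≤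
        Z n (init n ω) (fun c => clock n c ω)} := by
    intro Z hZ hbound ε hε
    obtain ⟨K, hK, hgoodK⟩ := hgood ε hε
    obtain ⟨B, hB⟩ := hbound K hK
    refine ⟨B, fun C hC => ?_⟩
    filter_upwards [hgoodK, hb] with n h1 h2
    refine ((hinput n).measure_le (hlam n).1
      {q : Fin n → ℕ | (JSQ.idle q : ℝ) ≤ K * √(n : ℝ) ∧ (JSQ.backlog q : ℝ) ≤ K * √(n : ℝ)}
      (fun q => {x | ENNReal.ofReal (C * √(n : ℝ)) ≤ Z n q x}) fun q hq => ?_).trans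
      (add_le_add h1 le_rfl)
    exact JSQ.clockLaw_ge_le (hZ n q) (hB n q h2 hq.1 hq.2) hC
  have hwait := key (fun n q x => JSQ.aggregateWait q x t)
    (fun n q => (JSQ.measurable_aggregateWait t).aemeasurable) fun K hK => by
      obtain ⟨B, hB0, hB⟩ := JSQ.exists_occupation_le (β + 1) K hK ht
      refine ⟨B + B, fun n q h1 h2 h3 => ?_⟩
      obtain ⟨h4, h5⟩ := hB n (lam n) q (hlam n).1 (hlam n).2.le h1 h2 h3
      refine (JSQ.lintegral_aggregateWait_le (hlam n).1 (hlam n).2.le t).trans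
        ((add_le_add h4 h5).trans (le_of_eq ?_))
      rw [← ENNReal.ofReal_add (by positivity) (by positivity), add_mul]
  have hduring := key (fun n q x => JSQ.waitDuring q x t)
    (fun n q => JSQ.aemeasurable_waitDuring (hlam n).1 t) fun K hK => by
      obtain ⟨B, hB0, hB⟩ := JSQ.exists_occupation_le (β + 1) K hK ht
      refine ⟨B, fun n q h1 h2 h3 => ?_⟩
      rw [JSQ.lintegral_waitDuring (hlam n).1]
      exact (hB n (lam n) q (hlam n).1 (hlam n).2.le h1 h2 h3).1
  refine ⟨hwait.tendsto, hduring.tendsto, fun ht0 => ?_⟩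
  -- the number of arrivals
  set good : (n : ℕ+) → Set (Ω n) := fun n => {ω |
    ENNReal.ofReal (t / 8 * n) ≤ (JSQ.arrivals (fun c => clock n c ω) t : ℝ≥0∞) ∧
    (JSQ.arrivals (fun c => clock n c ω) t : ℝ≥0∞) ≤ ENNReal.ofReal ((2 * t + 1) * n)}
  have hbad : Tendsto (fun n => P n (good n)ᶜ) atTop (𝓝 0) := by
    have hcast : Tendsto (fun n : ℕ+ => (n : ℝ)) atTop atTop :=
      tendsto_natCast_atTop_atTop.comp tendsto_PNat_val_atTop_atTop
    have hlim1 : Tendsto (fun n : ℕ+ => ENNReal.ofReal (Real.exp (1 - t / 8 * n))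
        + ENNReal.ofReal (Real.exp (-n))) atTop (𝓝 0) := by
      have h1 : Tendsto (fun n : ℕ+ => Real.exp (1 - t / 8 * n)) atTop (𝓝 0) :=
        Real.tendsto_exp_atBot.comp (tendsto_atBot_add_const_left _ 1
          (tendsto_neg_atTop_atBot.comp (hcast.const_mul_atTop (by positivity : 0 < t / 8))))
      have h2 : Tendsto (fun n : ℕ+ => Real.exp (-(n : ℝ))) atTop (𝓝 0) :=
        Real.tendsto_exp_atBot.comp (tendsto_neg_atTop_atBot.comp hcast)
      simpa using (ENNReal.tendsto_ofReal h1).add (ENNReal.tendsto_ofReal h2)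
    refine tendsto_of_tendsto_of_tendsto_of_le_of_le' tendsto_const_nhds hlim1
      (Eventually.of_forall fun _ => zero_le) ?_
    filter_upwards [hhalf] with n hn
    have h := (hinput n).measure_le (hlam n).1 Set.univ (fun _ => _) fun _ _ =>
      JSQ.clockLaw_arrivals_le hn (hlam n).2.le ht0
    refine le_trans (le_of_eq ?_) (h.trans (le_of_eq ?_))
    · rfl
    · simp
  have hratio : ∀ Z : (n : ℕ+) → Ω n → ℝ≥0∞,
      (JSQ.SmallTails fun n C => P n {ω | ENNReal.ofReal (C * √(n : ℝ)) ≤ Z n ω}) →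
      Tendsto (fun C : ℝ => limsup (fun n : ℕ+ => P n {ω | ENNReal.ofReal (C / √(n : ℝ)) ≤
        Z n ω / (JSQ.arrivals (fun c => clock n c ω) t : ℝ≥0∞)}) atTop) atTop (𝓝 0) := by
    intro Z hZ
    refine JSQ.SmallTails.tendsto
      (JSQ.SmallTails.div hZ (by positivity : 0 < t / 8) hbad fun n C hC => ?_)
    refine (measure_mono fun ω hω => ?_).trans (measure_union_le _ _)
    by_cases hωg : ω ∈ good n
    swap
    · exact .inl hωg
    right
    have hn : (0 : ℝ) < n := Nat.cast_pos.2 n.pos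
    have hA0 : (JSQ.arrivals (fun c => clock n c ω) t : ℝ≥0∞) ≠ 0 :=
      ((ENNReal.ofReal_pos.2 (by positivity)).trans_le hωg.1).ne'
    have hAtop : (JSQ.arrivals (fun c => clock n c ω) t : ℝ≥0∞) ≠ ∞ :=
      ne_top_of_le_ne_top ENNReal.ofReal_ne_top hωg.2
    refine le_trans (le_trans (le_of_eq ?_) (mul_le_mul_right hωg.1 _))
      ((ENNReal.le_div_iff_mul_le (.inl hA0) (.inl hAtop)).1 hω)
    have h1 := hsqrt n
    rw [← ENNReal.ofReal_mul (by positivity)]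
    congr 1
    calc t / 8 * C * √(n : ℝ) = C / √(n : ℝ) * (t / 8 * (√(n : ℝ) * √(n : ℝ))) := by field_simp
      _ = _ := by rw [hdiv n]
  refine ⟨⟨t / 8, 2 * t + 1, by positivity, by linarith, ?_⟩, hratio _ hwait, hratio _ hduring⟩
  have hone : Tendsto (fun n => 1 - P n (good n)ᶜ) atTop (𝓝 1) := by
    simpa using ENNReal.Tendsto.sub tendsto_const_nhds hbad (.inl ENNReal.one_ne_top)
  refine tendsto_of_tendsto_of_tendsto_of_le_of_le hone tendsto_const_nhds (fun n => ?_)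
    fun n => prob_le_one
  refine tsub_le_iff_right.2 ?_
  rw [← measure_univ (μ := P n), ← Set.union_compl_self (good n)]
  exact measure_union_le _ _

end
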